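/- **Notation.** Let $N\ge 1$, let $\hbar\in\mathbb C$ be such that $q=e^{\hbar}$ satisfies $|q|<1$ (write $q^{a}=e^{a\hbar}$), and let $p$ be an indeterminate. Let $V=\{x\in\mathbb C^N:\sum_i x_i=0\}$ and $\bar\epsilon_i=\epsilon_i-\frac1N\sum_k\epsilon_k\in V$. Let $\mathbb F$ be the field of meromorphic functions $f(P+h,P)$ on $V\times V$; the coordinate functions on the two factors are $(P+h)_{\bar\epsilon_j}$ and $P_{\bar\epsilon_j}$. For $s=P+h$ or $s=P$ put $s_{j,l}=s_{\bar\epsilon_j}-s_{\bar\epsilon_l}$. Put $(w;t)_\infty=\prod_{n\ge0}(1-wt^n)$, $\Theta_p(w)=(w;p)_\infty(p/w;p)_\infty(p;p)_\infty$, $\{w\}=\prod_{m,n\ge 0}(1-wp^mq^{2Nn})$, and let $E_{ij}$ be the matrix units. **The elliptic $R$-matrix.** $R^+(z,s)=\rho^+(z)\bar R(z,s)$ with $$\rho^+(z)=q^{-\frac{N-1}N}\frac{\{q^2z\}\{q^{2N-2}z\}\{p/z\}\{pq^{2N}/z\}}{\{z\}\{q^{2N}z\}\{pq^2/z\}\{pq^{2N-2}/z\}},$$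 $$\bar R=\sum_jE_{jj}\otimes E_{jj}+\sum_{j<l}\big(b(z,s_{j,l})E_{jj}\otimes E_{ll}+\bar b(z)E_{ll}\otimes E_{jj}+c(z,s_{j,l})E_{jl}\otimes E_{lj}+\bar c(z,s_{j,l})E_{lj}\otimes E_{jl}\big),$$ $$b(z,s)=q\frac{\Theta_p(q^2q^{2s})\Theta_p(q^{-2}q^{2s})\Theta_p(z)}{\Theta_p(q^{2s})^2\Theta_p(q^2z)},\quad \bar b(z)=q\frac{\Theta_p(z)}{\Theta_p(q^2z)},\quad c(z,s)=\frac{\Theta_p(q^2)\Theta_p(q^{2s}z)}{\Theta_p(q^{2s})\Theta_p(q^2z)},\quad \bar c(z,s)=c(z,-s),$$ expanded as a power series in $z$ and $p/z$ over $\mathbb F$. Thus $R^+(z,s)=\sum_{k\in\mathbb Z}R^+(s)_kz^k$ with $R^+(s)_k\in p^{\max(-k,0)}\mathbb F[[p]]$. Let $R^{+*}$ be $R^+$ with $p$ replaced by $p^*=pq^{-2c}$. **The elliptic algebra.** $E_{q,p}(\widehat{\mathfrak{gl}}_N)$ is the $p$-adically complete topological algebra over $\mathbb F[[p]]$ ($p$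 central, $\mathbb F$ in general not central) generated by $\bar L_{ij,n}$ ($1\le i,j\le N$, $n\in\mathbb Z$), $\hat d$ and the central elements $q^{\pm c/2}$ (inverse to each other), with the following relations, for $f\in\mathbb F$: $$f(P+h,P)\,\bar L_{ij,n}=\bar L_{ij,n}\,f(P+h-\bar\epsilon_i,P-\bar\epsilon_j),\qquad[\hat d,f]=0,\qquad[\hat d,\bar L_{ij,n}]=n\bar L_{ij,n},$$ and, with $L^+(z)=\sum_{i,j}E_{ij}\sum_{n}p^{\max(n,0)}\bar L_{ij,n}z^{-n}$, $$R^{+(12)}(z_1/z_2,P+h)L^{+(1)}(z_1)L^{+(2)}(z_2)=L^{+(2)}(z_2)L^{+(1)}(z_1)R^{+*(12)}(z_1/z_2,P).$$ This last relation is imposed on the $\bar L_{ij,n}$ coefficientwise: each matrix component of the coefficient of $z_1^az_2^b$ is imposed after removal of the power $p^{e(a,b)}$, $e(a,b)=\min_{k\in\mathbb Z}\big(\max(-k,0)+\max(k-a,0)+\max(-k-b,0)\big)$, which is common to all its terms. (The $R$-matrix term of degree $k$ contributes $p^{\max(-k,0)}$, and the modes $\bar L_{k-a}$, $\bar L_{-k-b}$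 contribute the other two exponents.) In other words, $E_{q,p}(\widehat{\mathfrak{gl}}_N)$ is the quotient of the $p$-adically completed algebra on the generators by the closed two-sided ideal generated by the relations. **The trigonometric algebra.** Let $\rho_0(w)=q^{-\frac{N-1}N}\dfrac{(q^2w;q^{2N})_\infty(q^{2N-2}w;q^{2N})_\infty}{(w;q^{2N})_\infty(q^{2N}w;q^{2N})_\infty}$ and $R_0^\pm(z,s)=\rho_0(z^{\pm1})^{\pm1}\bar R_0^\pm(z,s)$, where $\bar R_0^\pm$ has the form of $\bar R$ with $$b_0^\pm=\frac{(1-q^{2(s-1)})(1-q^{2(s+1)})}{(1-q^{2s})^2}\,q^{\pm1}\frac{1-z^{\pm1}}{1-(q^2z)^{\pm1}},\qquad \bar b_0^\pm=q^{\pm1}\frac{1-z^{\pm1}}{1-(q^2z)^{\pm1}},$$ $$c_0^\pm=\frac{1-q^{2s}z}{1-q^{2s}}\,\frac{1-q^{\pm2}}{1-(q^2z)^{\pm1}}\cdot\{1\text{ for }+,\ z^{-1}\text{ for }-\},\qquad \bar c_0^\pm=\frac{1-q^{2s}z^{-1}}{1-q^{2s}}\,\frac{1-q^{\pm2}}{1-(q^2z)^{\pm1}}\cdot\{z\text{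 for }+,\ 1\text{ for }-\},$$ expanded as power series in $z^{\pm1}$. Then $U^R_{q,x}(\widehat{\mathfrak{gl}}_N)$, the dynamical quantum affine algebra in the FRST formulation, is the unital associative algebra over $\mathbb F$ generated by $L^\pm_{0;ij,\mp m}$ ($m\ge0$), $\hat d$ and the central elements $q^{\pm c/2}$ (inverse to each other), subject to the following relations, where $L_0^\pm(z)=\sum_{i,j}E_{ij}\sum_{m\ge0}L^\pm_{0;ij,\mp m}z^{\pm m}$: $$R_0^{\pm(12)}(z_1/z_2,P+h)L_0^{\pm(1)}(z_1)L_0^{\pm(2)}(z_2)=L_0^{\pm(2)}(z_2)L_0^{\pm(1)}(z_1)R_0^{\pm(12)}(z_1/z_2,P),$$ $$R_0^{\pm(12)}(q^{\pm c}z_1/z_2,P+h)L_0^{\pm(1)}(z_1)L_0^{\mp(2)}(z_2)=L_0^{\mp(2)}(z_2)L_0^{\pm(1)}(z_1)R_0^{\pm(12)}(q^{\mp c}z_1/z_2,P),$$ $$f(P+h,P)L^\pm_{0;ij}(z)=L^\pm_{0;ij}(z)f(P+h-\bar\epsilon_i,P-\bar\epsilon_j)\quad(f\in\mathbb F),\qquad[\hat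 d,f]=0,\qquad[\hat d,L_0^\pm(z)]=-z\frac{\partial}{\partial z}L_0^\pm(z),$$ $$L^-_{0;ij,0}=q^{2(P+h)_{\bar\epsilon_i}}\,L^+_{0;ij,0}\,q^{-2P_{\bar\epsilon_j}}.$$ **Proposition.** There is a ring isomorphism $$E_{q,p}(\widehat{\mathfrak{gl}}_N)/pE_{q,p}(\widehat{\mathfrak{gl}}_N)\;\cong\;U^R_{q,x}(\widehat{\mathfrak{gl}}_N)$$ which is the identity on $\mathbb F$, $\hat d$ and $q^{\pm c/2}$, and which satisfies, for all $1\le i,j\le N$ and $m\ge0$, $$\bar L_{ij,-m}\mapsto L^+_{0;ij,-m},\qquad q^{2(P+h)_{\bar\epsilon_i}}\,\bar L_{ij,m}\,q^{-2P_{\bar\epsilon_j}}q^{cm}\mapsto L^-_{0;ij,m}.$$ -/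

import Mathlib

noncomputable section

namespace EllipticGL

/-! ### The field of dynamical functions -/

/-- The hyperplane `{x : x₁ + ⋯ + x_N = 0}` of `ℂᴺ`. The values `⟨μ, P_{ε̄ⱼ}⟩` (and likewise
`⟨μ, (P+h)_{ε̄ⱼ}⟩`) of the dynamical variables are the coordinates of a point of it. -/
abbrev Hyper (N : ℕ) : Submodule ℂ (Fin N → ℂ) :=
  LinearMap.ker (∑ j : Fin N, (LinearMap.proj j : (Fin N → ℂ) →ₗ[ℂ] ℂ))

/-- The weight `ε̄ᵢ = εᵢ - (1/N) ∑ₖ εₖ`; its coordinates are `(ε̄ᵢ, ε̄ₖ) = δᵢₖ - 1/N`. -/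
def epsBar {N : ℕ} (i : Fin N) : Hyper N :=
  ⟨fun k => (if k = i then 1 else 0) - 1 / (N : ℂ), by
    have hN : (N : ℂ) ≠ 0 := by
      have := i.pos
      exact_mod_cast this.ne'
    simp [LinearMap.mem_ker, Finset.sum_sub_distrib, hN]⟩

/-- Entire functions of `(P+h, P)`. -/
def Entire (N : ℕ) : Subalgebra ℂ (Hyper N × Hyper N → ℂ) where
  carrier := {f | AnalyticOnNhd ℂ f Set.univ}
  mul_mem' hf hg := hf.mul hg
  add_mem' hf hg := hf.add hg
  algebraMap_mem' _ := analyticOnNhd_const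

instance (N : ℕ) : IsDomain (Entire N) := by
  have : NoZeroDivisors (Entire N) := by
    refine ⟨fun {f g} h => ?_⟩
    by_cases hf : f = 0
    · exact Or.inl hf
    right
    have hf' : ∃ a, f.1 a ≠ 0 := by
      by_contra! hc
      exact hf (Subtype.ext (funext hc))
    obtain ⟨a, ha⟩ := hf'
    have hmul : ∀ x, f.1 x * g.1 x = 0 := fun x => congrFun (congrArg Subtype.val h) x
    have hev : g.1 =ᶠ[nhds a] 0 := by
      filter_upwards [(f.2 a (Set.mem_univ a)).continuousAt.eventually_ne ha] with x hx
      exact (mul_eq_zero.mp (hmul x)).resolve_left hx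
    have := AnalyticOnNhd.eqOn_zero_of_preconnected_of_eventuallyEq_zero g.2
      isPreconnected_univ (Set.mem_univ a) hev
    exact Subtype.ext (funext fun x => this (Set.mem_univ x))
  exact NoZeroDivisors.to_isDomain _

/-- The field of meromorphic functions `f(P+h, P)`. On a complex vector space these are exactly the
quotients of entire functions. -/
abbrev FF (N : ℕ) : Type := FractionRing (Entire N)

/-- Translation `f(P+h, P) ↦ f(P+h-a, P-b)` of entire functions. -/
def entireShift {N : ℕ} (a b : Hyper N) : Entire N ≃+* Entire N where
  toFun f := ⟨fun x => f.1 (x - (a, b)), fun x _ =>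
    (f.2 (x - (a, b)) (Set.mem_univ _)).comp_of_eq (analyticAt_id.sub analyticAt_const) rfl⟩
  invFun f := ⟨fun x => f.1 (x + (a, b)), fun x _ =>
    (f.2 (x + (a, b)) (Set.mem_univ _)).comp_of_eq (analyticAt_id.add analyticAt_const) rfl⟩
  left_inv f := Subtype.ext (funext fun x => by simp)
  right_inv f := Subtype.ext (funext fun x => by simp)
  map_mul' _ _ := rfl
  map_add' _ _ := rfl

/-- Translation `f(P+h, P) ↦ f(P+h-a, P-b)` of meromorphic functions. -/
def shift {N : ℕ} (a b : Hyper N) : FF N ≃+* FF N :=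
  IsFractionRing.ringEquivOfRingEquiv (entireShift a b)

/-- `q^{2(P+h)_{ε̄ᵢ}}`, with `q = exp ħ`. -/
def xL {N : ℕ} (hbar : ℂ) (i : Fin N) : FF N :=
  algebraMap (Entire N) (FF N) ⟨fun x => Complex.exp (2 * hbar * (x.1 : Fin N → ℂ) i), by
    intro x _
    exact (((ContinuousLinearMap.proj i).comp ((Hyper N).subtypeL.comp
      (ContinuousLinearMap.fst ℂ (Hyper N) (Hyper N)))).analyticAt x |>.const_smul
        (c := 2 * hbar)).cexp⟩

/-- `q^{2P_{ε̄ᵢ}}`, with `q = exp ħ`. -/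
def xR {N : ℕ} (hbar : ℂ) (i : Fin N) : FF N :=
  algebraMap (Entire N) (FF N) ⟨fun x => Complex.exp (2 * hbar * (x.2 : Fin N → ℂ) i), by
    intro x _
    exact (((ContinuousLinearMap.proj i).comp ((Hyper N).subtypeL.comp
      (ContinuousLinearMap.snd ℂ (Hyper N) (Hyper N)))).analyticAt x |>.const_smul
        (c := 2 * hbar)).cexp⟩

/-- The constant function `q = exp ħ`. -/
def qF (N : ℕ) (hbar : ℂ) : FF N := algebraMap ℂ (FF N) (Complex.exp hbar)

/-- The number `q^{-(N-1)/N}`. -/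
def qPow (N : ℕ) (hbar : ℂ) : ℂ := Complex.exp (-(hbar * (((N : ℂ) - 1) / (N : ℂ))))

/-! ### The elliptic dynamical `R`-matrix

A Laurent series `∑ₙ aₙ zⁿ` over `F[[p]]` with `aₙ ≡ 0 mod p^{max(-n,0)}` is the same thing as a
power series in the two variables `z` and `p/z`, with `p = z · (p/z)`. -/

section Elliptic

variable {K : Type*}

/-- The spectral variable `z`. -/
abbrev zVar (K : Type*) [CommRing K] : MvPowerSeries (Fin 2) K := MvPowerSeries.X 0

/-- The series `p/z`. -/
abbrev pzVar (K : Type*) [CommRing K] : MvPowerSeries (Fin 2) K := MvPowerSeries.X 1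

/-- The series `p`. -/
abbrev pVar (K : Type*) [CommRing K] : MvPowerSeries (Fin 2) K := zVar K * pzVar K

/-- `(w; p)_∞ = ∏_{m ≥ 0} (1 - w p^m)`. The factors with `m > |d|` do not contribute to the
coefficient of the monomial of exponent `d`. -/
def pPoch [CommRing K] (w : MvPowerSeries (Fin 2) K) : MvPowerSeries (Fin 2) K :=
  fun d => MvPowerSeries.coeff d (∏ m ∈ Finset.range (d 0 + d 1 + 1), (1 - w * pVar K ^ m))

/-- `Θ_p(w) = (w; p)_∞ (p/w; p)_∞ (p; p)_∞`, where `w' = p/w`. -/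
def theta [CommRing K] (w w' : MvPowerSeries (Fin 2) K) : MvPowerSeries (Fin 2) K :=
  pPoch w * pPoch w' * pPoch (pVar K)

/-- `Θ_p(a)` for a scalar `a ≠ 0`. -/
def thetaC [Field K] (a : K) : MvPowerSeries (Fin 2) K :=
  theta (MvPowerSeries.C a) (MvPowerSeries.C a⁻¹ * pVar K)

/-- `Θ_p(a z)` for a scalar `a ≠ 0`. -/
def thetaZ [Field K] (a : K) : MvPowerSeries (Fin 2) K :=
  theta (MvPowerSeries.C a * zVar K) (MvPowerSeries.C a⁻¹ * pzVar K)

/-- `b(z, s)`, where `X = q^{2s}`. -/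
def bE [Field K] (q X : K) : MvPowerSeries (Fin 2) K :=
  MvPowerSeries.C q * (thetaC (q ^ 2 * X) * thetaC ((q ^ 2)⁻¹ * X) * thetaZ 1) *
    (thetaC X ^ 2 * thetaZ (q ^ 2))⁻¹

/-- `b̄(z)`. -/
def bbarE [Field K] (q : K) : MvPowerSeries (Fin 2) K :=
  MvPowerSeries.C q * thetaZ 1 * (thetaZ (q ^ 2))⁻¹

/-- `c(z, s)`, where `X = q^{2s}`. -/
def cE [Field K] (q X : K) : MvPowerSeries (Fin 2) K :=
  thetaC (q ^ 2) * thetaZ X * (thetaC X * thetaZ (q ^ 2))⁻¹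

/-- `c̄(z, s) = c(z, -s)`, where `X = q^{2s}`. -/
def cbarE [Field K] (q X : K) : MvPowerSeries (Fin 2) K := cE q X⁻¹

open scoped MvPowerSeries.WithPiTopology in
/-- `(w; p, t)_∞ = ∏_{m, n ≥ 0} (1 - w p^m t^n)`, convergent coefficientwise for `|t| < 1`. -/
def pPoch₂ (t : ℂ) (w : MvPowerSeries (Fin 2) ℂ) : MvPowerSeries (Fin 2) ℂ :=
  ∏' mn : ℕ × ℕ, (1 - w * pVar ℂ ^ mn.1 * MvPowerSeries.C (t ^ mn.2))

/-- `ρ⁺(z)`; here `{w} = (w; p, q^{2N})_∞`. -/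
def rhoE (N : ℕ) (hbar : ℂ) : MvPowerSeries (Fin 2) ℂ :=
  let q := Complex.exp hbar
  let br : MvPowerSeries (Fin 2) ℂ → MvPowerSeries (Fin 2) ℂ := pPoch₂ (q ^ (2 * N))
  let c : ℂ → MvPowerSeries (Fin 2) ℂ := fun a => MvPowerSeries.C a
  let z := zVar ℂ
  let pz := pzVar ℂ
  c (qPow N hbar) *
    (br (c (q ^ 2) * z) * br (c (q ^ (2 * N - 2)) * z) * br pz * br (c (q ^ (2 * N)) * pz)) *
    (br z * br (c (q ^ (2 * N)) * z) * br (c (q ^ 2) * pz) * br (c (q ^ (2 * N - 2)) * pz))⁻¹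

end Elliptic

/-- The coefficient of `E_{i i'} ⊗ E_{j j'}` in
`∑ⱼ Eⱼⱼ⊗Eⱼⱼ + ∑_{j<l} (b(s_{jl}) Eⱼⱼ⊗E_{ll} + b̄ E_{ll}⊗Eⱼⱼ + c(s_{jl}) E_{jl}⊗E_{lj} + c̄(s_{jl}) E_{lj}⊗E_{jl})`,
where `b`, `c`, `c̄` are functions of `X = q^{2s}` and `x j / x l = q^{2 s_{jl}}`. -/
def rEntry {N : ℕ} {K S : Type*} [Field K] [Ring S] (b : K → S) (bbar : S) (c cbar : K → S)
    (x : Fin N → K) (i j i' j' : Fin N) : S :=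
  if i = j then (if i' = i ∧ j' = j then 1 else 0)
  else if i' = i ∧ j' = j then (if i < j then b (x i / x j) else bbar)
  else if i' = j ∧ j' = i then (if i < j then c (x i / x j) else cbar (x j / x i))
  else 0

/-- The entry `R⁺(z, s)_{ij}^{i'j'}` of the elliptic dynamical `R`-matrix, where
`x j = q^{2 s_{ε̄ⱼ}}`. -/
def rPlus {N : ℕ} (hbar : ℂ) (x : Fin N → FF N) (i j i' j' : Fin N) :
    MvPowerSeries (Fin 2) (FF N) :=
  MvPowerSeries.map (algebraMap ℂ (FF N)) (rhoE N hbar) *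
    rEntry (bE (qF N hbar)) (bbarE (qF N hbar)) (cE (qF N hbar)) (cbarE (qF N hbar)) x i j i' j'

/-- The coefficient of `z^k p^m` in `R⁺(z, s)_{ij}^{i'j'}`. -/
def rCoeff {N : ℕ} (hbar : ℂ) (x : Fin N → FF N) (i j i' j' : Fin N) (k : ℤ) (m : ℕ) : FF N :=
  if 0 ≤ k + m then
    MvPowerSeries.coeff (Finsupp.single 0 (k + m).toNat + Finsupp.single 1 m)
      (rPlus hbar x i j i' j')
  else 0

/-! ### Algebras with dynamical commutation relations -/

/-- Generators: functions `f ∈ F`, symbols `g ∈ G`, the element `d̂`, and `q^{c/2}`, `q^{-c/2}`. -/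
inductive DynGen (N : ℕ) (G : Type) : Type
  | fn (f : FF N)
  | gen (g : G)
  | d
  | qc
  | qcInv

/-- The relations, for symbols `g` of bidegree `-(Q_{ε̄ᵢ}, Q_{ε̄ⱼ})`, `row g = i`, `col g = j`, and
of degree `deg g` for `d̂`. -/
inductive DynRel (N : ℕ) (G : Type) (row col : G → Fin N) (deg : G → ℤ) :
    FreeAlgebra ℂ (DynGen N G) → FreeAlgebra ℂ (DynGen N G) → Prop
  | fn_const (a : ℂ) : DynRel N G row col deg
      (FreeAlgebra.ι ℂ (.fn (algebraMap ℂ (FF N) a))) (algebraMap ℂ _ a)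
  | fn_add (f g : FF N) : DynRel N G row col deg
      (FreeAlgebra.ι ℂ (.fn (f + g))) (FreeAlgebra.ι ℂ (.fn f) + FreeAlgebra.ι ℂ (.fn g))
  | fn_mul (f g : FF N) : DynRel N G row col deg
      (FreeAlgebra.ι ℂ (.fn (f * g))) (FreeAlgebra.ι ℂ (.fn f) * FreeAlgebra.ι ℂ (.fn g))
  | fn_gen (f : FF N) (g : G) : DynRel N G row col deg
      (FreeAlgebra.ι ℂ (.fn f) * FreeAlgebra.ι ℂ (.gen g))
      (FreeAlgebra.ι ℂ (.gen g) *
        FreeAlgebra.ι ℂ (.fn (shift (epsBar (row g)) (epsBar (col g)) f)))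
  | d_fn (f : FF N) : DynRel N G row col deg
      (FreeAlgebra.ι ℂ .d * FreeAlgebra.ι ℂ (.fn f))
      (FreeAlgebra.ι ℂ (.fn f) * FreeAlgebra.ι ℂ .d)
  | d_gen (g : G) : DynRel N G row col deg
      (FreeAlgebra.ι ℂ .d * FreeAlgebra.ι ℂ (.gen g) -
        FreeAlgebra.ι ℂ (.gen g) * FreeAlgebra.ι ℂ .d)
      ((deg g : ℂ) • FreeAlgebra.ι ℂ (.gen g))
  | qc_central (a : DynGen N G) : DynRel N G row col deg
      (FreeAlgebra.ι ℂ .qc * FreeAlgebra.ι ℂ a) (FreeAlgebra.ι ℂ a * FreeAlgebra.ι ℂ .qc)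
  | qc_qcInv : DynRel N G row col deg (FreeAlgebra.ι ℂ .qc * FreeAlgebra.ι ℂ .qcInv) 1
  | qcInv_qc : DynRel N G row col deg (FreeAlgebra.ι ℂ .qcInv * FreeAlgebra.ι ℂ .qc) 1

/-- The algebra over `F` generated by `G`, `d̂` and the central elements `q^{±c/2}` subject to the
dynamical commutation relations only. -/
abbrev DynAlg (N : ℕ) (G : Type) (row col : G → Fin N) (deg : G → ℤ) : Type :=
  RingQuot (DynRel N G row col deg)

/-- The image of a generator. -/
def DynAlg.of {N : ℕ} {G : Type} {row col : G → Fin N} {deg : G → ℤ} (a : DynGen N G) :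
    DynAlg N G row col deg :=
  RingQuot.mkRingHom _ (FreeAlgebra.ι ℂ a)

/-! ### The elliptic algebra `E_{q,p}` -/

/-- Indices `(i, j, n)` of the symbols `L̄_{ij,n}`, `n ∈ ℤ`. -/
abbrev EIdx (N : ℕ) : Type := Fin N × Fin N × ℤ

/-- The algebra over `F` generated by the `L̄_{ij,n}`, `d̂`, `q^{±c/2}` with
`f(P+h, P) L̄_{ij,n} = L̄_{ij,n} f(P+h-ε̄ᵢ, P-ε̄ⱼ)` and `[d̂, L̄_{ij,n}] = n L̄_{ij,n}`. -/
abbrev EFree (N : ℕ) : Type :=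
  DynAlg N (EIdx N) (fun g => g.1) (fun g => g.2.1) (fun g => g.2.2)

/-- `L_{ij,n} = p^{max(n,0)} L̄_{ij,n}`, so that `L⁺_{ij}(z) = ∑ₙ L_{ij,n} z^{-n}`. -/
def LMode {N : ℕ} (i j : Fin N) (n : ℤ) : PowerSeries (EFree N) :=
  PowerSeries.X ^ (max n 0).toNat * PowerSeries.C (DynAlg.of (.gen (i, j, n)))

/-- The coefficient of `z^k` in `R⁺(z, P+h)_{ij}^{i'j'}`. -/
def RMode {N : ℕ} (hbar : ℂ) (i j i' j' : Fin N) (k : ℤ) : PowerSeries (EFree N) :=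
  PowerSeries.mk fun m => DynAlg.of (.fn (rCoeff hbar (xL hbar) i j i' j' k m))

/-- The coefficient of `z^k` in `R⁺*(z, P)_{ij}^{i'j'}`, that is, with `p` replaced by
`p* = p q^{-2c}`. -/
def RStarMode {N : ℕ} (hbar : ℂ) (i j i' j' : Fin N) (k : ℤ) : PowerSeries (EFree N) :=
  PowerSeries.mk fun m =>
    DynAlg.of (.fn (rCoeff hbar (xR hbar) i j i' j' k m)) * DynAlg.of .qcInv ^ (4 * m)

/-- The part of the coefficient of `z₁^a z₂^b` in the `(i,j), (i'',j'')` component of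
`R⁺(z₁/z₂, P+h) L⁺⁽¹⁾(z₁) L⁺⁽²⁾(z₂) - L⁺⁽²⁾(z₂) L⁺⁽¹⁾(z₁) R⁺*(z₁/z₂, P)`
that comes from the `k`-th power of `z₁/z₂` in the `R`-matrices. -/
def rllTerm {N : ℕ} (hbar : ℂ) (i j i'' j'' : Fin N) (a b k : ℤ) : PowerSeries (EFree N) :=
  (∑ i' : Fin N, ∑ j' : Fin N,
      RMode hbar i j i' j' k * LMode i' i'' (k - a) * LMode j' j'' (-k - b)) -
    ∑ i' : Fin N, ∑ j' : Fin N,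
      LMode j j' (-k - b) * LMode i i' (k - a) * RStarMode hbar i' j' i'' j'' k

/-- The coefficient of `z₁^a z₂^b` in the `(i,j), (i'',j'')` component of
`R⁺(z₁/z₂, P+h) L⁺⁽¹⁾(z₁) L⁺⁽²⁾(z₂) - L⁺⁽²⁾(z₂) L⁺⁽¹⁾(z₁) R⁺*(z₁/z₂, P)`; only finitely many `k`
contribute to each power of `p`. -/
def rllCoeff {N : ℕ} (hbar : ℂ) (i j i'' j'' : Fin N) (a b : ℤ) : PowerSeries (EFree N) :=
  PowerSeries.mk fun m => ∑ᶠ k : ℤ, PowerSeries.coeff m (rllTerm hbar i j i'' j'' a b k)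

/-- The power of `p` that is common to all terms of the coefficient of `z₁^a z₂^b`: the summand
containing `L̄_{k-a}` and `L̄_{-k-b}` carries
`p^{max(-k,0) + max(k-a,0) + max(-k-b,0)}` (the first exponent from the `R`-matrix). -/
def pExp (a b : ℤ) : ℕ :=
  ⨅ k : ℤ, ((max (-k) 0).toNat + (max (k - a) 0).toNat + (max (-k - b) 0).toNat)

/-- The `RLL` relations for the `L̄_{ij,n}`: the coefficients of the `RLL` relation with the common
power of `p` removed. -/
def EIdeal (N : ℕ) (hbar : ℂ) : TwoSidedIdeal (PowerSeries (EFree N)) :=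
  TwoSidedIdeal.span {r | ∃ (i j i'' j'' : Fin N) (a b : ℤ),
    PowerSeries.X ^ pExp a b * r = rllCoeff hbar i j i'' j'' a b}

/-- The closure of a two-sided ideal of `A[[p]]` in the `p`-adic topology. -/
def pClosure {A : Type} [Ring A] (J : TwoSidedIdeal (PowerSeries A)) :
    TwoSidedIdeal (PowerSeries A) :=
  ⨅ n : ℕ, J ⊔ TwoSidedIdeal.span {PowerSeries.X ^ n}

/-- The elliptic algebra `E_{q,p}`: the quotient of the `p`-adically complete algebra `EFree[[p]]`
by the closed two-sided ideal generated by the `RLL` relations. -/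
abbrev EllAlg (N : ℕ) (hbar : ℂ) : Type := (pClosure (EIdeal N hbar)).ringCon.Quotient

/-- The projection onto `E_{q,p}`. -/
def EllAlg.mk (N : ℕ) (hbar : ℂ) : PowerSeries (EFree N) →+* EllAlg N hbar :=
  (pClosure (EIdeal N hbar)).ringCon.mk'

/-- The ideal `p E_{q,p}`. -/
def pIdeal (N : ℕ) (hbar : ℂ) : TwoSidedIdeal (EllAlg N hbar) :=
  TwoSidedIdeal.span {EllAlg.mk N hbar PowerSeries.X}

/-- The quotient `E_{q,p} / p E_{q,p}`. -/
abbrev EllAlgModP (N : ℕ) (hbar : ℂ) : Type := (pIdeal N hbar).ringCon.Quotient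

/-- The class modulo `p` of an element of `E_{q,p}`. -/
def EllAlgModP.mk (N : ℕ) (hbar : ℂ) : EllAlg N hbar →+* EllAlgModP N hbar :=
  (pIdeal N hbar).ringCon.mk'

/-- The class in `E_{q,p} / p E_{q,p}` of a generator of `E_{q,p}`. -/
def EllAlgModP.of {N : ℕ} {hbar : ℂ} (a : DynGen N (EIdx N)) : EllAlgModP N hbar :=
  EllAlgModP.mk N hbar (EllAlg.mk N hbar (PowerSeries.C (DynAlg.of a)))

/-! ### The trigonometric dynamical `R`-matrix and the algebra `U^R_{q,x}` -/

open scoped PowerSeries.WithPiTopology in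
/-- `(w; t)_∞ = ∏_{n ≥ 0} (1 - t^n w)`, convergent coefficientwise for `|t| < 1`. -/
def qPoch (t : ℂ) (w : PowerSeries ℂ) : PowerSeries ℂ :=
  ∏' n : ℕ, (1 - PowerSeries.C (t ^ n) * w)

/-- `ρ₀(w)` as a power series in `w`. -/
def rhoT (N : ℕ) (hbar : ℂ) : PowerSeries ℂ :=
  let q := Complex.exp hbar
  let t := q ^ (2 * N)
  let w : PowerSeries ℂ := PowerSeries.X
  PowerSeries.C (qPow N hbar) *
    (qPoch t (PowerSeries.C (q ^ 2) * w) * qPoch t (PowerSeries.C (q ^ (2 * N - 2)) * w)) *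
    (qPoch t w * qPoch t (PowerSeries.C (q ^ (2 * N)) * w))⁻¹

/-- The entry `R₀^±(z, s)_{ij}^{i'j'}` of the trigonometric dynamical `R`-matrix as a power series
in `w = z^{±1}` (the sign is `+` for `true`), where `x j = q^{2 s_{ε̄ⱼ}}`. -/
def rTrig {N : ℕ} (hbar : ℂ) (sgn : Bool) (x : Fin N → FF N) (i j i' j' : Fin N) :
    PowerSeries (FF N) :=
  let q := qF N hbar
  let w : PowerSeries (FF N) := PowerSeries.X
  let C : FF N → PowerSeries (FF N) := fun a => PowerSeries.C a
  let φ := algebraMap ℂ (FF N)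
  match sgn with
  | true =>
    let den := (1 - C (q ^ 2) * w)⁻¹
    PowerSeries.map φ (rhoT N hbar) *
      rEntry
        (fun X => C ((1 - (q ^ 2)⁻¹ * X) * (1 - q ^ 2 * X) / (1 - X) ^ 2 * q) * (1 - w) * den)
        (C q * (1 - w) * den)
        (fun X => C ((1 - q ^ 2) / (1 - X)) * (1 - C X * w) * den)
        (fun X => C ((1 - q ^ 2) / (1 - X)) * (w - C X) * den) x i j i' j'
  | false =>
    let den := (1 - C (q ^ 2)⁻¹ * w)⁻¹
    PowerSeries.map φ (rhoT N hbar)⁻¹ *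
      rEntry
        (fun X => C ((1 - (q ^ 2)⁻¹ * X) * (1 - q ^ 2 * X) / (1 - X) ^ 2 * q⁻¹) * (1 - w) * den)
        (C q⁻¹ * (1 - w) * den)
        (fun X => C ((1 - (q ^ 2)⁻¹) / (1 - X)) * (w - C X) * den)
        (fun X => C ((1 - (q ^ 2)⁻¹) / (1 - X)) * (1 - C X * w) * den) x i j i' j'

/-- Indices `(±, i, j, m)` of the generators `L^±_{0;ij,∓m}`, `m ≥ 0` (the sign is `+` for
`true`). -/
abbrev TIdx (N : ℕ) : Type := Bool × Fin N × Fin N × ℕ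

/-- The algebra over `F` generated by the `L^±_{0;ij,∓m}`, `d̂`, `q^{±c/2}` subject to the dynamical
commutation relations and `[d̂, L^±_{0;ij,∓m}] = ∓m L^±_{0;ij,∓m}`. -/
abbrev TFree (N : ℕ) : Type :=
  DynAlg N (TIdx N) (fun g => g.2.1) (fun g => g.2.2.1)
    (fun g => if g.1 then -(g.2.2.2 : ℤ) else (g.2.2.2 : ℤ))

/-- The coefficient of `w^m`, `w = z^{±1}`, in `L₀^±_{ij}(z)`. -/
def L0Mode {N : ℕ} (sgn : Bool) (i j : Fin N) (m : ℤ) : TFree N :=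
  if 0 ≤ m then DynAlg.of (.gen (sgn, i, j, m.toNat)) else 0

/-- The coefficient of `w^k`, `w = z^{±1}`, in `R₀^±(z, P+h)_{ij}^{i'j'}`. -/
def R0L {N : ℕ} (hbar : ℂ) (sgn : Bool) (i j i' j' : Fin N) (k : ℕ) : TFree N :=
  DynAlg.of (.fn (PowerSeries.coeff k (rTrig hbar sgn (xL hbar) i j i' j')))

/-- The coefficient of `w^k`, `w = z^{±1}`, in `R₀^±(z, P)_{ij}^{i'j'}`. -/
def R0R {N : ℕ} (hbar : ℂ) (sgn : Bool) (i j i' j' : Fin N) (k : ℕ) : TFree N :=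
  DynAlg.of (.fn (PowerSeries.coeff k (rTrig hbar sgn (xR hbar) i j i' j')))

/-- The relations of `U^R_{q,x}` besides the dynamical commutation relations. -/
inductive TrigRel (N : ℕ) (hbar : ℂ) : TFree N → TFree N → Prop
  /-- The coefficient of `w₁^a w₂^b`, `wᵢ = zᵢ^{±1}`, in
  `R₀^±(z₁/z₂, P+h) L₀^±⁽¹⁾(z₁) L₀^±⁽²⁾(z₂) = L₀^±⁽²⁾(z₂) L₀^±⁽¹⁾(z₁) R₀^±(z₁/z₂, P)`. -/
  | same (sgn : Bool) (i j i'' j'' : Fin N) (a : ℕ) (b : ℤ) : TrigRel N hbar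
      (∑ k ∈ Finset.range (a + 1), ∑ i' : Fin N, ∑ j' : Fin N,
        R0L hbar sgn i j i' j' k * L0Mode sgn i' i'' (a - k) * L0Mode sgn j' j'' (b + k))
      (∑ k ∈ Finset.range (a + 1), ∑ i' : Fin N, ∑ j' : Fin N,
        L0Mode sgn j j' (b + k) * L0Mode sgn i i' (a - k) * R0R hbar sgn i' j' i'' j'' k)
  /-- The coefficient of `w₁^a w₂^{-b}`, `wᵢ = zᵢ^{±1}`, in
  `R₀^±(q^{±c} z₁/z₂, P+h) L₀^±⁽¹⁾(z₁) L₀^∓⁽²⁾(z₂) = L₀^∓⁽²⁾(z₂) L₀^±⁽¹⁾(z₁) R₀^±(q^{∓c} z₁/z₂, P)`. -/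
  | mixed (sgn : Bool) (i j i'' j'' : Fin N) (a b : ℕ) : TrigRel N hbar
      (∑ k ∈ Finset.range (min a b + 1), ∑ i' : Fin N, ∑ j' : Fin N,
        R0L hbar sgn i j i' j' k * DynAlg.of .qc ^ (2 * k) *
          L0Mode sgn i' i'' (a - k) * L0Mode (!sgn) j' j'' (b - k))
      (∑ k ∈ Finset.range (min a b + 1), ∑ i' : Fin N, ∑ j' : Fin N,
        L0Mode (!sgn) j j' (b - k) * L0Mode sgn i i' (a - k) *
          R0R hbar sgn i' j' i'' j'' k * DynAlg.of .qcInv ^ (2 * k))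
  /-- `L⁻_{0;ij,0} = q^{2(P+h)_{ε̄ᵢ}} L⁺_{0;ij,0} q^{-2P_{ε̄ⱼ}}`. -/
  | zeroMode (i j : Fin N) : TrigRel N hbar
      (L0Mode false i j 0)
      (DynAlg.of (.fn (xL hbar i)) * L0Mode true i j 0 * DynAlg.of (.fn (xR hbar j)⁻¹))

/-- The dynamical quantum affine algebra `U^R_{q,x}` in the FRST formulation. -/
abbrev TrigAlg (N : ℕ) (hbar : ℂ) : Type := RingQuot (TrigRel N hbar)

/-- The image in `U^R_{q,x}` of a generator. -/
def TrigAlg.of {N : ℕ} {hbar : ℂ} (a : DynGen N (TIdx N)) : TrigAlg N hbar :=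
  RingQuot.mkRingHom (TrigRel N hbar) (DynAlg.of a)

end EllipticGL

end

noncomputable section

namespace EllipticGL

/-! ### Restriction of power series in two variables to a coordinate axis -/

/-! The isomorphism comes from reading the RLL relations at p = 0, after division by the common
power of p. In the coefficient of z₁^a z₂^b, the summand of index k carries at least the power
max(-k,0) + max(k-a,0) + max(-k-b,0) of p. This is a convex function of k, minimal exactly between
the median and the maximum of 0, a, -b (`pExp_summand_eq_iff`). So modulo p each relation is a
finite sum over that interval (`lift_constantCoeff_of_mul_eq`), and R⁺ enters only through its
coefficients of z^k p^0 and of z^(-k) p^k with k ≥ 0. For a power series in z and p/z these are the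
restrictions to the two coordinate axes. There p = 0, and every theta function becomes a constant or
a polynomial of degree one. The z-axis gives R₀⁺ (`edge_zero_rPlus`); the p/z-axis gives R₀⁻ up to
constants and a gauge factor x i' / x i (`edge_one_rPlus`).

The maximum of 0, a, -b decides which modes occur. If it is a, the relation is the one of R₀⁺ for
L⁺L⁺. If it is -b, the relation is the one of R₀⁺ for L⁻L⁻. If it is 0, the relation is the one of
R₀⁻ between L⁻(z₁) and L⁺(z₂). The twist by q^{2(P+h)}, q^{-2P} and q^{cm} in the definition of L⁻
absorbs the gauge factor and distributes the power of q^{-2c} coming from p* as the argument shifts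
q^{±c} (`rllT_minus_minus`, `rllT_minus_plus`).

The trigonometric algebra also asks for the R₀⁻ relation for L⁺L⁺ and L⁻L⁻ and for the second mixed
relation. For L⁻L⁻ the R₀⁻ relation is equivalent to the one of R₀⁺: up to a scalar series both
R-matrices expand the same matrix of degree one in z, and in a fixed total degree only finitely many
modes occur, so the coefficients can be read in reverse order (`rSeries_reverse`). The same-sign
trigonometric relations are indexed by the sign of L, so L⁺ uses R₀⁺ and needs no reversal. The
second mixed relation follows from the first by unitarity (`trigMat_unitary`, `mixed_of_mixed`).
This gives `isEll_iff_isTrig`.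

Both algebras are universal for such realizations: modulo p the closure of the ideal adds nothing,
since it lies in the ideal plus (p). The changes of generators `toTrig` and `toEll` are natural and
mutually inverse on realizations of the relations, so the induced homomorphisms are mutually
inverse. -/

/-- The restriction of a power series in `z`, `p/z` to one of the two coordinate axes. -/
def edge {K : Type*} [CommRing K] (s : Fin 2) : MvPowerSeries (Fin 2) K →+* PowerSeries K where
  toFun f := PowerSeries.mk fun k => MvPowerSeries.coeff (Finsupp.single s k) f
  map_one' := by
    ext k
    simp [MvPowerSeries.coeff_one, PowerSeries.coeff_one]
  map_zero' := by
    ext k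
    simp
  map_add' f g := by
    ext k
    simp
  map_mul' f g := by
    classical
    ext k
    rw [PowerSeries.coeff_mk, MvPowerSeries.coeff_mul, PowerSeries.coeff_mul,
      Finsupp.antidiagonal_single, Finset.sum_map]
    simp

section edge

variable {K : Type*} [CommRing K]

@[simp] theorem coeff_edge (s : Fin 2) (f : MvPowerSeries (Fin 2) K) (k : ℕ) :
    PowerSeries.coeff k (edge s f) = MvPowerSeries.coeff (Finsupp.single s k) f := by
  simp [edge]

@[simp] theorem edge_C (s : Fin 2) (a : K) : edge s (MvPowerSeries.C a) = PowerSeries.C a := by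
  classical
  ext k
  simp [MvPowerSeries.coeff_C, PowerSeries.coeff_C]

@[simp] theorem edge_X_self (s : Fin 2) :
    edge s (MvPowerSeries.X s : MvPowerSeries (Fin 2) K) = PowerSeries.X := by
  classical
  ext k
  simp only [coeff_edge, MvPowerSeries.coeff_X, PowerSeries.coeff_X]
  congr 1
  simp [(Finsupp.single_injective s).eq_iff]

theorem edge_X_of_ne {s t : Fin 2} (h : s ≠ t) :
    edge s (MvPowerSeries.X t : MvPowerSeries (Fin 2) K) = 0 := by
  classical
  ext k
  simp only [coeff_edge, MvPowerSeries.coeff_X, map_zero, ite_eq_right_iff]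
  intro hk
  have := DFunLike.congr_fun hk t
  simp [h] at this

@[simp] theorem edge_zero_X_one : edge 0 (MvPowerSeries.X 1 : MvPowerSeries (Fin 2) K) = 0 :=
  edge_X_of_ne (by decide)

@[simp] theorem edge_one_X_zero : edge 1 (MvPowerSeries.X 0 : MvPowerSeries (Fin 2) K) = 0 :=
  edge_X_of_ne (by decide)

@[simp] theorem edge_pVar (s : Fin 2) : edge s (pVar K) = 0 := by
  fin_cases s <;> simp

theorem edge_map {K' : Type*} [CommRing K'] (s : Fin 2) (φ : K →+* K')
    (f : MvPowerSeries (Fin 2) K) :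
    edge s (MvPowerSeries.map φ f) = PowerSeries.map φ (edge s f) := by
  ext k
  simp

/-- Since p vanishes on both axes, only the factor with m = 0 survives; the truncation length, which
depends on the exponent, plays no role. -/
theorem edge_pPoch (s : Fin 2) (w : MvPowerSeries (Fin 2) K) : edge s (pPoch w) = 1 - edge s w := by
  ext k
  have h : ∀ n, edge s (∏ m ∈ Finset.range (n + 1), (1 - w * pVar K ^ m)) = 1 - edge s w := by
    intro n
    rw [map_prod, Finset.prod_range_succ']
    simp
  rw [coeff_edge]
  change MvPowerSeries.coeff (Finsupp.single s k) (∏ m ∈ Finset.range _, (1 - w * pVar K ^ m)) = _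
  rw [← coeff_edge, h]

end edge

theorem constantCoeff_edge {K : Type*} [CommRing K] (s : Fin 2) (f : MvPowerSeries (Fin 2) K) :
    PowerSeries.constantCoeff (edge s f) = MvPowerSeries.constantCoeff f := by
  rw [← PowerSeries.coeff_zero_eq_constantCoeff_apply, coeff_edge]
  simp

theorem edge_inv {K : Type*} [Field K] (s : Fin 2) (f : MvPowerSeries (Fin 2) K) :
    edge s f⁻¹ = (edge s f)⁻¹ := by
  by_cases h : MvPowerSeries.constantCoeff f = 0
  · rw [MvPowerSeries.inv_eq_zero.mpr h, PowerSeries.inv_eq_zero.mpr, map_zero]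
    rwa [constantCoeff_edge]
  · rw [PowerSeries.eq_inv_iff_mul_eq_one, ← map_mul, MvPowerSeries.inv_mul_cancel _ h, map_one]
    rwa [constantCoeff_edge]

theorem PowerSeries_map_inv {K K' : Type*} [Field K] [Field K'] (φ : K →+* K') (f : PowerSeries K) :
    PowerSeries.map φ f⁻¹ = (PowerSeries.map φ f)⁻¹ := by
  have hc : PowerSeries.constantCoeff (PowerSeries.map φ f) = φ (PowerSeries.constantCoeff f) := by
    rw [← PowerSeries.coeff_zero_eq_constantCoeff_apply, PowerSeries.coeff_map,
      PowerSeries.coeff_zero_eq_constantCoeff_apply]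
  by_cases h : PowerSeries.constantCoeff f = 0
  · rw [PowerSeries.inv_eq_zero.mpr h, PowerSeries.inv_eq_zero.mpr, map_zero]
    rw [hc, h, map_zero]
  · rw [PowerSeries.eq_inv_iff_mul_eq_one, ← map_mul, PowerSeries.inv_mul_cancel _ h, map_one]
    rw [hc]
    exact (map_ne_zero φ).mpr h

section thetaEdge

variable {K : Type*} [Field K]

theorem edge_thetaC (s : Fin 2) (a : K) : edge s (thetaC a) = PowerSeries.C (1 - a) := by
  simp [thetaC, theta, edge_pPoch]

theorem edge_zero_thetaZ (a : K) :
    edge 0 (thetaZ a) = 1 - PowerSeries.C a * PowerSeries.X := by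
  simp [thetaZ, theta, edge_pPoch]

theorem edge_one_thetaZ (a : K) :
    edge 1 (thetaZ a) = 1 - PowerSeries.C a⁻¹ * PowerSeries.X := by
  simp [thetaZ, theta, edge_pPoch]

end thetaEdge

/-! ### The infinite products -/

/-- Any finite partial sum is dominated by an expanded product `∏ (1 + g i)`, hence by `exp (∑' i, g
i)`. -/
theorem summable_finset_prod_of_nonneg {ι : Type*} {g : ι → ℝ} (h0 : ∀ i, 0 ≤ g i)
    (hg : Summable g) : Summable fun s : Finset ι => ∏ i ∈ s, g i := by
  classical
  refine summable_of_sum_le (c := Real.exp (∑' i, g i))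
    (fun s => Finset.prod_nonneg fun i _ => h0 i) fun T => ?_
  let U : Finset ι := T.sup id
  calc ∑ s ∈ T, ∏ i ∈ s, g i ≤ ∑ s ∈ U.powerset, ∏ i ∈ s, g i := by
        refine Finset.sum_le_sum_of_subset_of_nonneg (fun s hs => ?_)
          fun s _ _ => Finset.prod_nonneg fun i _ => h0 i
        exact Finset.mem_powerset.mpr (Finset.le_sup (f := id) hs)
    _ = ∏ i ∈ U, (1 + g i) := (Finset.prod_one_add U).symm
    _ ≤ ∏ i ∈ U, Real.exp (g i) := Finset.prod_le_prod (fun i _ => by linarith [h0 i])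
        fun i _ => by linarith [Real.add_one_le_exp (g i)]
    _ = Real.exp (∑ i ∈ U, g i) := (Real.exp_sum U g).symm
    _ ≤ _ := Real.exp_le_exp.mpr (hg.sum_le_tsum U fun i _ => h0 i)

open scoped MvPowerSeries.WithPiTopology in
/-- A product of factors `1 + cᵢ x^{eᵢ}` converges coefficientwise if `∑ᵢ |cᵢ| r^{|eᵢ|}` converges
for some `r > 0`. -/
theorem multipliable_one_add_monomial {σ ι : Type*} (e : ι → σ →₀ ℕ) (c : ι → ℂ) {r : ℝ}
    (hr : 0 < r) (h : Summable fun i => ‖c i‖ * r ^ (e i).degree) :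
    Multipliable fun i => 1 + MvPowerSeries.monomial (e i) (c i) := by
  classical
  refine multipliable_one_add_of_summable_prod ?_
  rw [MvPowerSeries.WithPiTopology.summable_iff_summable_coeff]
  intro d
  -- A finite subset contributes to the coefficient of exponent d only if its exponents add up to d.
  -- Its weights then multiply to r^|d|, which the prefactor cancels.
  refine Summable.of_norm_bounded
    ((summable_finset_prod_of_nonneg (fun i => by positivity) h).mul_left (r ^ d.degree)⁻¹)
    fun s => ?_
  have hprod : ∏ i ∈ s, MvPowerSeries.monomial (e i) (c i) =
      MvPowerSeries.monomial (∑ i ∈ s, e i) (∏ i ∈ s, c i) := by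
    induction s using Finset.induction_on with
    | empty => simp
    | insert a s ha ih =>
      rw [Finset.prod_insert ha, ih, MvPowerSeries.monomial_mul_monomial, Finset.sum_insert ha,
        Finset.prod_insert ha]
  rw [hprod, MvPowerSeries.coeff_monomial]
  split_ifs with hd
  · rw [norm_prod, Finset.prod_mul_distrib, Finset.prod_pow_eq_pow_sum, hd, map_sum, mul_comm,
      mul_assoc, mul_inv_cancel₀ (by positivity), mul_one]
  · rw [norm_zero]
    exact mul_nonneg (by positivity) (Finset.prod_nonneg fun i _ => by positivity)

-- Convergence is what allows `∏'` to be mapped through `edge`. With weight 1/2 for each variable,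
-- p^m contributes (1/4)^m, so the sum over (m, n) is a product of two geometric series.
open scoped MvPowerSeries.WithPiTopology in
theorem multipliable_pPoch₂ {t : ℂ} (ht : ‖t‖ < 1) (a : ℂ) (s : Fin 2) :
    Multipliable fun mn : ℕ × ℕ =>
      1 - MvPowerSeries.C a * MvPowerSeries.X s * pVar ℂ ^ mn.1 * MvPowerSeries.C (t ^ mn.2) := by
  let e : ℕ × ℕ → Fin 2 →₀ ℕ := fun mn =>
    Finsupp.single s 1 + (Finsupp.single 0 mn.1 + Finsupp.single 1 mn.1)
  have hsum : Summable fun mn : ℕ × ℕ => ‖-a * t ^ mn.2‖ * (1 / 2 : ℝ) ^ (e mn).degree := by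
    have h1 : Summable fun m : ℕ => (1 / 4 : ℝ) ^ m :=
      summable_geometric_of_lt_one (by norm_num) (by norm_num)
    have h2 : Summable fun n : ℕ => ‖t‖ ^ n := summable_geometric_of_lt_one (norm_nonneg _) ht
    refine ((h1.mul_of_nonneg h2 (fun _ => by positivity) (fun _ => by positivity)).mul_left
      (‖a‖ * (1 / 2))).congr fun mn => ?_
    have : (e mn).degree = 1 + (mn.1 + mn.1) := by
      simp [e, map_add]
    rw [this, norm_mul, norm_neg, norm_pow, pow_add, pow_one, ← two_mul, pow_mul]
    norm_num
    ring
  refine (multipliable_one_add_monomial e _ (by norm_num) hsum).congr fun mn => ?_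
  have h0 : ∀ (i : Fin 2) (n : ℕ), (MvPowerSeries.X i : MvPowerSeries (Fin 2) ℂ) ^ n =
      MvPowerSeries.monomial (Finsupp.single i n) 1 := fun i n => MvPowerSeries.X_pow_eq i n
  have h1 : (MvPowerSeries.X s : MvPowerSeries (Fin 2) ℂ) =
      MvPowerSeries.monomial (Finsupp.single s 1) 1 := rfl
  have hC : ∀ c : ℂ, (MvPowerSeries.C c : MvPowerSeries (Fin 2) ℂ) =
      MvPowerSeries.monomial 0 c := fun c => rfl
  rw [mul_pow, h0, h0, h1, hC, hC]
  simp only [MvPowerSeries.monomial_mul_monomial, sub_eq_add_neg, ← map_neg]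
  congr 2
  · simp [e]
  · simp

open scoped MvPowerSeries.WithPiTopology PowerSeries.WithPiTopology in
theorem continuous_edge (s : Fin 2) : Continuous (edge (K := ℂ) s) := by
  rw [continuous_iff_continuousAt]
  intro f
  refine (PowerSeries.WithPiTopology.tendsto_iff_coeff_tendsto ℂ _ _ _).mpr fun d => ?_
  simp only [coeff_edge]
  exact (MvPowerSeries.WithPiTopology.continuous_coeff ℂ _).continuousAt

-- Restriction is a continuous homomorphism, so it passes through the infinite product. As p
-- restricts to 0, only the indices (0, n) contribute a factor other than 1.
open scoped MvPowerSeries.WithPiTopology PowerSeries.WithPiTopology in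
theorem edge_pPoch₂ {t : ℂ} (ht : ‖t‖ < 1) (a : ℂ) (s s' : Fin 2) :
    edge s (pPoch₂ t (MvPowerSeries.C a * MvPowerSeries.X s')) =
      qPoch t (PowerSeries.C a * edge s (MvPowerSeries.X s')) := by
  have : T2Space (PowerSeries ℂ) := PowerSeries.WithPiTopology.instT2Space ℂ
  rw [pPoch₂, Multipliable.map_tprod (multipliable_pPoch₂ ht a s') (edge s) (continuous_edge s)]
  rw [qPoch, ← Function.Injective.tprod_eq (g := fun n : ℕ => ((0 : ℕ), n))]
  · refine tprod_congr fun n => ?_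
    simp only [map_sub, map_mul, map_one, edge_C, pow_zero, mul_one]
    ring
  · intro m n h
    simpa using h
  · rintro ⟨m, n⟩ h
    rcases m with _ | m
    · exact ⟨n, rfl⟩
    · exfalso
      apply h
      simp

theorem qPoch_zero (t : ℂ) : qPoch t 0 = 1 := by
  simp [qPoch]

/-! ### The scalar factor of the R-matrix on the two axes -/

section rho

variable {N : ℕ} {hbar : ℂ}

theorem norm_pow_lt_one (hN : 1 ≤ N) (hq : ‖Complex.exp hbar‖ < 1) :
    ‖Complex.exp hbar ^ (2 * N)‖ < 1 := by
  rw [norm_pow]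
  exact pow_lt_one₀ (norm_nonneg _) hq (by omega)

/-- The constant term of a series in two variables can be read on either axis. On the other axis the
argument is 0 and the product is 1. -/
theorem constantCoeff_qPoch {t : ℂ} (ht : ‖t‖ < 1) (a : ℂ) :
    PowerSeries.constantCoeff (qPoch t (PowerSeries.C a * PowerSeries.X)) = 1 := by
  have h0 := edge_pPoch₂ ht a 0 0
  have h1 := edge_pPoch₂ ht a 1 0
  rw [edge_X_self] at h0
  rw [edge_one_X_zero, mul_zero, qPoch_zero] at h1
  rw [← h0, constantCoeff_edge, ← constantCoeff_edge 1, h1, map_one]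

theorem constantCoeff_qPoch_X {t : ℂ} (ht : ‖t‖ < 1) :
    PowerSeries.constantCoeff (qPoch t PowerSeries.X) = 1 := by
  simpa using constantCoeff_qPoch ht 1

theorem edge_pPoch₂_X {t : ℂ} (ht : ‖t‖ < 1) (s s' : Fin 2) :
    edge s (pPoch₂ t (MvPowerSeries.X s')) = qPoch t (edge s (MvPowerSeries.X s')) := by
  simpa using edge_pPoch₂ ht 1 s s'

theorem edge_zero_rhoE (hN : 1 ≤ N) (hq : ‖Complex.exp hbar‖ < 1) :
    edge 0 (rhoE N hbar) = rhoT N hbar := by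
  have ht := norm_pow_lt_one hN hq
  rw [rhoE, rhoT]
  simp only [map_mul (edge 0), edge_inv, edge_C, zVar, pzVar, edge_pPoch₂ ht, edge_pPoch₂_X ht,
    edge_X_self, edge_zero_X_one, mul_zero, qPoch_zero, mul_one]

theorem qPow_ne_zero : qPow N hbar ≠ 0 := Complex.exp_ne_zero _

theorem PowerSeries_C_inv {K : Type*} [Field K] (a : K) :
    (PowerSeries.C a)⁻¹ = PowerSeries.C a⁻¹ := by
  by_cases ha : a = 0
  · simp [ha]
  · rw [eq_comm, PowerSeries.eq_inv_iff_mul_eq_one (by simpa using ha), ← map_mul,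
      inv_mul_cancel₀ ha, map_one]

theorem PowerSeries_inv_inv {K : Type*} [Field K] {f : PowerSeries K}
    (hf : PowerSeries.constantCoeff f ≠ 0) : (f⁻¹)⁻¹ = f := by
  rw [eq_comm, PowerSeries.eq_inv_iff_mul_eq_one, PowerSeries.mul_inv_cancel _ hf]
  simpa using hf

/-- On the p/z-axis the numerator and the denominator of ρ₀ trade places, but the prefactor
q^{-(N-1)/N} does not get inverted; hence its square in front of the inverse. -/
theorem edge_one_rhoE (hN : 1 ≤ N) (hq : ‖Complex.exp hbar‖ < 1) :
    edge 1 (rhoE N hbar) = PowerSeries.C (qPow N hbar ^ 2) * (rhoT N hbar)⁻¹ := by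
  have ht := norm_pow_lt_one hN hq
  rw [rhoE, rhoT]
  simp only [map_mul (edge 1), edge_inv, edge_C, zVar, pzVar, edge_pPoch₂ ht, edge_pPoch₂_X ht,
    edge_X_self, edge_one_X_zero, mul_zero, qPoch_zero, mul_one, one_mul]
  rw [PowerSeries.mul_inv_rev (PowerSeries.C _ * _), PowerSeries.mul_inv_rev (PowerSeries.C _),
    PowerSeries_inv_inv, PowerSeries_C_inv]
  · have h : (PowerSeries.C (qPow N hbar ^ 2) : PowerSeries ℂ) * PowerSeries.C (qPow N hbar)⁻¹ =
        PowerSeries.C (qPow N hbar) := by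
      rw [← map_mul, sq, mul_assoc, mul_inv_cancel₀ qPow_ne_zero, mul_one]
    rw [← h]
    ring
  · simp [constantCoeff_qPoch ht, constantCoeff_qPoch_X ht, -map_pow]

theorem constantCoeff_rhoT_ne_zero (hN : 1 ≤ N) (hq : ‖Complex.exp hbar‖ < 1) :
    PowerSeries.constantCoeff (rhoT N hbar) ≠ 0 := by
  have ht := norm_pow_lt_one hN hq
  simp [rhoT, constantCoeff_qPoch ht, constantCoeff_qPoch_X ht, qPow_ne_zero, -map_pow]

end rho

end EllipticGL
end

noncomputable section

namespace EllipticGL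

/-! ### The trigonometric `R`-matrices as matrix polynomials of degree one -/

section rEntry

variable {N : ℕ} {K S : Type*} [Field K] [Ring S]

theorem rEntry_of_eq (b : K → S) (bbar : S) (c cbar : K → S) (x : Fin N → K) (i i' j' : Fin N) :
    rEntry b bbar c cbar x i i i' j' = if i' = i ∧ j' = i then 1 else 0 := by
  simp [rEntry]

theorem rEntry_self (b : K → S) (bbar : S) (c cbar : K → S) (x : Fin N → K) {i j : Fin N}
    (h : i ≠ j) :
    rEntry b bbar c cbar x i j i j = if i < j then b (x i / x j) else bbar := by
  simp [rEntry, h]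

theorem rEntry_swap (b : K → S) (bbar : S) (c cbar : K → S) (x : Fin N → K) {i j : Fin N}
    (h : i ≠ j) :
    rEntry b bbar c cbar x i j j i = if i < j then c (x i / x j) else cbar (x j / x i) := by
  simp [rEntry, h, h.symm]

theorem rEntry_of_ne (b : K → S) (bbar : S) (c cbar : K → S) (x : Fin N → K) {i j i' j' : Fin N}
    (h1 : ¬(i' = i ∧ j' = j)) (h2 : ¬(i' = j ∧ j' = i)) :
    rEntry b bbar c cbar x i j i' j' = 0 := by
  unfold rEntry
  split_ifs <;> rfl

theorem sum_rEntry_mul_of_eq (b : K → S) (bbar : S) (c cbar : K → S) (x : Fin N → K) (i : Fin N)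
    (F : Fin N × Fin N → S) :
    ∑ p : Fin N × Fin N, rEntry b bbar c cbar x i i p.1 p.2 * F p = F (i, i) := by
  rw [Fintype.sum_eq_single (i, i)]
  · simp [rEntry_of_eq]
  · rintro ⟨a, b⟩ h
    rw [rEntry_of_eq, if_neg, zero_mul]
    rintro ⟨h1, h2⟩
    exact h (Prod.ext h1 h2)

/-- A row of the R-matrix is supported on (i, j) and (j, i), so matrix identities reduce to blocks
of size two. -/
theorem sum_rEntry_mul_of_ne (b : K → S) (bbar : S) (c cbar : K → S) (x : Fin N → K) {i j : Fin N}
    (hij : i ≠ j) (F : Fin N × Fin N → S) :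
    ∑ p : Fin N × Fin N, rEntry b bbar c cbar x i j p.1 p.2 * F p =
      rEntry b bbar c cbar x i j i j * F (i, j) + rEntry b bbar c cbar x i j j i * F (j, i) := by
  classical
  have hne : (i, j) ≠ (j, i) := fun h => hij (congrArg Prod.fst h)
  rw [← Finset.sum_pair (f := fun p : Fin N × Fin N => rEntry b bbar c cbar x i j p.1 p.2 * F p)
    hne]
  symm
  refine Finset.sum_subset (Finset.subset_univ _) ?_
  rintro ⟨a, b⟩ - h
  simp only [Finset.mem_insert, Finset.mem_singleton, Prod.mk.injEq, not_or] at h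
  rw [rEntry_of_ne _ _ _ _ _ h.1 h.2, zero_mul]

end rEntry

section TrigPoly

variable {N : ℕ} {K : Type*} [Field K]

/-- The scalar `(1 - q^{-2}X)(1 - q^2 X) / (1 - X)^2`. -/
def bScalar (q X : K) : K := (1 - (q ^ 2)⁻¹ * X) * (1 - q ^ 2 * X) / (1 - X) ^ 2

/-- The value at `z = 0` of the trigonometric `R`-matrix, up to a scalar. -/
def matZero (q : K) (x : Fin N → K) : Matrix (Fin N × Fin N) (Fin N × Fin N) K := fun p p' =>
  rEntry (fun X => bScalar q X * q) q (fun X => (1 - q ^ 2) / (1 - X))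
    (fun X => (1 - q ^ 2) / (1 - X) * -X) x p.1 p.2 p'.1 p'.2

/-- The value at `z = ∞` of the trigonometric `R`-matrix, up to a scalar. -/
def matInfty (q : K) (x : Fin N → K) : Matrix (Fin N × Fin N) (Fin N × Fin N) K := fun p p' =>
  rEntry (fun X => bScalar q X * q⁻¹) q⁻¹ (fun X => (1 - (q ^ 2)⁻¹) / (1 - X) * -X)
    (fun X => (1 - (q ^ 2)⁻¹) / (1 - X)) x p.1 p.2 p'.1 p'.2

/-- Exchange of the two tensor factors. -/
def flip {R : Type*} (A : Matrix (Fin N × Fin N) (Fin N × Fin N) R) :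
    Matrix (Fin N × Fin N) (Fin N × Fin N) R :=
  A.submatrix Prod.swap Prod.swap

theorem flip_mul {R : Type*} [Ring R] (A B : Matrix (Fin N × Fin N) (Fin N × Fin N) R) :
    flip (A * B) = flip A * flip B :=
  (Matrix.submatrix_mul_equiv A B Prod.swap (Equiv.prodComm _ _) Prod.swap).symm

@[simp] theorem flip_flip {R : Type*} (A : Matrix (Fin N × Fin N) (Fin N × Fin N) R) :
    flip (flip A) = A := rfl

@[simp] theorem flip_apply {R : Type*} (A : Matrix (Fin N × Fin N) (Fin N × Fin N) R) (p p') :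
    flip A p p' = A p.swap p'.swap := rfl

@[simp] theorem flip_one {R : Type*} [Ring R] :
    flip (1 : Matrix (Fin N × Fin N) (Fin N × Fin N) R) = 1 := by
  ext p p'
  simp [Matrix.one_apply, Prod.swap_inj]

variable {q : K} {x : Fin N → K}

/-- This and the next two identities are the coefficients of 1, X² and X in the unitarity relation
(`affine_mul_affine`). Each block is a rational identity; distinctness of the `x i` keeps the
denominators 1 - x i / x j nonzero. -/
theorem matZero_mul_flip_matInfty (hq : q ≠ 0) (hx : ∀ i, x i ≠ 0)
    (hx' : ∀ i j, i ≠ j → x i ≠ x j) : matZero q x * flip (matInfty q x) = 1 := by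
  ext ⟨i, j⟩ ⟨k, l⟩
  rw [Matrix.mul_apply, Matrix.one_apply]
  simp only [matZero, flip_apply, matInfty, Prod.fst_swap, Prod.snd_swap]
  by_cases hij : i = j
  · subst hij
    rw [sum_rEntry_mul_of_eq _ _ _ _ _ _
      (fun p => rEntry _ _ _ _ x p.2 p.1 l k), rEntry_of_eq]
    simp [eq_comm, and_comm]
  · rw [sum_rEntry_mul_of_ne _ _ _ _ _ hij (fun p => rEntry _ _ _ _ x p.2 p.1 l k)]
    have h1 : ∀ i j, i ≠ j → 1 - x i / x j ≠ 0 := fun i j h => by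
      rw [sub_ne_zero, ne_comm, Ne, div_eq_one_iff_eq (hx j)]
      exact hx' i j h
    by_cases h : k = i ∧ l = j
    · obtain ⟨rfl, rfl⟩ := h
      rw [rEntry_self _ _ _ _ _ hij, rEntry_swap _ _ _ _ _ hij, rEntry_self _ _ _ _ _ (Ne.symm hij),
        rEntry_swap _ _ _ _ _ hij]
      rcases lt_or_gt_of_ne hij with h | h
      · have := h1 k l hij
        simp only [h, h.not_gt, if_true, if_false, bScalar]
        field_simp
        ring
      · have := h1 l k (Ne.symm hij)
        simp only [h, h.not_gt, if_true, if_false, bScalar]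
        field_simp
        ring
    by_cases h' : k = j ∧ l = i
    · obtain ⟨rfl, rfl⟩ := h'
      rw [rEntry_self _ _ _ _ _ hij, rEntry_swap _ _ _ _ _ hij, rEntry_self _ _ _ _ _ hij,
        rEntry_swap _ _ _ _ _ (Ne.symm hij), if_neg (fun h => hij (congrArg Prod.fst h))]
      rcases lt_or_gt_of_ne hij with h | h
      · have := h1 l k hij
        simp only [h, h.not_gt, if_true, if_false, bScalar]
        field_simp
        ring
      · have := h1 k l (Ne.symm hij)
        simp only [h, h.not_gt, if_true, if_false, bScalar]
        field_simp
        ring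
    · rw [rEntry_of_ne (i := j) (j := i), rEntry_of_ne (i := i) (j := j) (i' := l), if_neg]
      · simp
      all_goals grind

/-- Flip the preceding identity; a one-sided inverse of a square matrix is two-sided. -/
theorem matInfty_mul_flip_matZero (hq : q ≠ 0) (hx : ∀ i, x i ≠ 0)
    (hx' : ∀ i j, i ≠ j → x i ≠ x j) : matInfty q x * flip (matZero q x) = 1 := by
  have h := congrArg flip (matZero_mul_flip_matInfty hq hx hx')
  rw [flip_mul, flip_flip, flip_one] at h
  exact mul_eq_one_comm.mp h

theorem matZero_mul_flip_matZero_add (hq : q ≠ 0) (hx : ∀ i, x i ≠ 0)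
    (hx' : ∀ i j, i ≠ j → x i ≠ x j) :
    (q ^ 2)⁻¹ • (matZero q x * flip (matZero q x)) + q ^ 2 • (matInfty q x * flip (matInfty q x)) =
      (q ^ 2 + (q ^ 2)⁻¹) • 1 := by
  ext ⟨i, j⟩ ⟨k, l⟩
  rw [Matrix.add_apply, Matrix.smul_apply, Matrix.smul_apply, Matrix.smul_apply, Matrix.mul_apply,
    Matrix.mul_apply, Matrix.one_apply]
  simp only [matZero, flip_apply, matInfty, Prod.fst_swap, Prod.snd_swap]
  by_cases hij : i = j
  · subst hij
    rw [sum_rEntry_mul_of_eq _ _ _ _ _ _ (fun p => rEntry _ _ _ _ x p.2 p.1 l k),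
      sum_rEntry_mul_of_eq _ _ _ _ _ _ (fun p => rEntry _ _ _ _ x p.2 p.1 l k), rEntry_of_eq,
      rEntry_of_eq]
    by_cases h : l = i ∧ k = i
    · obtain ⟨rfl, rfl⟩ := h
      simp [add_comm]
    · rw [if_neg h, if_neg (by grind)]
      simp
  · rw [sum_rEntry_mul_of_ne _ _ _ _ _ hij (fun p => rEntry _ _ _ _ x p.2 p.1 l k),
      sum_rEntry_mul_of_ne _ _ _ _ _ hij (fun p => rEntry _ _ _ _ x p.2 p.1 l k)]
    have h1 : ∀ i j, i ≠ j → 1 - x i / x j ≠ 0 := fun i j h => by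
      rw [sub_ne_zero, ne_comm, Ne, div_eq_one_iff_eq (hx j)]
      exact hx' i j h
    by_cases h : k = i ∧ l = j
    · obtain ⟨rfl, rfl⟩ := h
      simp only [rEntry_self _ _ _ _ _ hij, rEntry_swap _ _ _ _ _ hij,
        rEntry_self _ _ _ _ _ (Ne.symm hij)]
      rcases lt_or_gt_of_ne hij with h | h
      · have := h1 k l hij
        simp only [h, h.not_gt, if_true, if_false, bScalar, smul_eq_mul]
        field_simp
        ring
      · have := h1 l k (Ne.symm hij)
        simp only [h, h.not_gt, if_true, if_false, bScalar, smul_eq_mul]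
        field_simp
        ring
    by_cases h' : k = j ∧ l = i
    · obtain ⟨rfl, rfl⟩ := h'
      simp only [rEntry_self _ _ _ _ _ hij, rEntry_swap _ _ _ _ _ hij,
        rEntry_swap _ _ _ _ _ (Ne.symm hij)]
      rw [if_neg (fun h => hij (congrArg Prod.fst h) : ¬((l, k) = (k, l)))]
      rcases lt_or_gt_of_ne hij with h | h
      · have := h1 l k hij
        simp only [h, h.not_gt, if_true, if_false, bScalar, smul_eq_mul]
        field_simp
        ring
      · have := h1 k l (Ne.symm hij)
        simp only [h, h.not_gt, if_true, if_false, bScalar, smul_eq_mul]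
        field_simp
        ring
    · have e1 : ∀ (b : K → K) (bbar : K) (c cbar : K → K),
          rEntry b bbar c cbar x j i l k = 0 := fun _ _ _ _ => rEntry_of_ne _ _ _ _ _ (by grind)
            (by grind)
      have e2 : ∀ (b : K → K) (bbar : K) (c cbar : K → K),
          rEntry b bbar c cbar x i j l k = 0 := fun _ _ _ _ => rEntry_of_ne _ _ _ _ _ (by grind)
            (by grind)
      rw [e1, e2, e1, e2, if_neg (by grind)]
      simp

end TrigPoly

end EllipticGL
end

noncomputable section

namespace EllipticGL

open PowerSeries (C X)

/-! ### Entries of the R-matrices as degree-one polynomials over a common denominator -/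

section Factor

variable {N : ℕ} {K : Type*} [Field K]

/-- Apart from the common denominator each entry is affine in z, hence determined by its values at 0
and ∞. An entry 1 fits because 1 - q²z is the denominator itself. -/
theorem rEntry_trig_plus {q : K} (hq : q ≠ 0) (x : Fin N → K) (p p' : Fin N × Fin N) :
    rEntry (fun Y => C ((1 - (q ^ 2)⁻¹ * Y) * (1 - q ^ 2 * Y) / (1 - Y) ^ 2 * q) * (1 - X) *
          (1 - C (q ^ 2) * X)⁻¹)
        (C q * (1 - X) * (1 - C (q ^ 2) * X)⁻¹)
        (fun Y => C ((1 - q ^ 2) / (1 - Y)) * (1 - C Y * X) * (1 - C (q ^ 2) * X)⁻¹)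
        (fun Y => C ((1 - q ^ 2) / (1 - Y)) * (X - C Y) * (1 - C (q ^ 2) * X)⁻¹)
        x p.1 p.2 p'.1 p'.2 =
      (1 - C (q ^ 2) * X)⁻¹ * (C (matZero q x p p') - C (q ^ 2 * matInfty q x p p') * X) := by
  have hden : PowerSeries.constantCoeff (1 - C (q ^ 2) * X) ≠ 0 := by simp
  have hq2 : q ^ 2 * (q ^ 2)⁻¹ = 1 := mul_inv_cancel₀ (pow_ne_zero 2 hq)
  have hq1 : q ^ 2 * q⁻¹ = q := by field_simp
  simp only [matZero, matInfty]
  unfold rEntry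
  split_ifs
  · rw [mul_one, map_one, PowerSeries.inv_mul_cancel _ hden]
  · simp
  · simp only [bScalar]
    rw [mul_left_comm, hq1]
    ring
  · rw [hq1]
    ring
  · rw [show ∀ Y : K, q ^ 2 * ((1 - (q ^ 2)⁻¹) / (1 - Y) * -Y) = (1 - q ^ 2) / (1 - Y) * Y from
      fun Y => by simp only [div_eq_mul_inv]; linear_combination ((1 - Y)⁻¹ * Y) * hq2, map_mul]
    ring
  · rw [show ∀ Y : K, q ^ 2 * ((1 - (q ^ 2)⁻¹) / (1 - Y)) = - ((1 - q ^ 2) / (1 - Y)) from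
      fun Y => by simp only [div_eq_mul_inv]; linear_combination -(1 - Y)⁻¹ * hq2, map_mul, map_neg,
        map_neg]
    ring
  · simp

theorem rEntry_trig_minus {q : K} (hq : q ≠ 0) (x : Fin N → K) (p p' : Fin N × Fin N) :
    rEntry (fun Y => C ((1 - (q ^ 2)⁻¹ * Y) * (1 - q ^ 2 * Y) / (1 - Y) ^ 2 * q⁻¹) * (1 - X) *
          (1 - C (q ^ 2)⁻¹ * X)⁻¹)
        (C q⁻¹ * (1 - X) * (1 - C (q ^ 2)⁻¹ * X)⁻¹)
        (fun Y => C ((1 - (q ^ 2)⁻¹) / (1 - Y)) * (X - C Y) * (1 - C (q ^ 2)⁻¹ * X)⁻¹)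
        (fun Y => C ((1 - (q ^ 2)⁻¹) / (1 - Y)) * (1 - C Y * X) * (1 - C (q ^ 2)⁻¹ * X)⁻¹)
        x p.1 p.2 p'.1 p'.2 =
      (1 - C (q ^ 2)⁻¹ * X)⁻¹ *
        (C (matInfty q x p p') - C ((q ^ 2)⁻¹ * matZero q x p p') * X) := by
  have hden : PowerSeries.constantCoeff (1 - C (q ^ 2)⁻¹ * X) ≠ 0 := by simp
  have hq2 : q ^ 2 * (q ^ 2)⁻¹ = 1 := mul_inv_cancel₀ (pow_ne_zero 2 hq)
  have hq1 : (q ^ 2)⁻¹ * q = q⁻¹ := by field_simp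
  simp only [matZero, matInfty]
  unfold rEntry
  split_ifs
  · rw [mul_one, map_one, PowerSeries.inv_mul_cancel _ hden]
  · simp
  · simp only [bScalar]
    rw [mul_left_comm, hq1]
    ring
  · rw [hq1]
    ring
  · rw [show ∀ Y : K, (q ^ 2)⁻¹ * ((1 - q ^ 2) / (1 - Y)) = - ((1 - (q ^ 2)⁻¹) / (1 - Y)) from
      fun Y => by simp only [div_eq_mul_inv]; linear_combination -(1 - Y)⁻¹ * hq2, map_mul, map_neg,
        map_neg]
    ring
  · rw [show ∀ Y : K, (q ^ 2)⁻¹ * ((1 - q ^ 2) / (1 - Y) * -Y) = (1 - (q ^ 2)⁻¹) / (1 - Y) * Y from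
      fun Y => by simp only [div_eq_mul_inv]; linear_combination ((1 - Y)⁻¹ * Y) * hq2, map_mul]
    ring
  · simp

theorem edge_rEntry {s : Fin 2} (b : K → MvPowerSeries (Fin 2) K) (bbar : MvPowerSeries (Fin 2) K)
    (c cbar : K → MvPowerSeries (Fin 2) K) (x : Fin N → K) (i j i' j' : Fin N) :
    edge s (rEntry b bbar c cbar x i j i' j') =
      rEntry (fun Y => edge s (b Y)) (edge s bbar) (fun Y => edge s (c Y))
        (fun Y => edge s (cbar Y)) x i j i' j' := by
  unfold rEntry
  split_ifs <;> simp

theorem edge_zero_bE (q Y : K) : edge 0 (bE q Y) =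
    C ((1 - (q ^ 2)⁻¹ * Y) * (1 - q ^ 2 * Y) / (1 - Y) ^ 2 * q) * (1 - X) *
          (1 - C (q ^ 2) * X)⁻¹ := by
  simp only [bE, map_mul (edge 0), map_pow (edge 0), edge_C, edge_thetaC, edge_inv, edge_zero_thetaZ]
  rw [PowerSeries.mul_inv_rev, ← map_pow, PowerSeries_C_inv, div_eq_mul_inv]
  simp only [map_mul C, map_one, one_mul]
  ring

theorem edge_one_bE (q Y : K) : edge 1 (bE q Y) =
    C ((1 - (q ^ 2)⁻¹ * Y) * (1 - q ^ 2 * Y) / (1 - Y) ^ 2 * q) * (1 - X) *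
          (1 - C (q ^ 2)⁻¹ * X)⁻¹ := by
  simp only [bE, map_mul (edge 1), map_pow (edge 1), edge_C, edge_thetaC, edge_inv, edge_one_thetaZ]
  rw [PowerSeries.mul_inv_rev, ← map_pow, PowerSeries_C_inv, div_eq_mul_inv]
  simp only [map_mul C, map_one, one_mul, inv_one]
  ring

theorem edge_zero_bbarE (q : K) : edge 0 (bbarE q) = C q * (1 - X) * (1 - C (q ^ 2) * X)⁻¹ := by
  simp only [bbarE, map_mul (edge 0), edge_C, edge_inv, edge_zero_thetaZ, map_one, one_mul]

theorem edge_one_bbarE (q : K) : edge 1 (bbarE q) = C q * (1 - X) * (1 - C (q ^ 2)⁻¹ * X)⁻¹ := by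
  simp only [bbarE, map_mul (edge 1), edge_C, edge_inv, edge_one_thetaZ, map_one, one_mul, inv_one]

theorem edge_zero_cE (q Y : K) : edge 0 (cE q Y) =
    C ((1 - q ^ 2) / (1 - Y)) * (1 - C Y * X) * (1 - C (q ^ 2) * X)⁻¹ := by
  simp only [cE, map_mul (edge 0), edge_thetaC, edge_inv, edge_zero_thetaZ]
  rw [PowerSeries.mul_inv_rev, PowerSeries_C_inv, div_eq_mul_inv, map_mul C]
  ring

theorem edge_one_cE (q Y : K) : edge 1 (cE q Y) =
    C ((1 - q ^ 2) / (1 - Y)) * (1 - C Y⁻¹ * X) * (1 - C (q ^ 2)⁻¹ * X)⁻¹ := by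
  simp only [cE, map_mul (edge 1), edge_thetaC, edge_inv, edge_one_thetaZ]
  rw [PowerSeries.mul_inv_rev, PowerSeries_C_inv, div_eq_mul_inv, map_mul C]
  ring

/-- At Y = 1 both sides vanish by the convention for division by zero, so Y ≠ 1 need not be assumed.
-/
theorem div_one_sub_inv {Y : K} (hY : Y ≠ 0) (a : K) : a / (1 - Y⁻¹) = - (a / (1 - Y) * Y) := by
  by_cases h : Y = 1
  · simp [h]
  · have h1 : 1 - Y ≠ 0 := sub_ne_zero.mpr (Ne.symm h)
    have h2 : 1 - Y⁻¹ ≠ 0 := by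
      rw [sub_ne_zero, ne_comm, Ne, inv_eq_one]
      exact h
    have h3 : Y - 1 ≠ 0 := sub_ne_zero.mpr h
    field_simp
    ring

theorem edge_zero_cbarE (q : K) {Y : K} (hY : Y ≠ 0) : edge 0 (cbarE q Y) =
    C ((1 - q ^ 2) / (1 - Y)) * (X - C Y) * (1 - C (q ^ 2) * X)⁻¹ := by
  have hC : (C Y : PowerSeries K) * C Y⁻¹ = 1 := by rw [← map_mul, mul_inv_cancel₀ hY, map_one]
  rw [cbarE, edge_zero_cE, div_one_sub_inv hY, map_neg, map_mul]
  linear_combination C ((1 - q ^ 2) / (1 - Y)) * X * (1 - C (q ^ 2) * X)⁻¹ * hC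

theorem edge_zero_rEntry (q : K) {x : Fin N → K} (hx : ∀ i, x i ≠ 0) (i j i' j' : Fin N) :
    edge 0 (rEntry (bE q) (bbarE q) (cE q) (cbarE q) x i j i' j') =
    rEntry (fun Y => C ((1 - (q ^ 2)⁻¹ * Y) * (1 - q ^ 2 * Y) / (1 - Y) ^ 2 * q) * (1 - X) *
          (1 - C (q ^ 2) * X)⁻¹)
        (C q * (1 - X) * (1 - C (q ^ 2) * X)⁻¹)
        (fun Y => C ((1 - q ^ 2) / (1 - Y)) * (1 - C Y * X) * (1 - C (q ^ 2) * X)⁻¹)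
        (fun Y => C ((1 - q ^ 2) / (1 - Y)) * (X - C Y) * (1 - C (q ^ 2) * X)⁻¹) x i j i' j' := by
  rw [edge_rEntry]
  unfold rEntry
  split_ifs
  · rfl
  · rfl
  · exact edge_zero_bE _ _
  · exact edge_zero_bbarE _
  · exact edge_zero_cE _ _
  · exact edge_zero_cbarE _ (div_ne_zero (hx _) (hx _))
  · rfl

/-- The factor q² comes from 1 - q² = -q²(1 - q⁻²) and from q = q² q⁻¹. The ratio x i' / x i comes
from 1 - Y⁻¹w = -Y⁻¹(w - Y) in c, and from `div_one_sub_inv` in c̄. The twist in the definition of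
L⁻ has to compensate this gauge factor. -/
theorem edge_one_rEntry {q : K} (hq : q ≠ 0) {x : Fin N → K} (hx : ∀ i, x i ≠ 0)
    (i j i' j' : Fin N) :
    edge 1 (rEntry (bE q) (bbarE q) (cE q) (cbarE q) x i j i' j') =
    C ((if i = j then 1 else q ^ 2) * (x i' / x i)) *
    rEntry (fun Y => C ((1 - (q ^ 2)⁻¹ * Y) * (1 - q ^ 2 * Y) / (1 - Y) ^ 2 * q⁻¹) * (1 - X) *
          (1 - C (q ^ 2)⁻¹ * X)⁻¹)
        (C q⁻¹ * (1 - X) * (1 - C (q ^ 2)⁻¹ * X)⁻¹)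
        (fun Y => C ((1 - (q ^ 2)⁻¹) / (1 - Y)) * (X - C Y) * (1 - C (q ^ 2)⁻¹ * X)⁻¹)
        (fun Y => C ((1 - (q ^ 2)⁻¹) / (1 - Y)) * (1 - C Y * X) * (1 - C (q ^ 2)⁻¹ * X)⁻¹)
        x i j i' j' := by
  have hq1 : ∀ B : K, q ^ 2 * (B * q⁻¹) = B * q := fun B => by field_simp
  have hq2 : q ^ 2 * (q ^ 2)⁻¹ = 1 := mul_inv_cancel₀ (pow_ne_zero 2 hq)
  rw [edge_rEntry]
  unfold rEntry
  split_ifs with h1 h2 h3 h4 h5 h6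
  · obtain ⟨rfl, rfl⟩ := h2
    rw [div_self (hx _)]
    simp
  · simp
  · obtain ⟨rfl, rfl⟩ := h3
    beta_reduce
    rw [edge_one_bE, div_self (hx _), mul_one, ← mul_assoc, ← mul_assoc, ← map_mul, hq1]
  · obtain ⟨rfl, rfl⟩ := h3
    rw [edge_one_bbarE, div_self (hx _), mul_one, ← mul_assoc, ← mul_assoc, ← map_mul]
    congr 3
    field_simp
  · obtain ⟨rfl, rfl⟩ := h5
    have hY := div_ne_zero (hx j') (hx i')
    have e : x i' / x j' = (x j' / x i')⁻¹ := (inv_div _ _).symm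
    beta_reduce
    rw [edge_one_cE, e]
    generalize x j' / x i' = Y at hY
    have hC : (C Y : PowerSeries K) * C Y⁻¹ = 1 := by rw [← map_mul, mul_inv_cancel₀ hY, map_one]
    have e2 : C ((1 - q ^ 2) / (1 - Y)) = - C (q ^ 2) * C ((1 - (q ^ 2)⁻¹) / (1 - Y)) := by
      rw [← map_neg, ← map_mul]
      congr 1
      simp only [div_eq_mul_inv]
      linear_combination (-(1 - Y)⁻¹) * hq2
    rw [e2, map_mul]
    linear_combination (C (q ^ 2) * C ((1 - (q ^ 2)⁻¹) / (1 - Y)) * (1 - C (q ^ 2)⁻¹ * X)⁻¹) * hC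
  · obtain ⟨rfl, rfl⟩ := h5
    have hY := div_ne_zero (hx i') (hx j')
    beta_reduce
    rw [cbarE, edge_one_cE, inv_inv, div_one_sub_inv hY, ← mul_assoc, ← mul_assoc, ← map_mul]
    congr 3
    generalize x i' / x j' = Y
    simp only [div_eq_mul_inv]
    linear_combination (Y * (1 - Y)⁻¹) * hq2
  · simp

end Factor

/-! ### Leading coefficients of the elliptic R-matrix -/

section Scalars

variable {N : ℕ} {hbar : ℂ}

theorem qF_ne_zero : qF N hbar ≠ 0 :=
  (map_ne_zero (algebraMap ℂ (FF N))).mpr (Complex.exp_ne_zero _)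

/-- The scalar factor of `R₀⁺`. -/
def scalarPlus (N : ℕ) (hbar : ℂ) : PowerSeries ℂ :=
  rhoT N hbar * (1 - C (Complex.exp hbar ^ 2) * X)⁻¹

/-- The scalar factor of `R₀⁻`. -/
def scalarMinus (N : ℕ) (hbar : ℂ) : PowerSeries ℂ :=
  (rhoT N hbar)⁻¹ * (1 - C (Complex.exp hbar ^ 2)⁻¹ * X)⁻¹

theorem constantCoeff_one_sub (a : ℂ) : PowerSeries.constantCoeff (1 - C a * X) = 1 := by
  simp

theorem scalarPlus_mul_scalarMinus (hN : 1 ≤ N) (hq : ‖Complex.exp hbar‖ < 1) :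
    scalarPlus N hbar * scalarMinus N hbar *
      ((1 - C (Complex.exp hbar ^ 2) * X) * (1 - C (Complex.exp hbar ^ 2)⁻¹ * X)) = 1 := by
  have h1 := PowerSeries.mul_inv_cancel (rhoT N hbar) (constantCoeff_rhoT_ne_zero hN hq)
  have h2 := PowerSeries.mul_inv_cancel (1 - C (Complex.exp hbar ^ 2) * X)
    (by rw [constantCoeff_one_sub]; exact one_ne_zero)
  have h3 := PowerSeries.mul_inv_cancel (1 - C (Complex.exp hbar ^ 2)⁻¹ * X)
    (by rw [constantCoeff_one_sub]; exact one_ne_zero)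
  rw [scalarPlus, scalarMinus]
  calc _ = (rhoT N hbar * (rhoT N hbar)⁻¹) *
      ((1 - C (Complex.exp hbar ^ 2) * X) * (1 - C (Complex.exp hbar ^ 2) * X)⁻¹) *
      ((1 - C (Complex.exp hbar ^ 2)⁻¹ * X) * (1 - C (Complex.exp hbar ^ 2)⁻¹ * X)⁻¹) := by ring
    _ = 1 := by rw [h1, h2, h3, mul_one, mul_one]

theorem map_one_sub_C_mul_X {K K' : Type*} [Field K] [Field K'] (φ : K →+* K') (a : K) :
    PowerSeries.map φ (1 - C a * X) = 1 - C (φ a) * X := by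
  simp

/-- The matrix of `R₀^±`. -/
def trigMat {N : ℕ} (hbar : ℂ) (sgn : Bool) (x : Fin N → FF N) :
    Matrix (Fin N × Fin N) (Fin N × Fin N) (PowerSeries (FF N)) :=
  fun p p' => rTrig hbar sgn x p.1 p.2 p'.1 p'.2

theorem trigMat_true (x : Fin N → FF N) (p p' : Fin N × Fin N) :
    trigMat hbar true x p p' = PowerSeries.map (algebraMap ℂ (FF N)) (scalarPlus N hbar) *
      (C (matZero (qF N hbar) x p p') -
        C (qF N hbar ^ 2 * matInfty (qF N hbar) x p p') * X) := by
  have hq2 : algebraMap ℂ (FF N) (Complex.exp hbar ^ 2) = qF N hbar ^ 2 := map_pow _ _ _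
  rw [scalarPlus, map_mul, PowerSeries_map_inv, map_one_sub_C_mul_X, hq2, mul_assoc,
    ← rEntry_trig_plus qF_ne_zero]
  rfl

theorem trigMat_false (x : Fin N → FF N) (p p' : Fin N × Fin N) :
    trigMat hbar false x p p' = PowerSeries.map (algebraMap ℂ (FF N)) (scalarMinus N hbar) *
      (C (matInfty (qF N hbar) x p p') -
        C ((qF N hbar ^ 2)⁻¹ * matZero (qF N hbar) x p p') * X) := by
  have hq2 : algebraMap ℂ (FF N) (Complex.exp hbar ^ 2)⁻¹ = (qF N hbar ^ 2)⁻¹ := by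
    rw [map_inv₀, map_pow]
    rfl
  rw [scalarMinus, map_mul, PowerSeries_map_inv _ (1 - _), map_one_sub_C_mul_X, hq2, mul_assoc,
    ← rEntry_trig_minus qF_ne_zero]
  rfl

theorem edge_zero_rPlus (hN : 1 ≤ N) (hq : ‖Complex.exp hbar‖ < 1) {x : Fin N → FF N}
    (hx : ∀ i, x i ≠ 0) (i j i' j' : Fin N) :
    edge 0 (rPlus hbar x i j i' j') = rTrig hbar true x i j i' j' := by
  rw [rPlus, map_mul, edge_map, edge_zero_rhoE hN hq, edge_zero_rEntry _ hx]
  rfl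

theorem edge_one_rPlus (hN : 1 ≤ N) (hq : ‖Complex.exp hbar‖ < 1) {x : Fin N → FF N}
    (hx : ∀ i, x i ≠ 0) (i j i' j' : Fin N) :
    edge 1 (rPlus hbar x i j i' j') =
      C (algebraMap ℂ (FF N) (qPow N hbar ^ 2) * ((if i = j then 1 else qF N hbar ^ 2) *
        (x i' / x i))) * rTrig hbar false x i j i' j' := by
  rw [rPlus, map_mul, edge_map, edge_one_rhoE hN hq, edge_one_rEntry qF_ne_zero hx,
    map_mul (PowerSeries.map _), PowerSeries.map_C, map_mul C (algebraMap ℂ (FF N) _),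
    mul_mul_mul_comm]
  rfl

theorem rCoeff_of_nonneg (hN : 1 ≤ N) (hq : ‖Complex.exp hbar‖ < 1) {x : Fin N → FF N}
    (hx : ∀ i, x i ≠ 0) (i j i' j' : Fin N) (k : ℕ) :
    rCoeff hbar x i j i' j' k 0 = PowerSeries.coeff k (rTrig hbar true x i j i' j') := by
  rw [← edge_zero_rPlus hN hq hx, coeff_edge, rCoeff, if_pos (by positivity)]
  simp

theorem rCoeff_of_nonpos (hN : 1 ≤ N) (hq : ‖Complex.exp hbar‖ < 1) {x : Fin N → FF N}
    (hx : ∀ i, x i ≠ 0) (i j i' j' : Fin N) (k : ℕ) :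
    rCoeff hbar x i j i' j' (-(k : ℤ)) k =
      algebraMap ℂ (FF N) (qPow N hbar ^ 2) * ((if i = j then 1 else qF N hbar ^ 2) *
        (x i' / x i)) * PowerSeries.coeff k (rTrig hbar false x i j i' j') := by
  rw [← PowerSeries.coeff_C_mul, ← edge_one_rPlus hN hq hx, coeff_edge, rCoeff, if_pos (by simp)]
  simp

theorem rCoeff_eq_zero (x : Fin N → FF N) (i j i' j' : Fin N) {k : ℤ} {m : ℕ} (h : k + m < 0) :
    rCoeff hbar x i j i' j' k m = 0 := if_neg h.not_ge

end Scalars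
end EllipticGL
end

noncomputable section

namespace EllipticGL

open PowerSeries (C X)

/-! ### Exponentials of the dynamical variables under translation -/

section Dynamical

variable {N : ℕ} {hbar : ℂ}

theorem hbar_ne_zero (hq : ‖Complex.exp hbar‖ < 1) : hbar ≠ 0 := by
  rintro rfl
  simp at hq

theorem FF_algebraMap_ne_zero {f : Entire N} {v : Hyper N × Hyper N} (h : f.1 v ≠ 0) :
    algebraMap (Entire N) (FF N) f ≠ 0 := by
  refine (map_ne_zero_iff _ (IsFractionRing.injective (Entire N) (FF N))).mpr ?_
  rintro rfl
  exact h rfl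

theorem xL_ne_zero (i : Fin N) : xL hbar i ≠ 0 :=
  FF_algebraMap_ne_zero (v := 0) (Complex.exp_ne_zero _)

theorem xR_ne_zero (i : Fin N) : xR hbar i ≠ 0 :=
  FF_algebraMap_ne_zero (v := 0) (Complex.exp_ne_zero _)

/-- At the point (2ħ)⁻¹ ε̄ᵢ the exponents are 1 - 1/N and -1/N, so the two values differ by the
factor e. -/
theorem exp_ne_exp_of_ne (hq : hbar ≠ 0) {i j : Fin N} (hij : i ≠ j) :
    Complex.exp (2 * hbar * ((((2 * hbar)⁻¹ • epsBar i : Hyper N) : Fin N → ℂ) i)) ≠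
      Complex.exp (2 * hbar * ((((2 * hbar)⁻¹ • epsBar i : Hyper N) : Fin N → ℂ) j)) := by
  have h2 : 2 * hbar ≠ 0 := mul_ne_zero two_ne_zero hq
  have hv : ∀ k, 2 * hbar * ((((2 * hbar)⁻¹ • epsBar i : Hyper N) : Fin N → ℂ) k) =
      (if k = i then 1 else 0) - 1 / (N : ℂ) := fun k => by
    simp only [Submodule.coe_smul, Pi.smul_apply, smul_eq_mul]
    rw [← mul_assoc, mul_inv_cancel₀ h2, one_mul]
    rfl
  rw [hv, hv, if_pos rfl, if_neg (Ne.symm hij), Complex.exp_sub, Complex.exp_sub, Complex.exp_zero]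
  intro h
  rw [div_left_inj' (Complex.exp_ne_zero _)] at h
  have : (Real.exp 1 : ℂ) = ((1 : ℝ) : ℂ) := by simpa using h
  have h1 : Real.exp 1 = 1 := by exact_mod_cast this
  exact one_ne_zero ((Real.exp_eq_one_iff 1).mp h1)

theorem xL_ne (hq : hbar ≠ 0) {i j : Fin N} (hij : i ≠ j) : xL hbar i ≠ xL hbar j := by
  intro h
  have h' := congrArg Subtype.val (IsFractionRing.injective (Entire N) (FF N) h)
  exact exp_ne_exp_of_ne hq hij (congrFun h' ((2 * hbar)⁻¹ • epsBar i, 0))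

theorem xR_ne (hq : hbar ≠ 0) {i j : Fin N} (hij : i ≠ j) : xR hbar i ≠ xR hbar j := by
  intro h
  have h' := congrArg Subtype.val (IsFractionRing.injective (Entire N) (FF N) h)
  exact exp_ne_exp_of_ne hq hij (congrFun h' (0, (2 * hbar)⁻¹ • epsBar i))

theorem shift_algebraMap (a b : Hyper N) (f : Entire N) :
    shift a b (algebraMap (Entire N) (FF N) f) = algebraMap (Entire N) (FF N) (entireShift a b f) :=
  IsFractionRing.ringEquivOfRingEquiv_algebraMap _ _

theorem algebraMap_FF (c : ℂ) :
    algebraMap ℂ (FF N) c = algebraMap (Entire N) (FF N) (algebraMap ℂ (Entire N) c) :=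
  IsScalarTower.algebraMap_apply _ _ _ _

theorem shift_xL (a b : Hyper N) (i : Fin N) :
    shift a b (xL hbar i) =
      algebraMap ℂ (FF N) (Complex.exp (-(2 * hbar * (a : Fin N → ℂ) i))) * xL hbar i := by
  rw [algebraMap_FF, xL, shift_algebraMap, ← map_mul]
  congr 1
  refine Subtype.ext (funext fun v => ?_)
  change Complex.exp (2 * hbar * ((v.1 - a : Hyper N) : Fin N → ℂ) i) =
    Complex.exp (-(2 * hbar * (a : Fin N → ℂ) i)) * Complex.exp (2 * hbar * (v.1 : Fin N → ℂ) i)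
  rw [← Complex.exp_add]
  congr 1
  simp only [Submodule.coe_sub, Pi.sub_apply]
  ring

theorem shift_xR (a b : Hyper N) (i : Fin N) :
    shift a b (xR hbar i) =
      algebraMap ℂ (FF N) (Complex.exp (-(2 * hbar * (b : Fin N → ℂ) i))) * xR hbar i := by
  rw [algebraMap_FF, xR, shift_algebraMap, ← map_mul]
  congr 1
  refine Subtype.ext (funext fun v => ?_)
  change Complex.exp (2 * hbar * ((v.2 - b : Hyper N) : Fin N → ℂ) i) =
    Complex.exp (-(2 * hbar * (b : Fin N → ℂ) i)) * Complex.exp (2 * hbar * (v.2 : Fin N → ℂ) i)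
  rw [← Complex.exp_add]
  congr 1
  simp only [Submodule.coe_sub, Pi.sub_apply]
  ring

/-- The constant `q^{-2(ε̄ᵢ, ε̄ⱼ)}`. -/
def epsPow {N : ℕ} (hbar : ℂ) (i j : Fin N) : ℂ :=
  Complex.exp (-(2 * hbar * (epsBar i : Fin N → ℂ) j))

theorem epsPow_ne_zero (i j : Fin N) : epsPow hbar i j ≠ 0 := Complex.exp_ne_zero _

theorem epsPow_eq (i j : Fin N) : epsPow hbar i j =
    (if i = j then (Complex.exp hbar ^ 2)⁻¹ else 1) * Complex.exp (2 * hbar / N) := by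
  have h : (epsBar i : Fin N → ℂ) j = (if j = i then 1 else 0) - 1 / (N : ℂ) := rfl
  rw [epsPow, h]
  by_cases hij : i = j
  · subst hij
    rw [if_pos rfl, if_pos rfl, ← Complex.exp_nat_mul, ← Complex.exp_neg, ← Complex.exp_add]
    congr 1
    push_cast
    ring
  · rw [if_neg hij, if_neg (Ne.symm hij), one_mul]
    congr 1
    ring

end Dynamical

/-! ### Unitarity of the trigonometric R-matrix -/

section Unitarity

variable {N : ℕ} {hbar : ℂ}

theorem trigMat_true_eq (x : Fin N → FF N) :
    trigMat hbar true x = PowerSeries.map (algebraMap ℂ (FF N)) (scalarPlus N hbar) •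
      ((C : FF N →+* _).mapMatrix (matZero (qF N hbar) x) -
        (X : PowerSeries (FF N)) •
          (C : FF N →+* _).mapMatrix (qF N hbar ^ 2 • matInfty (qF N hbar) x)) := by
  ext1 p p'
  rw [trigMat_true]
  simp [mul_comm]

theorem trigMat_false_eq (x : Fin N → FF N) :
    trigMat hbar false x = PowerSeries.map (algebraMap ℂ (FF N)) (scalarMinus N hbar) •
      ((C : FF N →+* _).mapMatrix (matInfty (qF N hbar) x) -
        (X : PowerSeries (FF N)) •
          (C : FF N →+* _).mapMatrix ((qF N hbar ^ 2)⁻¹ • matZero (qF N hbar) x)) := by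
  ext1 p p'
  rw [trigMat_false]
  simp [mul_comm]

theorem flip_trigMat_false_eq (x : Fin N → FF N) :
    flip (trigMat hbar false x) = PowerSeries.map (algebraMap ℂ (FF N)) (scalarMinus N hbar) •
      ((C : FF N →+* _).mapMatrix (flip (matInfty (qF N hbar) x)) -
        (X : PowerSeries (FF N)) •
          (C : FF N →+* _).mapMatrix ((qF N hbar ^ 2)⁻¹ • flip (matZero (qF N hbar) x))) := by
  rw [trigMat_false_eq]
  rfl

end Unitarity

/-- The hypotheses are exactly the coefficients of 1, X² and X in the product of the two linear
pencils; in X² the scalars q² and q⁻² cancel. -/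
theorem affine_mul_affine {ι K : Type*} [Fintype ι] [DecidableEq ι] [Field K] {q : K} (hq0 : q ≠ 0)
    {A B A' B' : Matrix ι ι K} (h1 : A * B' = 1) (h2 : B * A' = 1)
    (h3 : (q ^ 2)⁻¹ • (A * A') + q ^ 2 • (B * B') = (q ^ 2 + (q ^ 2)⁻¹) • 1) :
    ((C : K →+* _).mapMatrix A - (X : PowerSeries K) • (C : K →+* _).mapMatrix (q ^ 2 • B)) *
      ((C : K →+* _).mapMatrix B' - (X : PowerSeries K) •
        (C : K →+* _).mapMatrix ((q ^ 2)⁻¹ • A')) =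
      ((1 - C (q ^ 2) * X) * (1 - C (q ^ 2)⁻¹ * X) : PowerSeries K) • 1 := by
  have h5 : (q ^ 2 • B) * ((q ^ 2)⁻¹ • A') = 1 := by
    rw [smul_mul_smul_comm, mul_inv_cancel₀ (pow_ne_zero 2 hq0), one_smul, h2]
  have h6 : A * ((q ^ 2)⁻¹ • A') + (q ^ 2 • B) * B' = (q ^ 2 + (q ^ 2)⁻¹) • 1 := by
    rw [mul_smul_comm, smul_mul_assoc, h3]
  have h7 : (C (q ^ 2) : PowerSeries K) * C (q ^ 2)⁻¹ = 1 := by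
    rw [← map_mul, mul_inv_cancel₀ (pow_ne_zero 2 hq0), map_one]
  have h8 : (C : K →+* PowerSeries K).mapMatrix ((q ^ 2 + (q ^ 2)⁻¹) •
      (1 : Matrix ι ι K)) = (C (q ^ 2) + C (q ^ 2)⁻¹) • 1 := by
    ext1 p p'
    by_cases hp : p = p' <;> simp [hp]
  generalize q ^ 2 • B = B2 at *
  generalize (q ^ 2)⁻¹ • A' = A2 at *
  calc _ = (C : K →+* _).mapMatrix (A * B') - (X : PowerSeries K) •
        (C : K →+* _).mapMatrix (A * A2 + B2 * B') + (X ^ 2 : PowerSeries K) •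
        (C : K →+* _).mapMatrix (B2 * A2) := by
        simp only [sub_mul, mul_sub, smul_mul_assoc, mul_smul_comm, map_add, map_mul, smul_add,
          smul_sub, smul_smul, sq]
        abel
    _ = (1 : PowerSeries K) • 1 - (X * (C (q ^ 2) + C (q ^ 2)⁻¹) : PowerSeries K) • 1 +
        (X ^ 2 : PowerSeries K) • 1 := by
        rw [h1, h5, h6, h8, map_one, smul_smul, one_smul]
    _ = _ := by
        rw [← sub_smul, ← add_smul]
        congr 1
        linear_combination - X ^ 2 * h7

section Unitarity

variable {N : ℕ} {hbar : ℂ}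

/-- The pencils multiply to (1 - q²X)(1 - q⁻²X), and the product of the two scalar factors is the
inverse of this polynomial. -/
theorem trigMat_unitary (hN : 1 ≤ N) (hq : ‖Complex.exp hbar‖ < 1) {x : Fin N → FF N}
    (hx : ∀ i, x i ≠ 0) (hx' : ∀ i j, i ≠ j → x i ≠ x j) :
    trigMat hbar true x * flip (trigMat hbar false x) = 1 := by
  have hq0 := qF_ne_zero (N := N) (hbar := hbar)
  have hq2 : algebraMap ℂ (FF N) (Complex.exp hbar ^ 2) = qF N hbar ^ 2 := map_pow _ _ _
  have hq2' : algebraMap ℂ (FF N) (Complex.exp hbar ^ 2)⁻¹ = (qF N hbar ^ 2)⁻¹ := by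
    rw [map_inv₀, hq2]
  have h4 := congrArg (PowerSeries.map (algebraMap ℂ (FF N))) (scalarPlus_mul_scalarMinus hN hq)
  rw [map_mul, map_mul, map_mul, map_one_sub_C_mul_X, map_one_sub_C_mul_X, map_one, hq2, hq2'] at h4
  rw [trigMat_true_eq, flip_trigMat_false_eq, smul_mul_smul_comm,
    affine_mul_affine hq0 (matZero_mul_flip_matInfty hq0 hx hx')
      (matInfty_mul_flip_matZero hq0 hx hx') (matZero_mul_flip_matZero_add hq0 hx hx'),
    smul_smul, h4, one_smul]

end Unitarity

end EllipticGL
end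

noncomputable section

namespace EllipticGL

/-! ### Representations of the dynamical commutation relations -/

/-- A realization in a `ℂ`-algebra `S` of the generators of `DynAlg N G row col deg`, subject to its
relations. -/
structure DynData (N : ℕ) (G : Type) (row col : G → Fin N) (deg : G → ℤ) (S : Type*) [Ring S]
    [Algebra ℂ S] where
  fn : FF N →ₐ[ℂ] S
  gen : G → S
  d : S
  qc : S
  qcInv : S
  fn_gen : ∀ f g, fn f * gen g = gen g * fn (shift (epsBar (row g)) (epsBar (col g)) f)
  d_fn : ∀ f, d * fn f = fn f * d
  d_gen : ∀ g, d * gen g - gen g * d = (deg g : ℂ) • gen g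
  qc_fn : ∀ f, qc * fn f = fn f * qc
  qc_gen : ∀ g, qc * gen g = gen g * qc
  qc_d : qc * d = d * qc
  qc_qcInv : qc * qcInv = 1
  qcInv_qc : qcInv * qc = 1

section DynAlg

variable {N : ℕ} {G : Type} {row col : G → Fin N} {deg : G → ℤ}

theorem DynAlg.of_eq_mkAlgHom (a : DynGen N G) :
    (DynAlg.of a : DynAlg N G row col deg) = RingQuot.mkAlgHom ℂ _ (FreeAlgebra.ι ℂ a) := by
  rw [DynAlg.of, ← RingQuot.mkAlgHom_coe ℂ]
  rfl

theorem DynAlg.algHom_ext {S : Type*} [Ring S] [Algebra ℂ S]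
    {φ ψ : DynAlg N G row col deg →ₐ[ℂ] S} (h : ∀ a, φ (DynAlg.of a) = ψ (DynAlg.of a)) :
    φ = ψ := by
  refine RingQuot.ringQuot_ext' _ _ _ (FreeAlgebra.hom_ext (funext fun a => ?_))
  have := h a
  rw [DynAlg.of_eq_mkAlgHom] at this
  exact this

theorem DynAlg.rel {x y : FreeAlgebra ℂ (DynGen N G)} (h : DynRel N G row col deg x y) :
    RingQuot.mkAlgHom ℂ (DynRel N G row col deg) x = RingQuot.mkAlgHom ℂ _ y :=
  RingQuot.mkAlgHom_rel ℂ h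

variable (N G row col deg) in
/-- The tautological realization. -/
def DynData.univ : DynData N G row col deg (DynAlg N G row col deg) where
  fn := AlgHom.ofLinearMap
    { toFun := fun f => DynAlg.of (.fn f)
      map_add' := fun f g => by
        simp only [DynAlg.of_eq_mkAlgHom, ← map_add]
        exact DynAlg.rel (.fn_add f g)
      map_smul' := fun a f => by
        simp only [DynAlg.of_eq_mkAlgHom, RingHom.id_apply, Algebra.smul_def]
        rw [DynAlg.rel (.fn_mul _ f), map_mul, DynAlg.rel (.fn_const a), AlgHom.commutes] }
    (by
      change DynAlg.of (.fn 1) = 1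
      rw [DynAlg.of_eq_mkAlgHom, ← map_one (algebraMap ℂ (FF N)), DynAlg.rel (.fn_const 1), map_one,
        map_one])
    (fun f g => by
      change DynAlg.of (.fn (f * g)) = DynAlg.of (.fn f) * DynAlg.of (.fn g)
      simp only [DynAlg.of_eq_mkAlgHom, ← map_mul]
      exact DynAlg.rel (.fn_mul f g))
  gen g := DynAlg.of (.gen g)
  d := DynAlg.of .d
  qc := DynAlg.of .qc
  qcInv := DynAlg.of .qcInv
  fn_gen f g := by
    change DynAlg.of (.fn _) * DynAlg.of _ = DynAlg.of _ * DynAlg.of (.fn _)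
    simp only [DynAlg.of_eq_mkAlgHom, ← map_mul]
    exact DynAlg.rel (.fn_gen f g)
  d_fn f := by
    change DynAlg.of _ * DynAlg.of (.fn _) = DynAlg.of (.fn _) * DynAlg.of _
    simp only [DynAlg.of_eq_mkAlgHom, ← map_mul]
    exact DynAlg.rel (.d_fn f)
  d_gen g := by
    simp only [DynAlg.of_eq_mkAlgHom, ← map_mul, ← map_sub, ← map_smul]
    exact DynAlg.rel (.d_gen g)
  qc_fn f := by
    change DynAlg.of _ * DynAlg.of (.fn _) = DynAlg.of (.fn _) * DynAlg.of _
    simp only [DynAlg.of_eq_mkAlgHom, ← map_mul]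
    exact DynAlg.rel (.qc_central _)
  qc_gen g := by
    simp only [DynAlg.of_eq_mkAlgHom, ← map_mul]
    exact DynAlg.rel (.qc_central _)
  qc_d := by
    simp only [DynAlg.of_eq_mkAlgHom, ← map_mul]
    exact DynAlg.rel (.qc_central _)
  qc_qcInv := by
    simp only [DynAlg.of_eq_mkAlgHom, ← map_mul]
    rw [DynAlg.rel .qc_qcInv, map_one]
  qcInv_qc := by
    simp only [DynAlg.of_eq_mkAlgHom, ← map_mul]
    rw [DynAlg.rel .qcInv_qc, map_one]

variable {S S' : Type*} [Ring S] [Algebra ℂ S] [Ring S'] [Algebra ℂ S']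

/-- The image of a realization under a homomorphism. -/
def DynData.map (D : DynData N G row col deg S) (φ : S →ₐ[ℂ] S') : DynData N G row col deg S' where
  fn := φ.comp D.fn
  gen g := φ (D.gen g)
  d := φ D.d
  qc := φ D.qc
  qcInv := φ D.qcInv
  fn_gen f g := by
    simp only [AlgHom.comp_apply, ← map_mul]
    rw [D.fn_gen]
  d_fn f := by
    simp only [AlgHom.comp_apply, ← map_mul]
    rw [D.d_fn]
  d_gen g := by rw [← map_mul, ← map_mul, ← map_sub, D.d_gen, map_smul]
  qc_fn f := by
    simp only [AlgHom.comp_apply, ← map_mul]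
    rw [D.qc_fn]
  qc_gen g := by rw [← map_mul, D.qc_gen, map_mul]
  qc_d := by rw [← map_mul, D.qc_d, map_mul]
  qc_qcInv := by rw [← map_mul, D.qc_qcInv, map_one]
  qcInv_qc := by rw [← map_mul, D.qcInv_qc, map_one]

namespace DynData

variable (D : DynData N G row col deg S)

/-- The image of a generator. -/
def onGen : DynGen N G → S
  | .fn f => D.fn f
  | .gen g => D.gen g
  | .d => D.d
  | .qc => D.qc
  | .qcInv => D.qcInv

theorem qcInv_comm {a : S} (h : D.qc * a = a * D.qc) : D.qcInv * a = a * D.qcInv := by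
  calc D.qcInv * a = D.qcInv * a * (D.qc * D.qcInv) := by rw [D.qc_qcInv, mul_one]
    _ = D.qcInv * (a * D.qc) * D.qcInv := by noncomm_ring
    _ = (D.qcInv * D.qc) * a * D.qcInv := by rw [← h]; noncomm_ring
    _ = a * D.qcInv := by rw [D.qcInv_qc, one_mul]

theorem lift_rel ⦃x y : FreeAlgebra ℂ (DynGen N G)⦄ (h : DynRel N G row col deg x y) :
    FreeAlgebra.lift ℂ D.onGen x = FreeAlgebra.lift ℂ D.onGen y := by
  induction h with
  | fn_const a => simp [onGen]
  | fn_add f g =>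
    rw [map_add, FreeAlgebra.lift_ι_apply, FreeAlgebra.lift_ι_apply, FreeAlgebra.lift_ι_apply]
    exact D.fn.map_add' f g
  | fn_mul f g =>
    rw [map_mul, FreeAlgebra.lift_ι_apply, FreeAlgebra.lift_ι_apply, FreeAlgebra.lift_ι_apply]
    exact D.fn.map_mul' f g
  | fn_gen f g => simpa [onGen] using D.fn_gen f g
  | d_fn f => simpa [onGen] using D.d_fn f
  | d_gen g => simpa [onGen] using D.d_gen g
  | qc_central a =>
    simp only [map_mul, FreeAlgebra.lift_ι_apply]
    cases a with
    | fn f => exact D.qc_fn f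
    | gen g => exact D.qc_gen g
    | d => exact D.qc_d
    | qc => rfl
    | qcInv => exact D.qc_qcInv.trans D.qcInv_qc.symm
  | qc_qcInv => simpa [onGen] using D.qc_qcInv
  | qcInv_qc => simpa [onGen] using D.qcInv_qc

/-- The homomorphism determined by a realization. -/
def lift : DynAlg N G row col deg →ₐ[ℂ] S :=
  RingQuot.liftAlgHom ℂ ⟨FreeAlgebra.lift ℂ D.onGen, D.lift_rel⟩

@[simp] theorem lift_of (a : DynGen N G) : D.lift (DynAlg.of a) = D.onGen a := by
  rw [lift, DynAlg.of_eq_mkAlgHom, RingQuot.liftAlgHom_mkAlgHom_apply, FreeAlgebra.lift_ι_apply]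

theorem commute_qc_fn (f : FF N) : Commute D.qc (D.fn f) := D.qc_fn f
theorem commute_qcInv_fn (f : FF N) : Commute D.qcInv (D.fn f) := D.qcInv_comm (D.qc_fn f)
theorem commute_qc_gen (g : G) : Commute D.qc (D.gen g) := D.qc_gen g

end DynData

end DynAlg

/-! ### Power series of matrices -/

section MatrixSeries

variable {ι K S : Type*} [Fintype ι] [DecidableEq ι] [CommRing K] [Ring S]

/-- The homomorphism that maps a matrix with entries `∑ₖ aₖ wᵏ` to the power series
`∑ₖ (F(aₖ) uᵏ) wᵏ` with matrix coefficients. -/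
def matSeries (F : K →+* S) (u : S) (hu : ∀ a, Commute u (F a)) :
    Matrix ι ι (PowerSeries K) →+* PowerSeries (Matrix ι ι S) where
  toFun M := PowerSeries.mk fun k => Matrix.of fun p p' => F (PowerSeries.coeff k (M p p')) * u ^ k
  map_one' := by
    ext k p p'
    by_cases hp : p = p' <;> by_cases hk : k = 0 <;>
      simp [Matrix.one_apply, PowerSeries.coeff_one, hp, hk]
  map_zero' := by
    ext k p p'
    simp
  map_add' M M' := by
    ext k p p'
    simp [add_mul]
  map_mul' M M' := by
    ext k p p'
    rw [PowerSeries.coeff_mk, Matrix.of_apply, Matrix.mul_apply, map_sum, map_sum,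
      PowerSeries.coeff_mul, Matrix.sum_apply, Finset.sum_mul]
    simp only [PowerSeries.coeff_mul, map_sum, Finset.sum_mul, PowerSeries.coeff_mk,
      Matrix.mul_apply, Matrix.of_apply]
    rw [Finset.sum_comm]
    refine Finset.sum_congr rfl fun ij hij => Finset.sum_congr rfl fun r _ => ?_
    rw [Finset.HasAntidiagonal.mem_antidiagonal] at hij
    rw [map_mul, ← hij, pow_add, mul_assoc, mul_assoc,
      ← mul_assoc (u ^ ij.1), ((hu _).pow_left ij.1).eq, mul_assoc]

variable (F : K →+* S) (u : S) (hu : ∀ a, Commute u (F a))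

@[simp] theorem coeff_matSeries (M : Matrix ι ι (PowerSeries K)) (k : ℕ) (p p' : ι) :
    PowerSeries.coeff k (matSeries F u hu M) p p' = F (PowerSeries.coeff k (M p p')) * u ^ k := by
  simp [matSeries]

theorem coeff_mul_apply (M T : PowerSeries (Matrix ι ι S)) (n : ℕ) (p p' : ι) :
    PowerSeries.coeff n (M * T) p p' = ∑ k ∈ Finset.range (n + 1), ∑ r,
      PowerSeries.coeff k M p r * PowerSeries.coeff (n - k) T r p' := by
  rw [PowerSeries.coeff_mul, Finset.Nat.sum_antidiagonal_eq_sum_range_succ_mk, Matrix.sum_apply]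
  rfl

theorem coeff_mul_apply' (M T : PowerSeries (Matrix ι ι S)) (n : ℕ) (p p' : ι) :
    PowerSeries.coeff n (T * M) p p' = ∑ k ∈ Finset.range (n + 1), ∑ r,
      PowerSeries.coeff (n - k) T p r * PowerSeries.coeff k M r p' := by
  rw [PowerSeries.coeff_mul, ← Finset.Nat.sum_antidiagonal_swap,
    Finset.Nat.sum_antidiagonal_eq_sum_range_succ_mk, Matrix.sum_apply]
  rfl

/-- Power series with central coefficients are central. -/
theorem commute_map_algebraMap {k A : Type*} [CommRing k] [Ring A] [Algebra k A] (g : PowerSeries k)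
    (T : PowerSeries A) : Commute (PowerSeries.map (algebraMap k A) g) T := by
  ext n
  rw [PowerSeries.coeff_mul, PowerSeries.coeff_mul, ← Finset.Nat.sum_antidiagonal_swap]
  refine Finset.sum_congr rfl fun ij _ => ?_
  rw [PowerSeries.coeff_map]
  exact Algebra.commutes _ _

/-- Used to cancel the scalar series of R₀^± from both sides of a relation, so that only the affine
pencil remains. -/
theorem mul_eq_mul_iff_of_central {A : Type*} [Ring A] {c c' : A} (hc : ∀ a, Commute c a)
    (h : c' * c = 1) (M T T' M' : A) : c * M * T = T' * (c * M') ↔ M * T = T' * M' := by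
  constructor
  · intro e
    rw [← mul_assoc, ← (hc T').eq, mul_assoc, mul_assoc] at e
    have := congrArg (c' * ·) e
    simpa only [← mul_assoc, h, one_mul] using this
  · intro e
    rw [mul_assoc, e, ← mul_assoc, (hc T').eq, mul_assoc]

theorem matSeries_smul_map [Algebra ℂ K] [Algebra ℂ S] (F : K →ₐ[ℂ] S)
    (h1 : ∀ a, Commute (1 : S) ((F : K →+* S) a)) (g : PowerSeries ℂ) (M : Matrix ι ι (PowerSeries K)) :
    matSeries (F : K →+* S) 1 h1 (PowerSeries.map (algebraMap ℂ K) g • M) =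
      PowerSeries.map (algebraMap ℂ (Matrix ι ι S)) g * matSeries (F : K →+* S) 1 h1 M := by
  ext n p p'
  rw [coeff_matSeries, Matrix.smul_apply, smul_eq_mul, PowerSeries.coeff_mul, map_sum, one_pow,
    mul_one, PowerSeries.coeff_mul, Matrix.sum_apply]
  refine Finset.sum_congr rfl fun ij _ => ?_
  rw [PowerSeries.coeff_map, PowerSeries.coeff_map, ← Algebra.smul_def, ← Algebra.smul_def,
    Matrix.smul_apply, coeff_matSeries, one_pow, mul_one]
  exact map_smul F _ _

end MatrixSeries

end EllipticGL
end

noncomputable section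

namespace EllipticGL

open PowerSeries (C X)

/-! ### Relations between modes of the same sign -/

section SameSign

variable {N : ℕ} {hbar : ℂ} {S : Type*} [Ring S] [Algebra ℂ S]

theorem commute_one_fn (F : FF N →ₐ[ℂ] S) (a : FF N) : Commute (1 : S) ((F : FF N →+* S) a) :=
  Commute.one_left _

/-- The series of matrices `R₀^±(w)` with coefficients in `S`. -/
def rSeries (hbar : ℂ) (sgn : Bool) (x : Fin N → FF N) (F : FF N →ₐ[ℂ] S) :
    PowerSeries (Matrix (Fin N × Fin N) (Fin N × Fin N) S) :=
  matSeries (F : FF N →+* S) 1 (commute_one_fn F) (trigMat hbar sgn x)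

/-- The matrix of images of the entries. -/
def imMat (F : FF N →ₐ[ℂ] S) (A : Matrix (Fin N × Fin N) (Fin N × Fin N) (FF N)) :
    Matrix (Fin N × Fin N) (Fin N × Fin N) S := A.map F

theorem matSeries_affine {ι K : Type*} [Fintype ι] [DecidableEq ι] [Field K] [Algebra ℂ K]
    (F : K →ₐ[ℂ] S) (h1 : ∀ a, Commute (1 : S) ((F : K →+* S) a)) (A B : Matrix ι ι K) (c : ℂ) :
    matSeries (F : K →+* S) 1 h1 ((C : K →+* _).mapMatrix A - (X : PowerSeries K) •
        (C : K →+* _).mapMatrix (algebraMap ℂ K c • B)) =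
      C (A.map F) - X * C (c • B.map F) := by
  ext n p p'
  rw [coeff_matSeries, one_pow, mul_one]
  rcases n with _ | n
  · simp
  · have h : PowerSeries.coeff (n + 1) (X * C (c • B.map F) : PowerSeries (Matrix ι ι S)) =
        PowerSeries.coeff n (C (c • B.map F)) := PowerSeries.coeff_succ_X_mul _ _
    rcases n with _ | n
    · simp
    · simp [PowerSeries.coeff_X, h]

theorem rSeries_eq_of_eq (F : FF N →ₐ[ℂ] S) {sgn : Bool} {x : Fin N → FF N} {g : PowerSeries ℂ}
    {A B : Matrix (Fin N × Fin N) (Fin N × Fin N) (FF N)} {c : ℂ} {c' : FF N}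
    (hc : algebraMap ℂ (FF N) c = c')
    (h : trigMat hbar sgn x = PowerSeries.map (algebraMap ℂ (FF N)) g •
      ((C : FF N →+* _).mapMatrix A - (X : PowerSeries (FF N)) •
          (C : FF N →+* _).mapMatrix (c' • B))) :
    rSeries hbar sgn x F = PowerSeries.map (algebraMap ℂ _) g *
      (C (imMat F A) - X * C (c • imMat F B)) := by
  subst hc
  rw [rSeries, h, matSeries_smul_map, matSeries_affine]
  rfl

/-- The `n`-th coefficient of the relation `(A - c w B) T(w) = T'(w) (A' - c w B')`, for Laurent
series `T`, `T'`. -/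
def affineDefect {A : Type*} [Ring A] [Algebra ℂ A] (a b a' b' : A) (c : ℂ) (T T' : ℤ → A) (n : ℤ) :
    A :=
  (a * T n - c • (b * T (n - 1))) - (T' n * a' - c • (T' (n - 1) * b'))

/-- This is comparison of coefficients. All integers n are admitted, the defect being 0 for n < 0 by
the support hypotheses, because the reversal n ↦ D + 1 - n does not preserve ℕ. -/
theorem affine_relation_iff {A : Type*} [Ring A] [Algebra ℂ A] (a b a' b' : A) (c : ℂ)
    {T T' : ℤ → A} (hT : ∀ n < 0, T n = 0) (hT' : ∀ n < 0, T' n = 0) :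
    (C a - X * C (c • b)) * (PowerSeries.mk fun n => T n) =
      (PowerSeries.mk fun n => T' n) * (C a' - X * C (c • b')) ↔
    ∀ n : ℤ, affineDefect a b a' b' c T T' n = 0 := by
  have key : ∀ n : ℕ, PowerSeries.coeff n ((C a - X * C (c • b)) * (PowerSeries.mk fun n => T n)) -
      PowerSeries.coeff n ((PowerSeries.mk fun n => T' n) * (C a' - X * C (c • b'))) =
      affineDefect a b a' b' c T T' n := by
    intro n
    rw [sub_mul, mul_sub, mul_assoc X, (PowerSeries.commute_X (C (c • b'))).symm.eq,
      ← mul_assoc (PowerSeries.mk _), map_sub, map_sub, affineDefect]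
    rcases n with _ | n
    · rw [PowerSeries.coeff_zero_X_mul, PowerSeries.coeff_zero_mul_X, hT (_ - 1) (by simp), hT' (_ - 1) (by simp)]
      simp
    · rw [PowerSeries.coeff_succ_X_mul, PowerSeries.coeff_succ_mul_X]
      simp
  constructor
  · intro h n
    rcases lt_or_ge n 0 with hn | hn
    · simp [affineDefect, hT n hn, hT (n - 1) (by omega), hT' n hn, hT' (n - 1) (by omega)]
    · lift n to ℕ using hn
      rw [← key, h, sub_self]
  · intro h
    ext1 n
    rw [← sub_eq_zero, key, h]

/-- Reversal of the order of the coefficients exchanges the relations for `A - c w B` and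
`B - c⁻¹ w A`. -/
theorem affineDefect_reverse {A : Type*} [Ring A] [Algebra ℂ A] (a b a' b' : A) {c : ℂ} (hc : c ≠ 0)
    (T T' : ℤ → A) (D n : ℤ) :
    affineDefect b a b' a' c⁻¹ (fun n => T (D - n)) (fun n => T' (D - n)) (D + 1 - n) =
      - c⁻¹ • affineDefect a b a' b' c T T' n := by
  have h1 : D - (D + 1 - n) = n - 1 := by ring
  have h2 : D - (D + 1 - n - 1) = n := by ring
  simp only [affineDefect, h1, h2, smul_sub, neg_smul, smul_smul, inv_mul_cancel₀ hc, one_smul,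
    neg_mul]
  abel

theorem map_algebraMap_inv_mul {A : Type*} [Ring A] [Algebra ℂ A] {g : PowerSeries ℂ}
    (hg : PowerSeries.constantCoeff g ≠ 0) :
    PowerSeries.map (algebraMap ℂ A) g⁻¹ * PowerSeries.map (algebraMap ℂ A) g = 1 := by
  rw [← map_mul, PowerSeries.inv_mul_cancel _ hg, map_one]

theorem constantCoeff_scalarPlus_ne_zero (hN : 1 ≤ N) (hq : ‖Complex.exp hbar‖ < 1) :
    PowerSeries.constantCoeff (scalarPlus N hbar) ≠ 0 := by
  intro h
  have := congrArg PowerSeries.constantCoeff (scalarPlus_mul_scalarMinus hN hq)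
  rw [map_mul, map_mul, h] at this
  simp at this

theorem constantCoeff_scalarMinus_ne_zero (hN : 1 ≤ N) (hq : ‖Complex.exp hbar‖ < 1) :
    PowerSeries.constantCoeff (scalarMinus N hbar) ≠ 0 := by
  intro h
  have := congrArg PowerSeries.constantCoeff (scalarPlus_mul_scalarMinus hN hq)
  rw [map_mul, map_mul, h] at this
  simp at this

/-- Since `R₀⁺` and `R₀⁻` are expansions of the same rational function up to a scalar factor, the
relations for `R₀⁺` and for `R₀⁻` are equivalent for homogeneous polynomials in `z₁^{±1}`, `z₂^{±1}`.
-/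
theorem rSeries_reverse (hN : 1 ≤ N) (hq : ‖Complex.exp hbar‖ < 1) (F : FF N →ₐ[ℂ] S)
    (x y : Fin N → FF N) {T T' : ℤ → Matrix (Fin N × Fin N) (Fin N × Fin N) S} {D : ℤ}
    (hT : ∀ n, n < 0 ∨ D < n → T n = 0) (hT' : ∀ n, n < 0 ∨ D < n → T' n = 0) :
    rSeries hbar true x F * (PowerSeries.mk fun n => T n) =
        (PowerSeries.mk fun n => T' n) * rSeries hbar true y F ↔
      rSeries hbar false x F * (PowerSeries.mk fun n => T (D - n)) =
        (PowerSeries.mk fun n => T' (D - n)) * rSeries hbar false y F := by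
  have hq2 : algebraMap ℂ (FF N) (Complex.exp hbar ^ 2) = qF N hbar ^ 2 := map_pow _ _ _
  have hq2' : algebraMap ℂ (FF N) (Complex.exp hbar ^ 2)⁻¹ = (qF N hbar ^ 2)⁻¹ := by
    rw [map_inv₀, hq2]
  have hc : Complex.exp hbar ^ 2 ≠ 0 := pow_ne_zero 2 (Complex.exp_ne_zero _)
  rw [rSeries_eq_of_eq F hq2 (trigMat_true_eq x), rSeries_eq_of_eq F hq2 (trigMat_true_eq y),
    rSeries_eq_of_eq F hq2' (trigMat_false_eq x), rSeries_eq_of_eq F hq2' (trigMat_false_eq y),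
    mul_eq_mul_iff_of_central (commute_map_algebraMap _)
      (map_algebraMap_inv_mul (constantCoeff_scalarPlus_ne_zero hN hq)),
    mul_eq_mul_iff_of_central (commute_map_algebraMap _)
      (map_algebraMap_inv_mul (constantCoeff_scalarMinus_ne_zero hN hq)),
    affine_relation_iff _ _ _ _ _ (fun n h => hT n (Or.inl h)) (fun n h => hT' n (Or.inl h)),
    affine_relation_iff (T := fun n => T (D - n)) (T' := fun n => T' (D - n)) _ _ _ _ _
      (fun n h => hT _ (Or.inr (by omega))) (fun n h => hT' _ (Or.inr (by omega)))]
  -- With the scalars cancelled, the defect for R₀⁻ at D + 1 - n is a nonzero multiple of the defect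
  -- for R₀⁺ at n.
  constructor
  · intro h n
    have := affineDefect_reverse (imMat F (matZero (qF N hbar) x)) (imMat F (matInfty (qF N hbar) x))
      (imMat F (matZero (qF N hbar) y)) (imMat F (matInfty (qF N hbar) y)) hc T T' D (D + 1 - n)
    rw [h, smul_zero, sub_sub_cancel] at this
    exact this
  · intro h n
    have := affineDefect_reverse (imMat F (matZero (qF N hbar) x)) (imMat F (matInfty (qF N hbar) x))
      (imMat F (matZero (qF N hbar) y)) (imMat F (matInfty (qF N hbar) y)) hc T T' D n
    rw [h, eq_comm, smul_eq_zero] at this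
    exact this.resolve_left (neg_ne_zero.mpr (inv_ne_zero hc))

end SameSign

/-! ### Mixed relations from unitarity -/

section Mixed

variable {N : ℕ} {hbar : ℂ} {S : Type*} [Ring S]

/-- Exchange of the two tensor factors, as a ring homomorphism. -/
def flipHom (N : ℕ) (S : Type*) [Ring S] : Matrix (Fin N × Fin N) (Fin N × Fin N) S →+*
    Matrix (Fin N × Fin N) (Fin N × Fin N) S where
  toFun := flip
  map_one' := flip_one
  map_mul' := flip_mul
  map_zero' := rfl
  map_add' _ _ := rfl

theorem map_flipHom_matSeries (F : FF N →+* S) (u : S) (hu : ∀ a, Commute u (F a))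
    (M : Matrix (Fin N × Fin N) (Fin N × Fin N) (PowerSeries (FF N))) :
    PowerSeries.map (flipHom N S) (matSeries F u hu M) = matSeries F u hu (flip M) := by
  ext n p p'
  rw [coeff_matSeries, PowerSeries.coeff_map]
  exact coeff_matSeries F u hu M n p.swap p'.swap

/-- By unitarity of the `R`-matrix, the relation between `L⁻(z₁)` and `L⁺(z₂)` implies the one between
`L⁺(z₁)` and `L⁻(z₂)`. -/
theorem mixed_of_mixed (hN : 1 ≤ N) (hq : ‖Complex.exp hbar‖ < 1) (F : FF N →+* S) {u v : S}
    (hu : ∀ a, Commute u (F a)) (hv : ∀ a, Commute v (F a)) {x y : Fin N → FF N}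
    (hx : ∀ i, x i ≠ 0) (hx' : ∀ i j, i ≠ j → x i ≠ x j)
    (hy : ∀ i, y i ≠ 0) (hy' : ∀ i j, i ≠ j → y i ≠ y j)
    {T T' : PowerSeries (Matrix (Fin N × Fin N) (Fin N × Fin N) S)}
    (h : matSeries F u hu (trigMat hbar false x) * T = T' * matSeries F v hv (trigMat hbar false y)) :
    matSeries F u hu (trigMat hbar true x) * PowerSeries.map (flipHom N S) T' =
      PowerSeries.map (flipHom N S) T * matSeries F v hv (trigMat hbar true y) := by
  have h1 := congrArg (PowerSeries.map (flipHom N S)) h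
  rw [map_mul, map_mul, map_flipHom_matSeries, map_flipHom_matSeries] at h1
  have hX := congrArg (matSeries F u hu) (trigMat_unitary hN hq hx hx')
  have hY := congrArg (matSeries F v hv) (mul_eq_one_comm.mp (trigMat_unitary hN hq hy hy'))
  rw [map_mul, map_one] at hX hY
  -- Insert R⁻²¹R⁺ = 1 on the right, apply the flipped hypothesis, and cancel R⁺R⁻²¹ = 1 on the
  -- left.
  calc _ = matSeries F u hu (trigMat hbar true x) * (PowerSeries.map (flipHom N S) T' *
        (matSeries F v hv (flip (trigMat hbar false y)) * matSeries F v hv (trigMat hbar true y))) := by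
        rw [hY, mul_one]
    _ = (matSeries F u hu (trigMat hbar true x) * matSeries F u hu (flip (trigMat hbar false x))) *
        PowerSeries.map (flipHom N S) T * matSeries F v hv (trigMat hbar true y) := by
        rw [← mul_assoc (PowerSeries.map (flipHom N S) T'), ← h1]
        simp only [mul_assoc]
    _ = _ := by rw [hX, one_mul]

end Mixed

end EllipticGL
end

noncomputable section

namespace EllipticGL

open PowerSeries (C X)

/-! ### Passage between elliptic and trigonometric generators -/

/-- Realizations of the generators of the elliptic algebra. -/
abbrev EData (N : ℕ) (S : Type*) [Ring S] [Algebra ℂ S] :=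
  DynData N (EIdx N) (fun g => g.1) (fun g => g.2.1) (fun g => g.2.2) S

/-- Realizations of the generators of the trigonometric algebra. -/
abbrev TData (N : ℕ) (S : Type*) [Ring S] [Algebra ℂ S] :=
  DynData N (TIdx N) (fun g => g.2.1) (fun g => g.2.2.1)
    (fun g => if g.1 then -(g.2.2.2 : ℤ) else (g.2.2.2 : ℤ)) S

section Conjugate

variable {N : ℕ} {G : Type} {row col : G → Fin N} {deg : G → ℤ} {S : Type*} [Ring S] [Algebra ℂ S]
  (D : DynData N G row col deg S)

theorem DynData.fn_comm (f g : FF N) : D.fn f * D.fn g = D.fn g * D.fn f := by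
  rw [← map_mul, mul_comm, map_mul]

/-- The element `f L_g f' u` with `u` a power of `q^{±c/2}`. -/
theorem DynData.conj_fn_gen (f g g' : FF N) (t : G) {u : S} (hu : ∀ f, Commute u (D.fn f)) :
    D.fn f * (D.fn g * D.gen t * D.fn g' * u) =
      D.fn g * D.gen t * D.fn g' * u * D.fn (shift (epsBar (row t)) (epsBar (col t)) f) := by
  calc _ = (D.fn f * D.fn g) * D.gen t * D.fn g' * u := by simp only [mul_assoc]
    _ = D.fn g * (D.fn f * D.gen t) * D.fn g' * u := by
        rw [D.fn_comm]
        simp only [mul_assoc]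
    _ = D.fn g * D.gen t * (D.fn (shift (epsBar (row t)) (epsBar (col t)) f) * D.fn g') * u := by
        rw [D.fn_gen]
        simp only [mul_assoc]
    _ = D.fn g * D.gen t * D.fn g' * (D.fn (shift (epsBar (row t)) (epsBar (col t)) f) * u) := by
        rw [D.fn_comm]
        simp only [mul_assoc]
    _ = _ := by
        rw [← (hu _).eq]
        simp only [mul_assoc]

theorem DynData.d_conj_gen (g g' : FF N) (t : G) {u : S} (hu : Commute D.d u) :
    D.d * (D.fn g * D.gen t * D.fn g' * u) - D.fn g * D.gen t * D.fn g' * u * D.d =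
      (deg t : ℂ) • (D.fn g * D.gen t * D.fn g' * u) := by
  rw [← smul_mul_assoc, ← smul_mul_assoc, ← mul_smul_comm, ← D.d_gen]
  rw [mul_assoc _ u D.d, ← hu.eq, ← mul_assoc _ D.d u, mul_assoc _ (D.fn g') D.d, ← D.d_fn,
    ← mul_assoc _ D.d (D.fn g'), ← mul_assoc D.d, ← mul_assoc D.d, ← mul_assoc D.d, D.d_fn]
  noncomm_ring

theorem DynData.qc_conj_gen (g g' : FF N) (t : G) {u : S} (hu : Commute D.qc u) :
    D.qc * (D.fn g * D.gen t * D.fn g' * u) = D.fn g * D.gen t * D.fn g' * u * D.qc :=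
  ((((D.commute_qc_fn g).mul_right (D.commute_qc_gen t)).mul_right
    (D.commute_qc_fn g')).mul_right hu).eq

theorem DynData.commute_d_qcInv : Commute D.d D.qcInv := (D.qcInv_comm D.qc_d).symm

end Conjugate

section Translate

variable {N : ℕ} {S : Type*} [Ring S] [Algebra ℂ S]

/-- `q^{2(P+h)_{ε̄ᵢ}} L̄_{ij,m} q^{-2P_{ε̄ⱼ}} q^{cm}`. -/
def DynData.minus (D : EData N S) (hbar : ℂ) (i j : Fin N) (m : ℕ) : S :=
  D.fn (xL hbar i) * D.gen (i, j, (m : ℤ)) * D.fn (xR hbar j)⁻¹ * D.qc ^ (2 * m)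

/-- The generators of the trigonometric algebra in terms of those of the elliptic algebra. -/
def DynData.toTrig (D : EData N S) (hbar : ℂ) : TData N S where
  fn := D.fn
  gen g := if g.1 then D.gen (g.2.1, g.2.2.1, -(g.2.2.2 : ℤ)) else D.minus hbar g.2.1 g.2.2.1 g.2.2.2
  d := D.d
  qc := D.qc
  qcInv := D.qcInv
  fn_gen := by
    rintro f ⟨_ | _, i, j, m⟩
    · exact D.conj_fn_gen _ _ _ (i, j, (m : ℤ)) fun f => (D.commute_qc_fn f).pow_left _
    · exact D.fn_gen f (i, j, -(m : ℤ))
  d_fn := D.d_fn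
  d_gen := by
    rintro ⟨_ | _, i, j, m⟩
    · exact D.d_conj_gen _ _ (i, j, (m : ℤ)) ((show Commute D.qc D.d from D.qc_d).symm.pow_right _)
    · exact D.d_gen (i, j, -(m : ℤ))
  qc_fn := D.qc_fn
  qc_gen := by
    rintro ⟨_ | _, i, j, m⟩
    · exact D.qc_conj_gen _ _ (i, j, (m : ℤ)) ((Commute.refl _).pow_right _)
    · exact D.qc_gen (i, j, -(m : ℤ))
  qc_d := D.qc_d
  qc_qcInv := D.qc_qcInv
  qcInv_qc := D.qcInv_qc

/-- The generators of the elliptic algebra in terms of those of the trigonometric algebra. -/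
def DynData.toEll (T : TData N S) (hbar : ℂ) : EData N S where
  fn := T.fn
  -- The inequality is strict: degree 0 is taken from L⁺, and the degree-0 modes of L⁻ are recovered
  -- only through the zero-mode relation.
  gen g := if 0 < g.2.2 then
      T.fn (xL hbar g.1)⁻¹ * T.gen (false, g.1, g.2.1, g.2.2.toNat) * T.fn (xR hbar g.2.1) *
        T.qcInv ^ (2 * g.2.2.toNat)
    else T.gen (true, g.1, g.2.1, (-g.2.2).toNat)
  d := T.d
  qc := T.qc
  qcInv := T.qcInv
  fn_gen := by
    rintro f ⟨i, j, n⟩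
    by_cases h : 0 < n
    · simp only [h, if_true]
      exact T.conj_fn_gen _ _ _ (false, i, j, n.toNat) fun f => (T.commute_qcInv_fn f).pow_left _
    · simp only [h, if_false]
      exact T.fn_gen f (true, i, j, (-n).toNat)
  d_fn := T.d_fn
  d_gen := by
    rintro ⟨i, j, n⟩
    by_cases h : 0 < n
    · simp only [h, if_true]
      rw [T.d_conj_gen _ _ (false, i, j, n.toNat) (T.commute_d_qcInv.pow_right _)]
      simp [Int.toNat_of_nonneg h.le]
    · simp only [h, if_false]
      rw [T.d_gen (true, i, j, (-n).toNat)]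
      simp [Int.toNat_of_nonneg (show 0 ≤ -n by omega)]
  qc_fn := T.qc_fn
  qc_gen := by
    rintro ⟨i, j, n⟩
    by_cases h : 0 < n
    · simp only [h, if_true]
      exact T.qc_conj_gen _ _ (false, i, j, n.toNat)
        ((show Commute T.qc T.qcInv from T.qc_qcInv.trans T.qcInv_qc.symm).pow_right _)
    · simp only [h, if_false]
      exact T.qc_gen (true, i, j, (-n).toNat)
  qc_d := T.qc_d
  qc_qcInv := T.qc_qcInv
  qcInv_qc := T.qcInv_qc

theorem DynData.fn_mul_fn_inv {G : Type} {row col : G → Fin N} {deg : G → ℤ}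
    (D : DynData N G row col deg S) {f : FF N} (hf : f ≠ 0) : D.fn f * D.fn f⁻¹ = 1 := by
  rw [← map_mul, mul_inv_cancel₀ hf, map_one]

theorem DynData.fn_inv_mul_fn {G : Type} {row col : G → Fin N} {deg : G → ℤ}
    (D : DynData N G row col deg S) {f : FF N} (hf : f ≠ 0) : D.fn f⁻¹ * D.fn f = 1 := by
  rw [← map_mul, inv_mul_cancel₀ hf, map_one]

theorem DynData.pow_cancel {G : Type} {row col : G → Fin N} {deg : G → ℤ}
    (D : DynData N G row col deg S) (n : ℕ) : D.qcInv ^ n * D.qc ^ n = 1 := by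
  rw [← (show Commute D.qcInv D.qc from D.qcInv_qc.trans D.qc_qcInv.symm).mul_pow, D.qcInv_qc,
    one_pow]

theorem DynData.pow_cancel' {G : Type} {row col : G → Fin N} {deg : G → ℤ}
    (D : DynData N G row col deg S) (n : ℕ) : D.qc ^ n * D.qcInv ^ n = 1 := by
  rw [← (show Commute D.qc D.qcInv from D.qc_qcInv.trans D.qcInv_qc.symm).mul_pow, D.qc_qcInv,
    one_pow]

/-- The relation between the zero modes of `L₀^±`. -/
theorem DynData.toEll_minus (T : TData N S) (hbar : ℂ)
    (h0 : ∀ i j, T.gen (false, i, j, 0) =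
      T.fn (xL hbar i) * T.gen (true, i, j, 0) * T.fn (xR hbar j)⁻¹) (i j : Fin N) (m : ℕ) :
    (T.toEll hbar).minus hbar i j m = T.gen (false, i, j, m) := by
  rw [DynData.minus]
  simp only [toEll]
  rcases m with _ | m
  · simp [h0]
  · rw [if_pos (by positivity), Int.toNat_natCast]
    have hp : Commute (T.qcInv ^ (2 * (m + 1))) (T.fn (xR hbar j)⁻¹) :=
      (T.commute_qcInv_fn _).pow_left _
    calc _ = (T.fn (xL hbar i) * T.fn (xL hbar i)⁻¹) * T.gen (false, i, j, m + 1) *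
          (T.fn (xR hbar j) * (T.qcInv ^ (2 * (m + 1)) * T.fn (xR hbar j)⁻¹)) *
          T.qc ^ (2 * (m + 1)) := by simp only [mul_assoc]
      _ = T.gen (false, i, j, m + 1) *
          (T.fn (xR hbar j) * T.fn (xR hbar j)⁻¹) *
          (T.qcInv ^ (2 * (m + 1)) * T.qc ^ (2 * (m + 1))) := by
          rw [T.fn_mul_fn_inv (xL_ne_zero i), hp.eq, one_mul]
          simp only [mul_assoc]
      _ = _ := by rw [T.fn_mul_fn_inv (xR_ne_zero j), T.pow_cancel, mul_one, mul_one]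

theorem DynData.toEll_gen_neg (T : TData N S) (hbar : ℂ) (i j : Fin N) (m : ℕ) :
    (T.toEll hbar).gen (i, j, -(m : ℤ)) = T.gen (true, i, j, m) := by
  simp [toEll]

variable (D : EData N S) {hbar : ℂ}

theorem epsPow_symm (i j : Fin N) : epsPow hbar i j = epsPow hbar j i := by
  rw [epsPow_eq, epsPow_eq]
  simp only [eq_comm]

/-- Translation by ε̄ᵢ multiplies the exponential by the constant q^{-2(ε̄ᵢ,ε̄ₖ)}, so it commutes
with a mode up to that constant. -/
theorem DynData.gen_mul_xL (i j k : Fin N) (n : ℤ) :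
    D.gen (i, j, n) * D.fn (xL hbar k) =
      (epsPow hbar i k)⁻¹ • (D.fn (xL hbar k) * D.gen (i, j, n)) := by
  have h := D.fn_gen (xL hbar k) (i, j, n)
  rw [shift_xL, map_mul, AlgHom.commutes, ← Algebra.smul_def, mul_smul_comm] at h
  rw [h, smul_smul, epsPow, inv_mul_cancel₀ (Complex.exp_ne_zero _), one_smul]

theorem shift_xR_inv (a b : Hyper N) (k : Fin N) :
    shift a b (xR hbar k)⁻¹ =
      algebraMap ℂ (FF N) (Complex.exp (-(2 * hbar * (b : Fin N → ℂ) k)))⁻¹ * (xR hbar k)⁻¹ := by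
  have h : shift a b (xR hbar k)⁻¹ * shift a b (xR hbar k) = 1 := by
    rw [← map_mul (shift a b), inv_mul_cancel₀ (xR_ne_zero k), map_one (shift a b)]
  rw [eq_inv_of_mul_eq_one_left h, shift_xR, mul_inv, map_inv₀ (algebraMap ℂ (FF N))]

theorem DynData.xR_inv_mul_gen (i j k : Fin N) (n : ℤ) :
    D.fn (xR hbar k)⁻¹ * D.gen (i, j, n) =
      (epsPow hbar j k)⁻¹ • (D.gen (i, j, n) * D.fn (xR hbar k)⁻¹) := by
  have h := D.fn_gen (xR hbar k)⁻¹ (i, j, n)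
  rw [shift_xR_inv, map_mul, AlgHom.commutes, ← Algebra.smul_def,
    mul_smul_comm] at h
  exact h

theorem DynData.minus_mul_gen (i j k l : Fin N) (m : ℕ) (n : ℤ) :
    D.minus hbar i j m * D.gen (k, l, n) = (epsPow hbar l j)⁻¹ •
      (D.fn (xL hbar i) * (D.gen (i, j, (m : ℤ)) * D.gen (k, l, n)) * D.fn (xR hbar j)⁻¹ *
        D.qc ^ (2 * m)) := by
  rw [DynData.minus, mul_assoc _ (D.qc ^ _), ((D.commute_qc_gen (k, l, n)).pow_left _).eq,
    ← mul_assoc _ _ (D.qc ^ _), mul_assoc _ (D.fn (xR hbar j)⁻¹), D.xR_inv_mul_gen, mul_smul_comm,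
    smul_mul_assoc]
  simp only [mul_assoc]

theorem DynData.gen_mul_minus (i j k l : Fin N) (m : ℕ) (n : ℤ) :
    D.gen (k, l, n) * D.minus hbar i j m = (epsPow hbar k i)⁻¹ •
      (D.fn (xL hbar i) * (D.gen (k, l, n) * D.gen (i, j, (m : ℤ))) * D.fn (xR hbar j)⁻¹ *
        D.qc ^ (2 * m)) := by
  rw [DynData.minus, ← mul_assoc, ← mul_assoc, ← mul_assoc, D.gen_mul_xL]
  simp only [mul_assoc, smul_mul_assoc]

/-- The two inner twist factors commute with each other. Moving each of them outwards past one mode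
costs one constant `epsPow`. -/
theorem DynData.minus_mul_minus (i j k l : Fin N) (m n : ℕ) :
    D.minus hbar i j m * D.minus hbar k l n = ((epsPow hbar i k)⁻¹ * (epsPow hbar l j)⁻¹) •
      (D.fn (xL hbar i * xL hbar k) * (D.gen (i, j, (m : ℤ)) * D.gen (k, l, (n : ℤ))) *
        D.fn ((xR hbar j)⁻¹ * (xR hbar l)⁻¹) * D.qc ^ (2 * (m + n))) := by
  have hm : Commute (D.qc ^ (2 * m)) (D.minus hbar k l n) :=
    (show Commute D.qc _ from
      D.qc_conj_gen _ _ (k, l, (n : ℤ)) ((Commute.refl _).pow_right _)).pow_left _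
  rw [DynData.minus, mul_assoc _ (D.qc ^ _), hm.eq]
  rw [DynData.minus]
  calc _ = D.fn (xL hbar i) * D.gen (i, j, (m : ℤ)) * (D.fn (xR hbar j)⁻¹ * D.fn (xL hbar k)) *
        D.gen (k, l, (n : ℤ)) * D.fn (xR hbar l)⁻¹ * (D.qc ^ (2 * n) * D.qc ^ (2 * m)) := by
        simp only [mul_assoc]
    _ = D.fn (xL hbar i) * (D.gen (i, j, (m : ℤ)) * D.fn (xL hbar k)) *
        (D.fn (xR hbar j)⁻¹ * D.gen (k, l, (n : ℤ))) * D.fn (xR hbar l)⁻¹ *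
        D.qc ^ (2 * (m + n)) := by
        rw [D.fn_comm, ← pow_add, show 2 * n + 2 * m = 2 * (m + n) by ring]
        simp only [mul_assoc]
    _ = _ := by
        rw [D.gen_mul_xL, D.xR_inv_mul_gen, map_mul, map_mul]
        simp only [mul_assoc, smul_mul_assoc, mul_smul_comm, smul_smul]
        rw [mul_comm (epsPow hbar l j)⁻¹]

end Translate

end EllipticGL
end

noncomputable section

namespace EllipticGL

open PowerSeries (C X)

/-! ### The RLL relations at leading order -/

section Relations

variable {N : ℕ} {hbar : ℂ} {S : Type*} [Ring S] [Algebra ℂ S]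

/-- The coefficients of `L₀^±_{ij}`. -/
def DynData.L0 (T : TData N S) (sgn : Bool) (m : ℤ) (i j : Fin N) : S :=
  if 0 ≤ m then T.gen (sgn, i, j, m.toNat) else 0

theorem DynData.L0_of_neg (T : TData N S) (sgn : Bool) {m : ℤ} (h : m < 0) : T.L0 sgn m = 0 := by
  funext i j
  exact if_neg h.not_ge

/-- The contribution of the `k`-th coefficients of `R₀^±(P+h)` and `R₀^±(P)` (the latter multiplied by
`uᵏ` and `vᵏ`) to an `RLL` relation, where `A` and `B` are matrices of modes of `L⁽¹⁾`, `L⁽²⁾`. -/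
def rllT (hbar : ℂ) (F : FF N →ₐ[ℂ] S) (sgn : Bool) (u v : S) (A B : Fin N → Fin N → S)
    (p p'' : Fin N × Fin N) (k : ℕ) : S :=
  (∑ r : Fin N × Fin N, F (PowerSeries.coeff k (trigMat hbar sgn (xL hbar) p r)) * u ^ k *
      (A r.1 p''.1 * B r.2 p''.2)) -
    ∑ r : Fin N × Fin N, B p.2 r.2 * A p.1 r.1 *
      (F (PowerSeries.coeff k (trigMat hbar sgn (xR hbar) r p'')) * v ^ k)

theorem rllT_zero_left (F : FF N →ₐ[ℂ] S) (sgn : Bool) (u v : S) (B : Fin N → Fin N → S)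
    (p p'' : Fin N × Fin N) (k : ℕ) : rllT hbar F sgn u v 0 B p p'' k = 0 := by
  simp [rllT]

theorem rllT_zero_right (F : FF N →ₐ[ℂ] S) (sgn : Bool) (u v : S) (A : Fin N → Fin N → S)
    (p p'' : Fin N × Fin N) (k : ℕ) : rllT hbar F sgn u v A 0 p p'' k = 0 := by
  simp [rllT]

/-- The matrix of `A⁽¹⁾ B⁽²⁾`. -/
def tens (A B : Fin N → Fin N → S) : Matrix (Fin N × Fin N) (Fin N × Fin N) S :=
  Matrix.of fun p p' => A p.1 p'.1 * B p.2 p'.2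

/-- The matrix of `B⁽²⁾ A⁽¹⁾`. -/
def tens' (A B : Fin N → Fin N → S) : Matrix (Fin N × Fin N) (Fin N × Fin N) S :=
  Matrix.of fun p p' => B p.2 p'.2 * A p.1 p'.1

/-- Relations along a family of mode pairs (A n, B n) form a single identity of power series: its
n-th coefficient combines the k-th coefficients of R with the pair of index n - k. -/
theorem matSeries_relation_iff (F : FF N →ₐ[ℂ] S) (sgn : Bool) {u v : S}
    (hu : ∀ a, Commute u ((F : FF N →+* S) a)) (hv : ∀ a, Commute v ((F : FF N →+* S) a))
    (A B : ℕ → Fin N → Fin N → S) :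
    matSeries (F : FF N →+* S) u hu (trigMat hbar sgn (xL hbar)) *
        (PowerSeries.mk fun n => tens (A n) (B n)) =
      (PowerSeries.mk fun n => tens' (A n) (B n)) *
        matSeries (F : FF N →+* S) v hv (trigMat hbar sgn (xR hbar)) ↔
    ∀ n p p'', ∑ k ∈ Finset.range (n + 1), rllT hbar F sgn u v (A (n - k)) (B (n - k)) p p'' k = 0 := by
  have key : ∀ n p p'', PowerSeries.coeff n (matSeries (F : FF N →+* S) u hu
          (trigMat hbar sgn (xL hbar)) * (PowerSeries.mk fun n => tens (A n) (B n))) p p'' -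
      PowerSeries.coeff n ((PowerSeries.mk fun n => tens' (A n) (B n)) *
        matSeries (F : FF N →+* S) v hv (trigMat hbar sgn (xR hbar))) p p'' =
      ∑ k ∈ Finset.range (n + 1), rllT hbar F sgn u v (A (n - k)) (B (n - k)) p p'' k := by
    intro n p p''
    rw [coeff_mul_apply, coeff_mul_apply', ← Finset.sum_sub_distrib]
    refine Finset.sum_congr rfl fun k _ => ?_
    simp only [coeff_matSeries, PowerSeries.coeff_mk, tens, tens', Matrix.of_apply]
    rfl
  constructor
  · intro h n p p''
    rw [← key, h, sub_self]
  · intro h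
    ext n p p''
    rw [← sub_eq_zero, key, h]

/-- The relations of the trigonometric algebra. -/
structure IsTrig (hbar : ℂ) (T : TData N S) : Prop where
  same : ∀ (sgn : Bool) (p p'' : Fin N × Fin N) (a : ℕ) (b : ℤ), ∑ k ∈ Finset.range (a + 1),
    rllT hbar T.fn sgn 1 1 (T.L0 sgn (a - k)) (T.L0 sgn (b + k)) p p'' k = 0
  mixed : ∀ (sgn : Bool) (p p'' : Fin N × Fin N) (a b : ℕ), ∑ k ∈ Finset.range (min a b + 1),
    rllT hbar T.fn sgn (T.qc ^ 2) (T.qcInv ^ 2) (T.L0 sgn (a - k)) (T.L0 (!sgn) (b - k)) p p'' k = 0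
  zeroMode : ∀ i j, T.gen (false, i, j, 0) =
    T.fn (xL hbar i) * T.gen (true, i, j, 0) * T.fn (xR hbar j)⁻¹

/-- The summand of index `k` in the `RLL` relation of the elliptic algebra, at leading order in
`p`. -/
def ellTerm (hbar : ℂ) (D : EData N S) (p p'' : Fin N × Fin N) (a b k : ℤ) : S :=
  (∑ r : Fin N × Fin N, D.fn (rCoeff hbar (xL hbar) p.1 p.2 r.1 r.2 k (-k).toNat) *
      D.gen (r.1, p''.1, k - a) * D.gen (r.2, p''.2, -k - b)) -
    ∑ r : Fin N × Fin N, D.gen (p.2, r.2, -k - b) * D.gen (p.1, r.1, k - a) *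
      (D.fn (rCoeff hbar (xR hbar) r.1 r.2 p''.1 p''.2 k (-k).toNat) * D.qcInv ^ (4 * (-k).toNat))

/-- The median of `0`, `a`, `-b`. -/
def ellLo (a b : ℤ) : ℤ := max (min 0 a) (min (max 0 a) (-b))

/-- The maximum of `0`, `a`, `-b`. -/
def ellHi (a b : ℤ) : ℤ := max (max 0 a) (-b)

/-- The relations of the elliptic algebra, at leading order in `p`. -/
def IsEll (hbar : ℂ) (D : EData N S) : Prop :=
  ∀ (p p'' : Fin N × Fin N) (a b : ℤ),
    ∑ k ∈ Finset.Icc (ellLo a b) (ellHi a b), ellTerm hbar D p p'' a b k = 0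

/-- Trigonometric sums start at k = 0 and include modes that are 0 by convention; the elliptic sums
start at the first index where no such mode occurs. -/
theorem sum_Icc_eq_sum_range {M : Type*} [AddCommMonoid M] (f : ℤ → M) (g : ℕ → M) {lo : ℤ} {n : ℕ}
    (h0 : 0 ≤ lo) (h1 : ∀ k : ℕ, k ≤ n → lo ≤ k → f k = g k)
    (h2 : ∀ k : ℕ, k ≤ n → (k : ℤ) < lo → g k = 0) :
    ∑ k ∈ Finset.Icc lo n, f k = ∑ k ∈ Finset.range (n + 1), g k := by
  rw [← Finset.sum_filter_add_sum_filter_not (Finset.range (n + 1)) (fun k : ℕ => lo ≤ k),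
    Finset.sum_eq_zero (s := Finset.filter (fun k : ℕ => ¬ lo ≤ k) _), add_zero]
  · refine Finset.sum_nbij' Int.toNat Nat.cast ?_ ?_ ?_ ?_ ?_
    · intro k hk
      simp only [Finset.mem_Icc, Finset.mem_filter, Finset.mem_range] at *
      omega
    · intro k hk
      simp only [Finset.mem_Icc, Finset.mem_filter, Finset.mem_range] at *
      omega
    · intro k hk
      simp only [Finset.mem_Icc] at hk
      omega
    · intro k _
      simp
    · intro k hk
      simp only [Finset.mem_Icc] at hk
      lift k to ℕ using h0.trans hk.1
      exact h1 k (by omega) hk.1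
  · intro k hk
    simp only [Finset.mem_filter, Finset.mem_range] at hk
    exact h2 k (by omega) (by omega)

theorem sum_Icc_neg_eq_sum_range {M : Type*} [AddCommMonoid M] (f : ℤ → M) (n : ℕ) :
    ∑ k ∈ Finset.Icc (-(n : ℤ)) 0, f k = ∑ k ∈ Finset.range (n + 1), f (-(k : ℤ)) := by
  refine Finset.sum_nbij' (fun k => (-k).toNat) (fun k => -(k : ℤ)) ?_ ?_ ?_ ?_ ?_
  · intro k hk
    simp only [Finset.mem_Icc, Finset.mem_range] at *
    omega
  · intro k hk
    simp only [Finset.mem_Icc, Finset.mem_range] at *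
    omega
  · intro k hk
    simp only [Finset.mem_Icc] at hk
    omega
  · intro k _
    simp
  · intro k hk
    simp only [Finset.mem_Icc] at hk
    rw [Int.toNat_of_nonneg (by omega), neg_neg]

end Relations

/-! ### Comparison of the relations summand by summand -/

section Terms

variable {N : ℕ} {hbar : ℂ} {S : Type*} [Ring S] [Algebra ℂ S] (D : EData N S)

theorem DynData.toTrig_L0_true (m : ℤ) (hm : 0 ≤ m) (i j : Fin N) :
    (D.toTrig hbar).L0 true m i j = D.gen (i, j, -m) := by
  rw [DynData.L0, if_pos hm]
  simp [toTrig, Int.toNat_of_nonneg hm]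

theorem DynData.toTrig_L0_false (m : ℕ) (i j : Fin N) :
    (D.toTrig hbar).L0 false m i j = D.minus hbar i j m := by
  rw [DynData.L0, if_pos (by positivity)]
  simp [toTrig]

/-- The R-matrix preserves the unordered pair of indices, so symmetric functions of the pair are
constant along a row or column and can be taken out of the sums. -/
theorem coeff_trigMat_eq_zero_or (sgn : Bool) (x : Fin N → FF N) (p r : Fin N × Fin N) (k : ℕ) :
    PowerSeries.coeff k (trigMat hbar sgn x p r) = 0 ∨ r = p ∨ r = p.swap := by
  by_cases h1 : r.1 = p.1 ∧ r.2 = p.2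
  · exact Or.inr (Or.inl (Prod.ext h1.1 h1.2))
  by_cases h2 : r.1 = p.2 ∧ r.2 = p.1
  · exact Or.inr (Or.inr (Prod.ext h2.1 h2.2))
  left
  have : trigMat hbar sgn x p r = 0 := by
    cases sgn
    all_goals
      simp only [trigMat, rTrig]
      rw [rEntry_of_ne _ _ _ _ _ h1 h2, mul_zero]
  rw [this, map_zero]

theorem ellTerm_of_nonneg (hN : 1 ≤ N) (hq : ‖Complex.exp hbar‖ < 1) (p p'' : Fin N × Fin N)
    (a b : ℤ) (k : ℕ) : ellTerm hbar D p p'' a b k =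
      rllT hbar D.fn true 1 1 (fun i j => D.gen (i, j, k - a)) (fun i j => D.gen (i, j, -k - b))
        p p'' k := by
  have hk : (-(k : ℤ)).toNat = 0 := by simp
  simp only [ellTerm, rllT, hk, rCoeff_of_nonneg hN hq xL_ne_zero,
    rCoeff_of_nonneg hN hq xR_ne_zero, one_pow, mul_zero, pow_zero, mul_one, mul_assoc]
  rfl

-- The factors produced by twisting both modes are symmetric in the two summation indices, hence
-- common to all nonzero terms. The twist of L⁻L⁻ therefore does not change the relation.
set_option maxHeartbeats 1000000 in
theorem rllT_minus_minus (p p'' : Fin N × Fin N) (k m n : ℕ) :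
    rllT hbar D.fn true 1 1 (fun i j => D.minus hbar i j m) (fun i j => D.minus hbar i j n) p p'' k =
      (((epsPow hbar p.1 p.2)⁻¹ * (epsPow hbar p''.2 p''.1)⁻¹) • D.fn (xL hbar p.1 * xL hbar p.2)) *
      rllT hbar D.fn true 1 1 (fun i j => D.gen (i, j, (m : ℤ))) (fun i j => D.gen (i, j, (n : ℤ)))
        p p'' k *
      (D.fn ((xR hbar p''.1)⁻¹ * (xR hbar p''.2)⁻¹) * D.qc ^ (2 * (m + n))) := by
  simp only [rllT, mul_sub, sub_mul, Finset.mul_sum, Finset.sum_mul, one_pow, mul_one]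
  congr 1
  · refine Finset.sum_congr rfl fun r _ => ?_
    rcases coeff_trigMat_eq_zero_or (hbar := hbar) true (xL hbar) p r k with h | h
    · rw [h, map_zero]
      simp
    have he : epsPow hbar r.1 r.2 = epsPow hbar p.1 p.2 := by
      rcases h with rfl | rfl
      · rfl
      · exact epsPow_symm _ _
    have hx : xL hbar r.1 * xL hbar r.2 = xL hbar p.1 * xL hbar p.2 := by
      rcases h with rfl | rfl
      · rfl
      · exact mul_comm _ _
    rw [D.minus_mul_minus, he, hx]
    generalize PowerSeries.coeff k (trigMat hbar true (xL hbar) p r) = c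
    simp only [mul_smul_comm, smul_mul_assoc]
    congr 1
    simp only [← mul_assoc]
    rw [D.fn_comm c]
  · refine Finset.sum_congr rfl fun r _ => ?_
    rcases coeff_trigMat_eq_zero_or (hbar := hbar) true (xR hbar) r p'' k with h | h
    · rw [h, map_zero]
      simp
    have he : epsPow hbar r.1 r.2 = epsPow hbar p''.2 p''.1 := by
      rcases h with rfl | rfl
      · exact epsPow_symm _ _
      · rfl
    have hx : (xR hbar r.2)⁻¹ * (xR hbar r.1)⁻¹ = (xR hbar p''.1)⁻¹ * (xR hbar p''.2)⁻¹ := by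
      rcases h with rfl | rfl
      · exact mul_comm _ _
      · rfl
    rw [D.minus_mul_minus, he, hx, epsPow_symm p.2 p.1, mul_comm (xL hbar p.2), add_comm n m]
    generalize PowerSeries.coeff k (trigMat hbar true (xR hbar) r p'') = c
    simp only [smul_mul_assoc]
    congr 1
    simp only [mul_assoc]
    rw [((D.commute_qc_fn c).pow_left _).eq, ← mul_assoc (D.fn c) (D.fn _), D.fn_comm c]
    simp only [mul_assoc]

/-- The constant relating the values of the elliptic `R`-matrix at `z = 0` and of `R₀⁻`. -/
def betaConst (N : ℕ) (hbar : ℂ) : ℂ :=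
  qPow N hbar ^ 2 * (Complex.exp hbar ^ 2 * (Complex.exp (2 * hbar / N))⁻¹)

/-- For N ≥ 1 the exponents even cancel and the constant is 1; only its nonvanishing matters. -/
theorem betaConst_ne_zero : betaConst N hbar ≠ 0 :=
  mul_ne_zero (pow_ne_zero 2 qPow_ne_zero) (mul_ne_zero (pow_ne_zero 2 (Complex.exp_ne_zero _))
    (inv_ne_zero (Complex.exp_ne_zero _)))

/-- The factor "1 or q²" is rewritten through `epsPow`, the constant that arises when a twist factor
passes a mode, so that the two can cancel. -/
theorem rCoeff_neg (hN : 1 ≤ N) (hq : ‖Complex.exp hbar‖ < 1) {x : Fin N → FF N}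
    (hx : ∀ i, x i ≠ 0) (p r : Fin N × Fin N) (k : ℕ) :
    rCoeff hbar x p.1 p.2 r.1 r.2 (-(k : ℤ)) k =
      algebraMap ℂ (FF N) (betaConst N hbar * epsPow hbar p.1 p.2) * (x r.1 / x p.1) *
        PowerSeries.coeff k (trigMat hbar false x p r) := by
  have h : algebraMap ℂ (FF N) (betaConst N hbar * epsPow hbar p.1 p.2) =
      algebraMap ℂ (FF N) (qPow N hbar ^ 2) * (if p.1 = p.2 then 1 else qF N hbar ^ 2) := by
    have hE : Complex.exp (2 * hbar / N) ≠ 0 := Complex.exp_ne_zero _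
    have hq0 : Complex.exp hbar ≠ 0 := Complex.exp_ne_zero _
    have : betaConst N hbar * epsPow hbar p.1 p.2 =
        qPow N hbar ^ 2 * (if p.1 = p.2 then 1 else Complex.exp hbar ^ 2) := by
      rw [betaConst, epsPow_eq]
      split_ifs <;> field_simp
    rw [this, map_mul]
    congr 1
    split_ifs
    · exact map_one _
    · exact map_pow _ _ _
  rw [rCoeff_of_nonpos hN hq hx, h, ← mul_assoc (algebraMap ℂ (FF N) _)]
  rfl

/-- Bookkeeping of q^c: the factor q^{-2ck} from the k-th power of p*, times the common q^{c(m+k)},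
is the twist q^{cm} of the mode times the argument shift q^{-ck} in R₀⁻(P). -/
theorem DynData.qc_pow_mul (m k : ℕ) :
    D.qcInv ^ (4 * k) * D.qc ^ (2 * (m + k)) = D.qc ^ (2 * m) * D.qcInv ^ (2 * k) := by
  have hc : Commute D.qcInv D.qc := D.qcInv_qc.trans D.qc_qcInv.symm
  rw [show 4 * k = 2 * k + 2 * k by ring, show 2 * (m + k) = 2 * k + 2 * m by ring, pow_add, pow_add,
    mul_assoc, ← mul_assoc (D.qcInv ^ (2 * k)) (D.qc ^ (2 * k)), D.pow_cancel, one_mul,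
    (hc.pow_pow _ _).eq]

-- The gauge factor x r.1 / x p.1 in the elliptic coefficient replaces the common factor x p.1 by
-- the twist x r.1 of the mode of L⁻ in that summand. On the right x p''.1 / x r.1 does the same for
-- the inverse factors.
set_option maxHeartbeats 1000000 in
theorem rllT_minus_plus (hN : 1 ≤ N) (hq : ‖Complex.exp hbar‖ < 1) (p p'' : Fin N × Fin N)
    (k m : ℕ) (n : ℤ) :
    rllT hbar D.fn false (D.qc ^ 2) (D.qcInv ^ 2) (fun i j => D.minus hbar i j m)
        (fun i j => D.gen (i, j, -n)) p p'' k =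
      (((betaConst N hbar)⁻¹ * ((epsPow hbar p.1 p.2)⁻¹ * (epsPow hbar p''.2 p''.1)⁻¹)) •
        D.fn (xL hbar p.1)) * ellTerm hbar D p p'' (-((m + k : ℕ) : ℤ)) (n + k) (-k) *
      (D.fn (xR hbar p''.1)⁻¹ * D.qc ^ (2 * (m + k))) := by
  have hk : (- -(k : ℤ)).toNat = k := by simp
  have hm : -(k : ℤ) - -((m + k : ℕ) : ℤ) = m := by push_cast; ring
  have hn : - -(k : ℤ) - (n + k) = -n := by ring
  have hb := betaConst_ne_zero (N := N) (hbar := hbar)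
  simp only [rllT, ellTerm, mul_sub, sub_mul, Finset.mul_sum, Finset.sum_mul, hk, hm, hn,
    rCoeff_neg hN hq xL_ne_zero, rCoeff_neg hN hq xR_ne_zero]
  congr 1
  · refine Finset.sum_congr rfl fun r _ => ?_
    generalize PowerSeries.coeff k (trigMat hbar false (xL hbar) p r) = c
    have hc : D.fn (xL hbar p.1) * D.fn (algebraMap ℂ (FF N) (betaConst N hbar *
        epsPow hbar p.1 p.2) * (xL hbar r.1 / xL hbar p.1) * c) =
        (betaConst N hbar * epsPow hbar p.1 p.2) • (D.fn c * D.fn (xL hbar r.1)) := by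
      rw [← map_mul, ← map_mul, ← map_smul, Algebra.smul_def]
      congr 1
      have := xL_ne_zero (hbar := hbar) p.1
      field_simp
    have hg : ∀ t, Commute (D.qc ^ (2 * k)) (D.gen t) := fun t => (D.commute_qc_gen t).pow_left _
    have hf : ∀ t, Commute (D.qc ^ (2 * k)) (D.fn t) := fun t => (D.commute_qc_fn t).pow_left _
    -- The power q^{ck} from the argument shift is moved to the far right, where it joins the twist
    -- q^{cm}.
    have hall : Commute (D.qc ^ (2 * k)) (D.fn (xL hbar r.1) * (D.gen (r.1, p''.1, (m : ℤ)) *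
        D.gen (r.2, p''.2, -n)) * D.fn (xR hbar p''.1)⁻¹ * D.qc ^ (2 * m)) :=
      (((hf _).mul_right ((hg _).mul_right (hg _))).mul_right (hf _)).mul_right
        ((Commute.refl D.qc).pow_pow _ _)
    rw [D.minus_mul_gen, ← pow_mul, mul_smul_comm, mul_assoc (D.fn c), hall.eq,
      smul_mul_assoc, smul_mul_assoc]
    calc _ = (epsPow hbar p''.2 p''.1)⁻¹ • ((D.fn c * D.fn (xL hbar r.1)) *
          (D.gen (r.1, p''.1, (m : ℤ)) * D.gen (r.2, p''.2, -n) * (D.fn (xR hbar p''.1)⁻¹ *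
            D.qc ^ (2 * (m + k))))) := by
          rw [mul_add 2 m k, pow_add]
          simp only [mul_assoc]
      _ = ((betaConst N hbar)⁻¹ * ((epsPow hbar p.1 p.2)⁻¹ * (epsPow hbar p''.2 p''.1)⁻¹)) •
          (((betaConst N hbar * epsPow hbar p.1 p.2) • (D.fn c * D.fn (xL hbar r.1))) *
          (D.gen (r.1, p''.1, (m : ℤ)) * D.gen (r.2, p''.2, -n) * (D.fn (xR hbar p''.1)⁻¹ *
            D.qc ^ (2 * (m + k))))) := by
          rw [smul_mul_assoc, smul_smul]
          congr 1
          have := epsPow_ne_zero (hbar := hbar) p.1 p.2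
          field_simp
      _ = _ := by
          rw [← hc]
          simp only [mul_assoc]
  · refine Finset.sum_congr rfl fun r _ => ?_
    rcases coeff_trigMat_eq_zero_or (hbar := hbar) false (xR hbar) r p'' k with h | h
    · rw [h, map_zero, mul_zero, map_zero]
      simp
    have he : epsPow hbar r.1 r.2 = epsPow hbar p''.2 p''.1 := by
      rcases h with rfl | rfl
      · exact epsPow_symm _ _
      · rfl
    rw [he]
    generalize PowerSeries.coeff k (trigMat hbar false (xR hbar) r p'') = c
    have hc : D.fn (algebraMap ℂ (FF N) (betaConst N hbar *
        epsPow hbar p''.2 p''.1) * (xR hbar p''.1 / xR hbar r.1) * c) * D.fn (xR hbar p''.1)⁻¹ =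
        (betaConst N hbar * epsPow hbar p''.2 p''.1) • (D.fn (xR hbar r.1)⁻¹ * D.fn c) := by
      rw [← map_mul, ← map_mul, ← map_smul, Algebra.smul_def]
      congr 1
      have := xR_ne_zero (hbar := hbar) p''.1
      field_simp
    rw [D.gen_mul_minus, ← pow_mul, smul_mul_assoc, smul_mul_assoc, smul_mul_assoc,
      epsPow_symm p.2 p.1]
    calc _ = (epsPow hbar p.1 p.2)⁻¹ • (D.fn (xL hbar p.1) * (D.gen (p.2, r.2, -n) *
          D.gen (p.1, r.1, (m : ℤ))) * ((D.fn (xR hbar r.1)⁻¹ * D.fn c) *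
            (D.qc ^ (2 * m) * D.qcInv ^ (2 * k)))) := by
          congr 1
          have hf : Commute (D.qc ^ (2 * m)) (D.fn c) := (D.commute_qc_fn c).pow_left _
          rw [mul_assoc _ (D.qc ^ (2 * m)), ← mul_assoc (D.qc ^ (2 * m)), hf.eq]
          simp only [mul_assoc]
      _ = ((betaConst N hbar)⁻¹ * ((epsPow hbar p.1 p.2)⁻¹ * (epsPow hbar p''.2 p''.1)⁻¹)) •
          (D.fn (xL hbar p.1) * (D.gen (p.2, r.2, -n) * D.gen (p.1, r.1, (m : ℤ))) *
          (((betaConst N hbar * epsPow hbar p''.2 p''.1) • (D.fn (xR hbar r.1)⁻¹ * D.fn c)) *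
            (D.qcInv ^ (4 * k) * D.qc ^ (2 * (m + k))))) := by
          rw [D.qc_pow_mul, smul_mul_assoc, mul_smul_comm, smul_smul]
          congr 1
          have := epsPow_ne_zero (hbar := hbar) p''.2 p''.1
          field_simp
      _ = _ := by
          have hf : Commute (D.qcInv ^ (4 * k)) (D.fn (xR hbar p''.1)⁻¹) :=
            (D.commute_qcInv_fn _).pow_left _
          rw [← hc]
          simp only [mul_assoc]
          rw [← mul_assoc (D.qcInv ^ (4 * k)), hf.eq]
          simp only [mul_assoc]

end Terms

end EllipticGL
end

noncomputable section

namespace EllipticGL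

open PowerSeries (C X)

/-! ### Equivalence of the elliptic and trigonometric relations -/

section Equivalence

variable {N : ℕ} {hbar : ℂ} {S : Type*} [Ring S] [Algebra ℂ S] (D : EData N S)

/-- The outer factors are units: images of nonzero functions, a nonzero constant, and a power of
q^{c/2}. -/
theorem DynData.conj_eq_zero_iff (f g : FF N) (hf : f ≠ 0) (hg : g ≠ 0) {c : ℂ} (hc : c ≠ 0) (n : ℕ)
    (y : S) : (c • D.fn f) * y * (D.fn g * D.qc ^ n) = 0 ↔ y = 0 := by
  refine ⟨fun h => ?_, fun h => by rw [h, mul_zero, zero_mul]⟩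
  have h1 : c⁻¹ • (D.fn f⁻¹ * ((c • D.fn f) * y * (D.fn g * D.qc ^ n)) *
      (D.qcInv ^ n * D.fn g⁻¹)) = 0 := by
    rw [h, mul_zero, zero_mul, smul_zero]
  have h2 : c⁻¹ • (D.fn f⁻¹ * ((c • D.fn f) * y * (D.fn g * D.qc ^ n)) *
      (D.qcInv ^ n * D.fn g⁻¹)) = (D.fn f⁻¹ * D.fn f) * y * (D.fn g * (D.qc ^ n * D.qcInv ^ n) *
        D.fn g⁻¹) := by
    simp only [smul_mul_assoc, mul_smul_comm, smul_smul, inv_mul_cancel₀ hc, one_smul, mul_assoc]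
  rw [h2, D.fn_inv_mul_fn hf, D.pow_cancel', mul_one, D.fn_mul_fn_inv hg, one_mul, mul_one] at h1
  exact h1

/-- The relations in which only modes of `L⁺` occur. -/
theorem sum_ellTerm_plus (hN : 1 ≤ N) (hq : ‖Complex.exp hbar‖ < 1) (p p'' : Fin N × Fin N) (a : ℕ)
    (b : ℤ) (hab : 0 ≤ a + b) :
    ∑ k ∈ Finset.Icc (ellLo a b) (ellHi a b), ellTerm hbar D p p'' a b k =
      ∑ k ∈ Finset.range (a + 1), rllT hbar D.fn true 1 1 ((D.toTrig hbar).L0 true (a - k))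
        ((D.toTrig hbar).L0 true (b + k)) p p'' k := by
  have h1 : ellHi a b = a := by simp only [ellHi]; omega
  have h2 : ellLo a b = max 0 (-b) := by simp only [ellLo]; omega
  rw [h1, h2]
  refine sum_Icc_eq_sum_range _ _ (le_max_left _ _) ?_ ?_
  · intro k hk hk'
    rw [max_le_iff] at hk'
    rw [ellTerm_of_nonneg D hN hq]
    congr 1
    · funext i j
      rw [D.toTrig_L0_true _ (by omega), neg_sub]
    · funext i j
      rw [D.toTrig_L0_true _ (by omega), neg_add']
      congr 3
      ring
  · intro k hk hk'
    rw [DynData.L0_of_neg _ _ (m := b + k) (by omega), rllT_zero_right]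

/-- The relations in which only modes of `L⁻` occur. -/
theorem sum_ellTerm_minus (hN : 1 ≤ N) (hq : ‖Complex.exp hbar‖ < 1) (p p'' : Fin N × Fin N) (a : ℤ)
    (n : ℕ) (hab : a - n ≤ 0) :
    ∑ k ∈ Finset.Icc (ellLo a (-n)) (ellHi a (-n)), ellTerm hbar D p p'' a (-n) k = 0 ↔
      ∑ k ∈ Finset.range (n + 1), rllT hbar D.fn true 1 1 ((D.toTrig hbar).L0 false (k - a))
        ((D.toTrig hbar).L0 false (n - k)) p p'' k = 0 := by
  have h1 : ellHi a (-n) = n := by simp only [ellHi]; omega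
  have h2 : ellLo a (-n) = max 0 a := by simp only [ellLo]; omega
  rw [h1, h2, ← D.conj_eq_zero_iff (xL hbar p.1 * xL hbar p.2)
    ((xR hbar p''.1)⁻¹ * (xR hbar p''.2)⁻¹) (mul_ne_zero (xL_ne_zero _) (xL_ne_zero _))
    (mul_ne_zero (inv_ne_zero (xR_ne_zero _)) (inv_ne_zero (xR_ne_zero _)))
    (c := (epsPow hbar p.1 p.2)⁻¹ * (epsPow hbar p''.2 p''.1)⁻¹)
    (mul_ne_zero (inv_ne_zero (epsPow_ne_zero _ _)) (inv_ne_zero (epsPow_ne_zero _ _)))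
    (2 * (n - a).toNat), Finset.mul_sum, Finset.sum_mul]
  refine Eq.congr_left (sum_Icc_eq_sum_range _ _ (le_max_left _ _) ?_ ?_)
  · intro k hk hk'
    rw [max_le_iff] at hk'
    obtain ⟨m, hm⟩ := Int.eq_ofNat_of_zero_le (show 0 ≤ (k : ℤ) - a by omega)
    obtain ⟨l, hl⟩ := Int.eq_ofNat_of_zero_le (show 0 ≤ (n : ℤ) - k by omega)
    have e1 : -(k : ℤ) - -(n : ℤ) = l := by omega
    have e2 : (n - a).toNat = m + l := by omega
    have e3 : ∀ m : ℕ, (D.toTrig hbar).L0 false m = fun i j => D.minus hbar i j m := fun m =>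
      funext fun i => funext fun j => D.toTrig_L0_false m i j
    rw [ellTerm_of_nonneg D hN hq, e1, hm, hl, e2, e3, e3, rllT_minus_minus]
  · intro k hk hk'
    rw [DynData.L0_of_neg _ _ (m := k - a) (by omega), rllT_zero_left]

/-- The relations in which modes of `L⁻` and `L⁺` occur. -/
theorem sum_ellTerm_mixed (hN : 1 ≤ N) (hq : ‖Complex.exp hbar‖ < 1) (p p'' : Fin N × Fin N)
    (a b : ℕ) :
    ∑ k ∈ Finset.Icc (ellLo (-a) b) (ellHi (-a) b), ellTerm hbar D p p'' (-a) b k = 0 ↔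
      ∑ k ∈ Finset.range (min a b + 1), rllT hbar D.fn false (D.qc ^ 2) (D.qcInv ^ 2)
        ((D.toTrig hbar).L0 false (a - k)) ((D.toTrig hbar).L0 true (b - k)) p p'' k = 0 := by
  have h1 : ellHi (-a) b = 0 := by simp only [ellHi]; omega
  have h2 : ellLo (-a) b = -((min a b : ℕ) : ℤ) := by simp only [ellLo]; omega
  rw [h1, h2, sum_Icc_neg_eq_sum_range, ← D.conj_eq_zero_iff (xL hbar p.1) (xR hbar p''.1)⁻¹
    (xL_ne_zero _) (inv_ne_zero (xR_ne_zero _))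
    (c := (betaConst N hbar)⁻¹ * ((epsPow hbar p.1 p.2)⁻¹ * (epsPow hbar p''.2 p''.1)⁻¹))
    (mul_ne_zero (inv_ne_zero betaConst_ne_zero)
      (mul_ne_zero (inv_ne_zero (epsPow_ne_zero _ _)) (inv_ne_zero (epsPow_ne_zero _ _))))
    (2 * a), Finset.mul_sum, Finset.sum_mul]
  refine Eq.congr_left (Finset.sum_congr rfl fun k hk => ?_)
  rw [Finset.mem_range] at hk
  obtain ⟨m, rfl⟩ := Nat.exists_eq_add_of_le' (show k ≤ a by omega)
  obtain ⟨n, rfl⟩ := Nat.exists_eq_add_of_le' (show k ≤ b by omega)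
  have e1 : ((m + k : ℕ) : ℤ) - k = m := by omega
  have e2 : ((n + k : ℕ) : ℤ) - k = n := by omega
  have e3 : (D.toTrig hbar).L0 false (m : ℤ) = fun i j => D.minus hbar i j m :=
    funext fun i => funext fun j => D.toTrig_L0_false m i j
  have e4 : (D.toTrig hbar).L0 true (n : ℤ) = fun i j => D.gen (i, j, -(n : ℤ)) :=
    funext fun i => funext fun j => D.toTrig_L0_true _ (by positivity) i j
  rw [e1, e2, e3, e4, rllT_minus_plus D hN hq, Nat.cast_add n k]

/-- The relations of `R₀⁺` and of `R₀⁻` for the modes of `L⁻` are equivalent. -/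
theorem minus_relations_iff (hN : 1 ≤ N) (hq : ‖Complex.exp hbar‖ < 1) (T : TData N S) (d : ℤ) :
    (∀ (n : ℕ) (p p'' : Fin N × Fin N), ∑ k ∈ Finset.range (n + 1),
      rllT hbar T.fn true 1 1 (T.L0 false (d - n + k)) (T.L0 false (n - k)) p p'' k = 0) ↔
    ∀ (n : ℕ) (p p'' : Fin N × Fin N), ∑ k ∈ Finset.range (n + 1),
      rllT hbar T.fn false 1 1 (T.L0 false (n - k)) (T.L0 false (d - n + k)) p p'' k = 0 := by
  -- With the total degree d fixed, only the finitely many pairs of degrees (d - n, n) with 0 ≤ n ≤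
  -- d survive; this finiteness is what makes reversal possible.
  have hz : ∀ n : ℤ, n < 0 ∨ d < n → tens (T.L0 false (d - n)) (T.L0 false n) = 0 := by
    intro n hn
    ext p p'
    rcases hn with hn | hn
    · simp [tens, T.L0_of_neg false hn]
    · simp [tens, T.L0_of_neg false (show d - n < 0 by omega)]
  have hz' : ∀ n : ℤ, n < 0 ∨ d < n → tens' (T.L0 false (d - n)) (T.L0 false n) = 0 := by
    intro n hn
    ext p p'
    rcases hn with hn | hn
    · simp [tens', T.L0_of_neg false hn]
    · simp [tens', T.L0_of_neg false (show d - n < 0 by omega)]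
  have h := rSeries_reverse hN hq T.fn (xL hbar) (xR hbar) hz hz'
  simp only [sub_sub_cancel] at h
  rw [rSeries, rSeries, rSeries, rSeries,
    matSeries_relation_iff T.fn true _ _ (fun n : ℕ => T.L0 false (d - n)) (fun n : ℕ => T.L0 false n),
    matSeries_relation_iff T.fn false _ _ (fun n : ℕ => T.L0 false n)
      (fun n : ℕ => T.L0 false (d - n))] at h
  have e : ∀ n k : ℕ, k ∈ Finset.range (n + 1) → d - ((n - k : ℕ) : ℤ) = d - n + k ∧
      ((n - k : ℕ) : ℤ) = n - k := by
    intro n k hk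
    rw [Finset.mem_range] at hk
    omega
  refine Iff.trans ?_ (h.trans ?_)
  · refine forall_congr' fun n => forall_congr' fun p => forall_congr' fun p'' =>
      Eq.congr_left (Finset.sum_congr rfl fun k hk => ?_)
    rw [(e n k hk).1, (e n k hk).2]
  · refine forall_congr' fun n => forall_congr' fun p => forall_congr' fun p'' =>
      Eq.congr_left (Finset.sum_congr rfl fun k hk => ?_)
    rw [(e n k hk).1, (e n k hk).2]

/-- The relations between `L^±(z₁)` and `L^∓(z₂)` as relations between power series. -/
theorem mixed_relations_iff (T : TData N S) (sgn : Bool)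
    (hu : ∀ a, Commute (T.qc ^ 2) ((T.fn : FF N →+* S) a))
    (hv : ∀ a, Commute (T.qcInv ^ 2) ((T.fn : FF N →+* S) a)) :
    (∀ (p p'' : Fin N × Fin N) (a b : ℕ), ∑ k ∈ Finset.range (min a b + 1), rllT hbar T.fn sgn
      (T.qc ^ 2) (T.qcInv ^ 2) (T.L0 sgn (a - k)) (T.L0 (!sgn) (b - k)) p p'' k = 0) ↔
    ∀ a b : ℕ, a = 0 ∨ b = 0 →
      matSeries (T.fn : FF N →+* S) (T.qc ^ 2) hu (trigMat hbar sgn (xL hbar)) *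
        (PowerSeries.mk fun n => tens (T.L0 sgn (n + a)) (T.L0 (!sgn) (n + b))) =
      (PowerSeries.mk fun n => tens' (T.L0 sgn (n + a)) (T.L0 (!sgn) (n + b))) *
        matSeries (T.fn : FF N →+* S) (T.qcInv ^ 2) hv (trigMat hbar sgn (xR hbar)) := by
  constructor
  · intro h a b hab
    rw [matSeries_relation_iff T.fn sgn _ _ (fun n : ℕ => T.L0 sgn (n + a))
      (fun n : ℕ => T.L0 (!sgn) (n + b))]
    intro n p p''
    have := h p p'' (n + a) (n + b)
    rw [show min (n + a) (n + b) = n by omega] at this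
    rw [← this]
    refine Finset.sum_congr rfl fun k hk => ?_
    rw [Finset.mem_range] at hk
    congr 2 <;> omega
  · intro h p p'' a b
    -- One of the two truncated differences is 0, and (a, b) is reached from this pair after min a b
    -- common steps.
    have h1 := h (a - min a b) (b - min a b) (by omega)
    rw [matSeries_relation_iff T.fn sgn _ _ (fun n : ℕ => T.L0 sgn (n + (a - min a b : ℕ)))
      (fun n : ℕ => T.L0 (!sgn) (n + (b - min a b : ℕ)))] at h1
    rw [← h1 (min a b) p p'']
    refine Finset.sum_congr rfl fun k hk => ?_
    rw [Finset.mem_range] at hk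
    congr 2 <;> omega

theorem map_flipHom_tens {R : Type*} [Ring R] (A B : ℕ → Fin N → Fin N → R) :
    PowerSeries.map (flipHom N R) (PowerSeries.mk fun n => tens (A n) (B n)) =
      PowerSeries.mk fun n => tens' (B n) (A n) := by
  ext n p p'
  simp only [PowerSeries.coeff_map, PowerSeries.coeff_mk]
  rfl

theorem map_flipHom_tens' {R : Type*} [Ring R] (A B : ℕ → Fin N → Fin N → R) :
    PowerSeries.map (flipHom N R) (PowerSeries.mk fun n => tens' (A n) (B n)) =
      PowerSeries.mk fun n => tens (B n) (A n) := by
  ext n p p'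
  simp only [PowerSeries.coeff_map, PowerSeries.coeff_mk]
  rfl

theorem mixed_true_of_mixed_false (hN : 1 ≤ N) (hq : ‖Complex.exp hbar‖ < 1) (T : TData N S)
    (h : ∀ (p p'' : Fin N × Fin N) (a b : ℕ), ∑ k ∈ Finset.range (min a b + 1), rllT hbar T.fn false
      (T.qc ^ 2) (T.qcInv ^ 2) (T.L0 false (a - k)) (T.L0 true (b - k)) p p'' k = 0)
    (p p'' : Fin N × Fin N) (a b : ℕ) :
    ∑ k ∈ Finset.range (min a b + 1), rllT hbar T.fn true
      (T.qc ^ 2) (T.qcInv ^ 2) (T.L0 true (a - k)) (T.L0 false (b - k)) p p'' k = 0 := by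
  have hu : ∀ a, Commute (T.qc ^ 2) ((T.fn : FF N →+* S) a) := fun a =>
    (T.commute_qc_fn a).pow_left _
  have hv : ∀ a, Commute (T.qcInv ^ 2) ((T.fn : FF N →+* S) a) := fun a =>
    (T.commute_qcInv_fn a).pow_left _
  revert p p'' a b
  refine (mixed_relations_iff T true hu hv).mpr fun a b hab => ?_
  have h1 := mixed_of_mixed hN hq (T.fn : FF N →+* S) hu hv xL_ne_zero
    (fun i j => xL_ne (hbar_ne_zero hq)) xR_ne_zero (fun i j => xR_ne (hbar_ne_zero hq))
    ((mixed_relations_iff T false hu hv).mp h b a hab.symm)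
  rw [map_flipHom_tens (fun n : ℕ => T.L0 false (n + b)) (fun n : ℕ => T.L0 (!false) (n + a)),
    map_flipHom_tens' (fun n : ℕ => T.L0 false (n + b)) (fun n : ℕ => T.L0 (!false) (n + a))] at h1
  exact h1

/-- At leading order in `p`, the relations of the elliptic algebra are those of the trigonometric
algebra. -/
theorem isEll_iff_isTrig (hN : 1 ≤ N) (hq : ‖Complex.exp hbar‖ < 1) :
    IsEll hbar D ↔ IsTrig hbar (D.toTrig hbar) := by
  constructor
  · intro h
    have hminus : ∀ (p p'' : Fin N × Fin N) (a b : ℕ), ∑ k ∈ Finset.range (min a b + 1),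
        rllT hbar D.fn false (D.qc ^ 2) (D.qcInv ^ 2)
          ((D.toTrig hbar).L0 false (a - k)) ((D.toTrig hbar).L0 true (b - k)) p p'' k = 0 :=
      fun p p'' a b => (sum_ellTerm_mixed D hN hq p p'' a b).mp (h p p'' _ _)
    refine ⟨?_, ?_, ?_⟩
    · rintro (_ | _) p p'' a b
      -- The elliptic side supplies the R₀⁺ relations for L⁻L⁻ of total degree a + b; reversal turns
      -- them into the R₀⁻ relations.
      · have h1 := (minus_relations_iff hN hq (D.toTrig hbar) (a + b)).mp ?_ a p p''
        · simpa only [add_sub_cancel_left] using h1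
        · intro n p p''
          rcases lt_or_ge ((a : ℤ) + b) 0 with hd | hd
          · refine Finset.sum_eq_zero fun k hk => ?_
            rw [Finset.mem_range] at hk
            rw [DynData.L0_of_neg _ _ (m := (a : ℤ) + b - n + k) (by omega), rllT_zero_left]
          -- In the coefficient of z₁^{n-(a+b)} z₂^{-n} the degrees of the two modes add up to a +
          -- b.
          · have h2 := (sum_ellTerm_minus D hN hq p p'' (n - (a + b)) n (by omega)).mp (h p p'' _ _)
            rw [← h2]
            refine Finset.sum_congr rfl fun k _ => ?_
            rw [show (a : ℤ) + b - n + k = k - (n - (a + b)) by ring]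
            rfl
      · rcases lt_or_ge ((a : ℤ) + b) 0 with hd | hd
        · refine Finset.sum_eq_zero fun k hk => ?_
          rw [Finset.mem_range] at hk
          rw [DynData.L0_of_neg _ _ (m := b + k) (by omega), rllT_zero_right]
        · exact (sum_ellTerm_plus D hN hq p p'' a b hd).symm.trans (h p p'' _ _)
    · rintro (_ | _) p p'' a b
      · exact hminus p p'' a b
      · exact mixed_true_of_mixed_false hN hq (D.toTrig hbar) hminus p p'' a b
    -- In degree 0 the twisted mode of L⁻ is by construction the twist of the mode of L⁺.
    · intro i j
      simp [DynData.toTrig, DynData.minus]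
  · intro h p p'' a b
    -- The cases are sorted by the largest of 0, a, -b: a gives L⁺L⁺, -b gives L⁻L⁻ (it arises
    -- twice, for either sign of a), and 0 gives the mixed relation.
    rcases le_total 0 a with ha | ha
    · rcases le_total 0 (a + b) with hab | hab
      · lift a to ℕ using ha
        rw [sum_ellTerm_plus D hN hq p p'' a b hab]
        exact h.same true p p'' a b
      · obtain ⟨n, hn⟩ := Int.eq_ofNat_of_zero_le (show 0 ≤ -b by omega)
        obtain rfl : b = -(n : ℤ) := by omega
        rw [sum_ellTerm_minus D hN hq p p'' a n (by omega)]
        have h1 := (minus_relations_iff hN hq (D.toTrig hbar) (n - a)).mpr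
          (fun m p p'' => by simpa only [add_sub_cancel] using h.same false p p'' m (n - a - m)) n p p''
        rw [← h1]
        refine Finset.sum_congr rfl fun k _ => ?_
        rw [show (n : ℤ) - a - n + k = k - a by ring]
        rfl
    · rcases le_total 0 b with hb | hb
      · obtain ⟨m, hm⟩ := Int.eq_ofNat_of_zero_le (show 0 ≤ -a by omega)
        obtain rfl : a = -(m : ℤ) := by omega
        lift b to ℕ using hb
        exact (sum_ellTerm_mixed D hN hq p p'' m b).mpr (h.mixed false p p'' m b)
      · obtain ⟨n, hn⟩ := Int.eq_ofNat_of_zero_le (show 0 ≤ -b by omega)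
        obtain rfl : b = -(n : ℤ) := by omega
        rw [sum_ellTerm_minus D hN hq p p'' a n (by omega)]
        have h1 := (minus_relations_iff hN hq (D.toTrig hbar) (n - a)).mpr
          (fun m p p'' => by simpa only [add_sub_cancel] using h.same false p p'' m (n - a - m)) n p p''
        rw [← h1]
        refine Finset.sum_congr rfl fun k _ => ?_
        rw [show (n : ℤ) - a - n + k = k - a by ring]
        rfl

end Equivalence

end EllipticGL
end

noncomputable section

namespace EllipticGL

open PowerSeries (C X)

/-! ### The leading power of p in the RLL relations -/

section Leading

variable {N : ℕ} {hbar : ℂ} {S : Type*} [Ring S] [Algebra ℂ S]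

/-- As a function of k the left side has slopes -2, -1, 0, 1, changing at 0, a and -b in increasing
order. It is therefore minimal precisely between the second and the third of these points. -/
theorem pExp_summand_eq_iff (a b k : ℤ) :
    (max (-k) 0).toNat + (max (k - a) 0).toNat + (max (-k - b) 0).toNat =
      (max (max 0 (-a)) (-a - b)).toNat ↔ ellLo a b ≤ k ∧ k ≤ ellHi a b := by
  simp only [ellLo, ellHi]
  omega

theorem le_pExp_summand (a b k : ℤ) : (max (max 0 (-a)) (-a - b)).toNat ≤
    (max (-k) 0).toNat + (max (k - a) 0).toNat + (max (-k - b) 0).toNat := by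
  omega

theorem ellLo_le_ellHi (a b : ℤ) : ellLo a b ≤ ellHi a b := by
  simp only [ellLo, ellHi]
  omega

theorem pExp_eq (a b : ℤ) : pExp a b = (max (max 0 (-a)) (-a - b)).toNat := by
  refine le_antisymm ?_ (le_ciInf fun k => le_pExp_summand a b k)
  exact (ciInf_le (OrderBot.bddBelow _) (ellHi a b)).trans
    ((pExp_summand_eq_iff a b _).mpr ⟨ellLo_le_ellHi a b, le_rfl⟩).le

theorem DynAlg.of_fn_zero {G : Type} {row col : G → Fin N} {deg : G → ℤ} :
    (DynAlg.of (.fn 0) : DynAlg N G row col deg) = 0 :=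
  map_zero (DynData.univ N G row col deg).fn

theorem coeff_mul_mode_mul_mode {A : Type*} [Ring A] (F : PowerSeries A) (s t m : ℕ) (u v : A) :
    PowerSeries.coeff m (F * (X ^ s * C u) * (X ^ t * C v)) =
      if s + t ≤ m then PowerSeries.coeff (m - (s + t)) F * u * v else 0 := by
  have h : F * (X ^ s * C u) * (X ^ t * C v) = X ^ (s + t) * (F * C u * C v) := by
    calc _ = F * X ^ s * (C u * X ^ t) * C v := by simp only [mul_assoc]
      _ = X ^ s * (F * X ^ t) * (C u * C v) := by
        rw [(PowerSeries.commute_X_pow F s).eq, (PowerSeries.commute_X_pow (C u) t).eq]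
        simp only [mul_assoc]
      _ = _ := by
        rw [(PowerSeries.commute_X_pow F t).eq, pow_add]
        simp only [mul_assoc]
  rw [h, PowerSeries.coeff_X_pow_mul']
  split_ifs
  · rw [PowerSeries.coeff_mul_C, PowerSeries.coeff_mul_C]
  · rfl

theorem coeff_mode_mul_mode_mul {A : Type*} [Ring A] (F : PowerSeries A) (s t m : ℕ) (u v : A) :
    PowerSeries.coeff m ((X ^ t * C v) * (X ^ s * C u) * F) =
      if s + t ≤ m then v * u * PowerSeries.coeff (m - (s + t)) F else 0 := by
  have h : (X ^ t * C v) * (X ^ s * C u) * F = X ^ (s + t) * (C (v * u) * F) := by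
    calc _ = X ^ t * (C v * X ^ s) * C u * F := by simp only [mul_assoc]
      _ = _ := by
        rw [(PowerSeries.commute_X_pow (C v) s).eq, add_comm s t, pow_add, map_mul]
        simp only [mul_assoc]
  rw [h, PowerSeries.coeff_X_pow_mul']
  split_ifs
  · rw [PowerSeries.coeff_C_mul]
  · rfl

theorem coeff_rllTerm (i j i'' j'' : Fin N) (a b k : ℤ) (m : ℕ) :
    PowerSeries.coeff m (rllTerm hbar i j i'' j'' a b k) =
      if (max (k - a) 0).toNat + (max (-k - b) 0).toNat ≤ m then
        (∑ i' : Fin N, ∑ j' : Fin N, DynAlg.of (.fn (rCoeff hbar (xL hbar) i j i' j' k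
            (m - ((max (k - a) 0).toNat + (max (-k - b) 0).toNat)))) *
          DynAlg.of (.gen (i', i'', k - a)) * DynAlg.of (.gen (j', j'', -k - b))) -
        ∑ i' : Fin N, ∑ j' : Fin N, DynAlg.of (.gen (j, j', -k - b)) *
          DynAlg.of (.gen (i, i', k - a)) *
            (DynAlg.of (.fn (rCoeff hbar (xR hbar) i' j' i'' j'' k
              (m - ((max (k - a) 0).toNat + (max (-k - b) 0).toNat)))) *
              DynAlg.of .qcInv ^ (4 * (m - ((max (k - a) 0).toNat + (max (-k - b) 0).toNat))))
      else 0 := by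
  simp only [rllTerm, LMode, map_sub, map_sum, coeff_mul_mode_mul_mode, coeff_mode_mul_mode_mul,
    RMode, RStarMode, PowerSeries.coeff_mk]
  split_ifs
  · rfl
  · simp

/-- The coefficient of z^k in R⁺ is divisible by p^{max(-k,0)}, and the two modes carry the other
two exponents. -/
theorem coeff_rllTerm_of_lt (i j i'' j'' : Fin N) (a b k : ℤ) (m : ℕ)
    (h : m < (max (-k) 0).toNat + (max (k - a) 0).toNat + (max (-k - b) 0).toNat) :
    PowerSeries.coeff m (rllTerm hbar i j i'' j'' a b k) = 0 := by
  rw [coeff_rllTerm]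
  split_ifs with h1
  · have h2 : k + ((m - ((max (k - a) 0).toNat + (max (-k - b) 0).toNat) : ℕ) : ℤ) < 0 := by omega
    simp only [rCoeff_eq_zero _ _ _ _ _ h2, DynAlg.of_fn_zero, zero_mul, mul_zero,
      Finset.sum_const_zero, sub_zero]
  · rfl

theorem lift_coeff_rllTerm (D : EData N S) (p p'' : Fin N × Fin N) (a b k : ℤ) {m : ℕ}
    (h : (max (-k) 0).toNat + (max (k - a) 0).toNat + (max (-k - b) 0).toNat = m) :
    D.lift (PowerSeries.coeff m (rllTerm hbar p.1 p.2 p''.1 p''.2 a b k)) =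
      ellTerm hbar D p p'' a b k := by
  have h1 : m - ((max (k - a) 0).toNat + (max (-k - b) 0).toNat) = (-k).toNat := by omega
  rw [coeff_rllTerm, if_pos (by omega), h1, ellTerm]
  simp only [map_sub, map_sum, map_mul, map_pow, DynData.lift_of, Fintype.sum_prod_type]
  rfl

/-- This divisibility makes the divided relation exist for every a and b, so `EIdeal` contains a
generator for each coefficient. -/
theorem X_pow_pExp_dvd_rllCoeff (i j i'' j'' : Fin N) (a b : ℤ) :
    X ^ pExp a b ∣ rllCoeff hbar i j i'' j'' a b := by
  rw [PowerSeries.X_pow_dvd_iff]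
  intro m hm
  rw [rllCoeff, PowerSeries.coeff_mk]
  refine finsum_eq_zero_of_forall_eq_zero fun k => coeff_rllTerm_of_lt _ _ _ _ _ _ _ _ ?_
  rw [pExp_eq] at hm
  exact hm.trans_le (le_pExp_summand a b k)

/-- The constant term of the divided relation is the coefficient of p^{e(a,b)}, to which only the
indices k attaining the minimum contribute. -/
theorem lift_constantCoeff_of_mul_eq (D : EData N S) (p p'' : Fin N × Fin N) (a b : ℤ)
    {r : PowerSeries (EFree N)}
    (hr : X ^ pExp a b * r = rllCoeff hbar p.1 p.2 p''.1 p''.2 a b) :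
    D.lift (PowerSeries.constantCoeff r) =
      ∑ k ∈ Finset.Icc (ellLo a b) (ellHi a b), ellTerm hbar D p p'' a b k := by
  have h1 : PowerSeries.constantCoeff r =
      PowerSeries.coeff (pExp a b) (rllCoeff hbar p.1 p.2 p''.1 p''.2 a b) := by
    rw [← hr, PowerSeries.coeff_X_pow_mul', if_pos le_rfl, Nat.sub_self,
      PowerSeries.coeff_zero_eq_constantCoeff_apply]
  rw [h1, rllCoeff, PowerSeries.coeff_mk, finsum_eq_sum_of_support_subset
    (s := Finset.Icc (ellLo a b) (ellHi a b)), map_sum]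
  · refine Finset.sum_congr rfl fun k hk => lift_coeff_rllTerm D p p'' a b k ?_
    rw [pExp_eq, pExp_summand_eq_iff]
    exact Finset.mem_Icc.mp hk
  · intro k hk
    rw [Function.mem_support] at hk
    rw [Finset.coe_Icc, Set.mem_Icc, ← pExp_summand_eq_iff, ← pExp_eq]
    by_contra hne
    refine hk (coeff_rllTerm_of_lt _ _ _ _ _ _ _ _ (lt_of_le_of_ne ?_ (Ne.symm hne)))
    rw [pExp_eq]
    exact le_pExp_summand a b k

end Leading

/-! ### Realizations of the trigonometric relations -/

section TrigLift

variable {N : ℕ} {hbar : ℂ} {S : Type*} [Ring S] [Algebra ℂ S] (T : TData N S)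

theorem lift_L0Mode (sgn : Bool) (i j : Fin N) (m : ℤ) :
    T.lift (L0Mode sgn i j m) = T.L0 sgn m i j := by
  rw [L0Mode, DynData.L0]
  split_ifs
  · rw [DynData.lift_of]
    rfl
  · exact map_zero _

/-- A realization of the trigonometric generators satisfies `TrigRel` if and only if it satisfies the
relations of `IsTrig`. -/
theorem isTrig_iff : IsTrig hbar T ↔ ∀ ⦃x y⦄, TrigRel N hbar x y → T.lift x = T.lift y := by
  have hsame : ∀ sgn i j i'' j'' (a : ℕ) (b : ℤ), T.lift (∑ k ∈ Finset.range (a + 1),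
      ∑ i' : Fin N, ∑ j' : Fin N,
        R0L hbar sgn i j i' j' k * L0Mode sgn i' i'' (a - k) * L0Mode sgn j' j'' (b + k)) -
      T.lift (∑ k ∈ Finset.range (a + 1), ∑ i' : Fin N, ∑ j' : Fin N,
        L0Mode sgn j j' (b + k) * L0Mode sgn i i' (a - k) * R0R hbar sgn i' j' i'' j'' k) =
      ∑ k ∈ Finset.range (a + 1), rllT hbar T.fn sgn 1 1 (T.L0 sgn (a - k)) (T.L0 sgn (b + k))
        (i, j) (i'', j'') k := by
    intro sgn i j i'' j'' a b
    simp only [map_sum, map_mul, lift_L0Mode, R0L, R0R, DynData.lift_of, rllT, one_pow, mul_one,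
      Fintype.sum_prod_type, Finset.sum_sub_distrib, mul_assoc]
    rfl
  have hmixed : ∀ sgn i j i'' j'' (a b : ℕ), T.lift (∑ k ∈ Finset.range (min a b + 1),
      ∑ i' : Fin N, ∑ j' : Fin N, R0L hbar sgn i j i' j' k * DynAlg.of .qc ^ (2 * k) *
          L0Mode sgn i' i'' (a - k) * L0Mode (!sgn) j' j'' (b - k)) -
      T.lift (∑ k ∈ Finset.range (min a b + 1), ∑ i' : Fin N, ∑ j' : Fin N,
        L0Mode (!sgn) j j' (b - k) * L0Mode sgn i i' (a - k) *
          R0R hbar sgn i' j' i'' j'' k * DynAlg.of .qcInv ^ (2 * k)) =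
      ∑ k ∈ Finset.range (min a b + 1), rllT hbar T.fn sgn (T.qc ^ 2) (T.qcInv ^ 2)
        (T.L0 sgn (a - k)) (T.L0 (!sgn) (b - k)) (i, j) (i'', j'') k := by
    intro sgn i j i'' j'' a b
    simp only [map_sum, map_mul, map_pow, lift_L0Mode, R0L, R0R, DynData.lift_of, rllT, pow_mul,
      Fintype.sum_prod_type, Finset.sum_sub_distrib, mul_assoc]
    rfl
  have hzero : ∀ i j : Fin N, T.lift (DynAlg.of (.fn (xL hbar i)) * L0Mode true i j 0 *
      DynAlg.of (.fn (xR hbar j)⁻¹)) =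
      T.fn (xL hbar i) * T.gen (true, i, j, 0) * T.fn (xR hbar j)⁻¹ := by
    intro i j
    rw [map_mul, map_mul, DynData.lift_of, DynData.lift_of, lift_L0Mode]
    rfl
  have hzero' : ∀ i j : Fin N, T.lift (L0Mode false i j 0) = T.gen (false, i, j, 0) := fun i j =>
    lift_L0Mode T false i j 0
  constructor
  · intro h x y hxy
    induction hxy with
    | same sgn i j i'' j'' a b => rw [← sub_eq_zero, hsame, h.same]
    | mixed sgn i j i'' j'' a b => rw [← sub_eq_zero, hmixed, h.mixed]
    | zeroMode i j => rw [hzero, hzero', h.zeroMode]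
  · intro h
    refine ⟨?_, ?_, ?_⟩
    · intro sgn p p'' a b
      rw [← hsame sgn p.1 p.2 p''.1 p''.2, sub_eq_zero]
      exact h (.same sgn _ _ _ _ a b)
    · intro sgn p p'' a b
      rw [← hmixed sgn p.1 p.2 p''.1 p''.2, sub_eq_zero]
      exact h (.mixed sgn _ _ _ _ a b)
    · intro i j
      rw [← hzero', ← hzero]
      exact h (.zeroMode i j)

end TrigLift

/-! ### The two quotients and their universal properties -/

section Quotients

variable {N : ℕ} {hbar : ℂ} {S : Type*} [Ring S] [Algebra ℂ S]

/-- The homomorphism induced on the quotient by a two-sided ideal. -/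
def quotLift {R : Type*} [Ring R] [Algebra ℂ R] (I : TwoSidedIdeal R) (f : R →ₐ[ℂ] S)
    (h : ∀ x ∈ I, f x = 0) : I.ringCon.Quotient →ₐ[ℂ] S :=
  I.ringCon.liftₐ f fun x y hxy => by
    have := h _ ((I.rel_iff x y).mp hxy)
    rw [map_sub, sub_eq_zero] at this
    exact this

theorem quotLift_mk {R : Type*} [Ring R] [Algebra ℂ R] (I : TwoSidedIdeal R) (f : R →ₐ[ℂ] S)
    (h : ∀ x ∈ I, f x = 0) (x : R) : quotLift I f h (I.ringCon.mk' x) = f x := rfl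

theorem mk'_eq_zero {R : Type*} [Ring R] {I : TwoSidedIdeal R} {x : R} (h : x ∈ I) :
    I.ringCon.mk' x = 0 := by
  rw [← TwoSidedIdeal.mem_ker, TwoSidedIdeal.ker_ringCon_mk']
  exact h

/-- The value at `p = 0` of the homomorphism determined by a realization. -/
def DynData.evalZero (D : EData N S) : PowerSeries (EFree N) →ₐ[ℂ] S :=
  D.lift.comp { (PowerSeries.constantCoeff : PowerSeries (EFree N) →+* EFree N) with
    commutes' := fun a => by
      rw [PowerSeries.algebraMap_apply]
      exact PowerSeries.constantCoeff_C _ }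

theorem DynData.evalZero_apply (D : EData N S) (r : PowerSeries (EFree N)) :
    D.evalZero r = D.lift (PowerSeries.constantCoeff r) := rfl

/-- Of the infimum defining the closure only the term n = 1 is needed: the closed ideal lies in the
ideal plus (p), and evaluation kills p. -/
theorem DynData.evalZero_eq_zero (D : EData N S) (h : IsEll hbar D) :
    ∀ x ∈ pClosure (EIdeal N hbar), D.evalZero x = 0 := by
  intro x hx
  have h1 : x ∈ EIdeal N hbar ⊔ TwoSidedIdeal.span {PowerSeries.X ^ 1} :=
    iInf_le (fun n : ℕ => EIdeal N hbar ⊔ TwoSidedIdeal.span {PowerSeries.X ^ n}) 1 hx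
  have h2 : EIdeal N hbar ⊔ TwoSidedIdeal.span {PowerSeries.X ^ 1} ≤
      TwoSidedIdeal.ker D.evalZero := by
    refine sup_le (TwoSidedIdeal.span_le.mpr ?_) (TwoSidedIdeal.span_le.mpr ?_)
    · rintro r ⟨i, j, i'', j'', a, b, hr⟩
      rw [SetLike.mem_coe, TwoSidedIdeal.mem_ker, evalZero_apply,
        lift_constantCoeff_of_mul_eq D (i, j) (i'', j'') a b hr]
      exact h _ _ _ _
    · rintro r rfl
      rw [SetLike.mem_coe, TwoSidedIdeal.mem_ker, evalZero_apply]
      simp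
  exact TwoSidedIdeal.mem_ker _ |>.mp (h2 h1)

/-- The homomorphism from `E_{q,p} / p E_{q,p}` determined by a realization of the relations at
leading order in `p`. -/
def DynData.liftModP (D : EData N S) (h : IsEll hbar D) : EllAlgModP N hbar →ₐ[ℂ] S :=
  quotLift (pIdeal N hbar) (quotLift (pClosure (EIdeal N hbar)) D.evalZero (D.evalZero_eq_zero h))
    (by
      intro x hx
      have h1 : pIdeal N hbar ≤ TwoSidedIdeal.ker
          (quotLift (pClosure (EIdeal N hbar)) D.evalZero (D.evalZero_eq_zero h)) := by
        refine TwoSidedIdeal.span_le.mpr ?_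
        rintro r rfl
        rw [SetLike.mem_coe, TwoSidedIdeal.mem_ker]
        refine (quotLift_mk _ _ _ _).trans ?_
        rw [evalZero_apply]
        simp
      exact TwoSidedIdeal.mem_ker _ |>.mp (h1 hx))

theorem DynData.liftModP_mk (D : EData N S) (h : IsEll hbar D) (r : PowerSeries (EFree N)) :
    D.liftModP h (EllAlgModP.mk N hbar (EllAlg.mk N hbar r)) = D.lift (PowerSeries.constantCoeff r) :=
  rfl

/-- The map from the free algebra to `E_{q,p} / p E_{q,p}`. -/
def toModP (N : ℕ) (hbar : ℂ) : EFree N →ₐ[ℂ] EllAlgModP N hbar where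
  __ := ((EllAlgModP.mk N hbar).comp (EllAlg.mk N hbar)).comp PowerSeries.C
  commutes' a := by
    change EllAlgModP.mk N hbar (EllAlg.mk N hbar (C (algebraMap ℂ (EFree N) a))) = _
    rw [← PowerSeries.algebraMap_apply]
    rfl

theorem toModP_of (a : DynGen N (EIdx N)) :
    toModP N hbar (DynAlg.of a) = EllAlgModP.of a := rfl

/-- A series differs from its constant term by a multiple of p. Hence the free algebra maps onto the
quotient, and homomorphisms can be compared there. -/
theorem toModP_constantCoeff (r : PowerSeries (EFree N)) :
    toModP N hbar (PowerSeries.constantCoeff r) = EllAlgModP.mk N hbar (EllAlg.mk N hbar r) := by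
  have hX : EllAlgModP.mk N hbar (EllAlg.mk N hbar PowerSeries.X) = 0 :=
    mk'_eq_zero (TwoSidedIdeal.subset_span rfl)
  have h1 : X ∣ r - C (PowerSeries.constantCoeff r) := by
    rw [PowerSeries.X_dvd_iff]
    simp
  obtain ⟨s, hs⟩ := h1
  rw [eq_comm, ← sub_eq_zero]
  change EllAlgModP.mk N hbar (EllAlg.mk N hbar r) -
    EllAlgModP.mk N hbar (EllAlg.mk N hbar (C (PowerSeries.constantCoeff r))) = 0
  rw [← map_sub, ← map_sub, hs, map_mul, map_mul, hX, zero_mul]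

/-- The generators of `E_{q,p} / p E_{q,p}`. -/
def ellData (N : ℕ) (hbar : ℂ) : EData N (EllAlgModP N hbar) :=
  (DynData.univ N _ _ _ _).map (toModP N hbar)

theorem univ_onGen {G : Type} {row col : G → Fin N} {deg : G → ℤ} (φ : DynAlg N G row col deg →ₐ[ℂ] S)
    (a : DynGen N G) : ((DynData.univ N G row col deg).map φ).onGen a = φ (DynAlg.of a) := by
  cases a <;> rfl

theorem lift_univ_map {G : Type} {row col : G → Fin N} {deg : G → ℤ}
    (φ : DynAlg N G row col deg →ₐ[ℂ] S) : ((DynData.univ N G row col deg).map φ).lift = φ :=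
  DynAlg.algHom_ext fun a => by rw [DynData.lift_of, univ_onGen]

/-- A divided relation is 0 in the elliptic algebra, and modulo p it equals its constant term, which
is the leading-order relation. -/
theorem isEll_ellData : IsEll hbar (ellData N hbar) := by
  intro p p'' a b
  obtain ⟨r, hr⟩ := X_pow_pExp_dvd_rllCoeff (hbar := hbar) p.1 p.2 p''.1 p''.2 a b
  rw [← lift_constantCoeff_of_mul_eq (ellData N hbar) p p'' a b hr.symm, ellData, lift_univ_map,
    toModP_constantCoeff]
  have h1 : r ∈ pClosure (EIdeal N hbar) := by
    refine (le_iInf fun n => le_sup_left : EIdeal N hbar ≤ pClosure (EIdeal N hbar)) ?_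
    exact TwoSidedIdeal.subset_span ⟨p.1, p.2, p''.1, p''.2, a, b, hr.symm⟩
  rw [show EllAlg.mk N hbar r = 0 from mk'_eq_zero h1, map_zero]

/-- The map from the free algebra to the trigonometric algebra. -/
def toTrigAlg (N : ℕ) (hbar : ℂ) : TFree N →ₐ[ℂ] TrigAlg N hbar :=
  RingQuot.mkAlgHom ℂ (TrigRel N hbar)

theorem toTrigAlg_of (a : DynGen N (TIdx N)) :
    toTrigAlg N hbar (DynAlg.of a) = TrigAlg.of a := by
  rw [TrigAlg.of, ← RingQuot.mkAlgHom_coe ℂ]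
  rfl

/-- The generators of the trigonometric algebra. -/
def trigData (N : ℕ) (hbar : ℂ) : TData N (TrigAlg N hbar) :=
  (DynData.univ N _ _ _ _).map (toTrigAlg N hbar)

theorem isTrig_trigData : IsTrig hbar (trigData N hbar) := by
  rw [isTrig_iff]
  intro x y h
  rw [trigData, lift_univ_map]
  exact RingQuot.mkAlgHom_rel ℂ h

theorem DynData.ext_data {G : Type} {row col : G → Fin N} {deg : G → ℤ}
    {D D' : DynData N G row col deg S} (h1 : D.fn = D'.fn) (h2 : D.gen = D'.gen) (h3 : D.d = D'.d)
    (h4 : D.qc = D'.qc) (h5 : D.qcInv = D'.qcInv) : D = D' := by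
  cases D
  cases D'
  subst h1 h2 h3 h4 h5
  rfl

/-- The zero-mode relation is indispensable here, as `toEll` discards the degree-0 modes of L⁻. -/
theorem DynData.toTrig_toEll (T : TData N S) (h : IsTrig hbar T) :
    (T.toEll hbar).toTrig hbar = T := by
  refine DynData.ext_data rfl ?_ rfl rfl rfl
  funext ⟨sgn, i, j, m⟩
  cases sgn
  · exact DynData.toEll_minus T hbar h.zeroMode i j m
  · exact DynData.toEll_gen_neg T hbar i j m

theorem DynData.toEll_toTrig (D : EData N S) : (D.toTrig hbar).toEll hbar = D := by
  refine DynData.ext_data rfl ?_ rfl rfl rfl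
  funext ⟨i, j, n⟩
  by_cases h : 0 < n
  · lift n to ℕ using h.le
    simp only [toEll, toTrig, h, if_true, Int.toNat_natCast, minus, Bool.false_eq_true, if_false]
    have hp : Commute (D.qc ^ (2 * n)) (D.fn (xR hbar j)) := (D.commute_qc_fn _).pow_left _
    calc _ = (D.fn (xL hbar i)⁻¹ * D.fn (xL hbar i)) * D.gen (i, j, (n : ℤ)) *
          (D.fn (xR hbar j)⁻¹ * (D.qc ^ (2 * n) * D.fn (xR hbar j))) * D.qcInv ^ (2 * n) := by
          simp only [mul_assoc]
      _ = D.gen (i, j, (n : ℤ)) * (D.fn (xR hbar j)⁻¹ * D.fn (xR hbar j)) *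
          (D.qc ^ (2 * n) * D.qcInv ^ (2 * n)) := by
          rw [D.fn_inv_mul_fn (xL_ne_zero i), hp.eq, one_mul]
          simp only [mul_assoc]
      _ = _ := by rw [D.fn_inv_mul_fn (xR_ne_zero j), D.pow_cancel', mul_one, mul_one]
  · simp only [toEll, toTrig, h, if_false, if_true]
    rw [Int.toNat_of_nonneg (by omega), neg_neg]

theorem DynData.map_onGen {G : Type} {row col : G → Fin N} {deg : G → ℤ} {S' : Type*} [Ring S']
    [Algebra ℂ S'] (D : DynData N G row col deg S) (φ : S →ₐ[ℂ] S') (a : DynGen N G) :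
    (D.map φ).onGen a = φ (D.onGen a) := by
  cases a <;> rfl

/-- Naturality of the change of generators, by which composites of the two homomorphisms are
computed on generators. -/
theorem DynData.toEll_map {S' : Type*} [Ring S'] [Algebra ℂ S'] (T : TData N S) (φ : S →ₐ[ℂ] S') :
    (T.map φ).toEll hbar = (T.toEll hbar).map φ := by
  refine DynData.ext_data rfl ?_ rfl rfl rfl
  funext ⟨i, j, n⟩
  by_cases h : 0 < n
  · simp only [toEll, DynData.map, h, if_true, map_mul, map_pow, AlgHom.comp_apply]
  · simp only [toEll, DynData.map, h, if_false]

theorem DynData.toTrig_map {S' : Type*} [Ring S'] [Algebra ℂ S'] (D : EData N S) (φ : S →ₐ[ℂ] S') :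
    (D.map φ).toTrig hbar = (D.toTrig hbar).map φ := by
  refine DynData.ext_data rfl ?_ rfl rfl rfl
  funext ⟨sgn, i, j, m⟩
  cases sgn
  · simp only [toTrig, DynData.map, minus, map_mul, map_pow, AlgHom.comp_apply, Bool.false_eq_true,
      if_false]
  · rfl

theorem DynData.map_eq_of_lift {G : Type} {row col : G → Fin N} {deg : G → ℤ}
    {D : DynData N G row col deg S} {φ : DynAlg N G row col deg →ₐ[ℂ] S} (h : D.lift = φ) :
    D = (DynData.univ N G row col deg).map φ := by
  subst h
  refine DynData.ext_data (AlgHom.ext fun f => ?_) (funext fun g => ?_) ?_ ?_ ?_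
  · exact (D.lift_of (.fn f)).symm
  · exact (D.lift_of (.gen g)).symm
  · exact (D.lift_of .d).symm
  · exact (D.lift_of .qc).symm
  · exact (D.lift_of .qcInv).symm

theorem isEll_toEll_trigData (hN : 1 ≤ N) (hq : ‖Complex.exp hbar‖ < 1) :
    IsEll hbar ((trigData N hbar).toEll hbar) := by
  rw [isEll_iff_isTrig _ hN hq, DynData.toTrig_toEll _ isTrig_trigData]
  exact isTrig_trigData

theorem isTrig_toTrig_ellData (hN : 1 ≤ N) (hq : ‖Complex.exp hbar‖ < 1) :
    IsTrig hbar ((ellData N hbar).toTrig hbar) :=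
  (isEll_iff_isTrig _ hN hq).mp isEll_ellData

end Quotients

end EllipticGL
end

noncomputable section

namespace EllipticGL

/-! ### The isomorphism -/

section Isomorphism

variable {N : ℕ} {hbar : ℂ}

/-- The homomorphism from `E_{q,p} / p E_{q,p}` to the trigonometric algebra. -/
def ellToTrig (hN : 1 ≤ N) (hq : ‖Complex.exp hbar‖ < 1) :
    EllAlgModP N hbar →ₐ[ℂ] TrigAlg N hbar :=
  ((trigData N hbar).toEll hbar).liftModP (isEll_toEll_trigData hN hq)

theorem ellToTrig_of (hN : 1 ≤ N) (hq : ‖Complex.exp hbar‖ < 1) (a : DynGen N (EIdx N)) :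
    ellToTrig hN hq (EllAlgModP.of a) = ((trigData N hbar).toEll hbar).onGen a := by
  rw [EllAlgModP.of, ellToTrig, DynData.liftModP_mk, PowerSeries.constantCoeff_C, DynData.lift_of]

/-- The homomorphism from the trigonometric algebra to `E_{q,p} / p E_{q,p}`. -/
def trigToEll (hN : 1 ≤ N) (hq : ‖Complex.exp hbar‖ < 1) :
    TrigAlg N hbar →ₐ[ℂ] EllAlgModP N hbar :=
  RingQuot.liftAlgHom ℂ ⟨((ellData N hbar).toTrig hbar).lift,
    (isTrig_iff _).mp (isTrig_toTrig_ellData hN hq)⟩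

theorem trigToEll_toTrigAlg (hN : 1 ≤ N) (hq : ‖Complex.exp hbar‖ < 1) (x : TFree N) :
    trigToEll hN hq (toTrigAlg N hbar x) = ((ellData N hbar).toTrig hbar).lift x :=
  RingQuot.liftAlgHom_mkAlgHom_apply _ _ _ _

theorem map_trigData (hN : 1 ≤ N) (hq : ‖Complex.exp hbar‖ < 1) :
    (trigData N hbar).map (trigToEll hN hq) = (ellData N hbar).toTrig hbar := by
  rw [DynData.map_eq_of_lift (φ := (trigToEll hN hq).comp (toTrigAlg N hbar))
    (D := (ellData N hbar).toTrig hbar)]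
  · rfl
  · exact AlgHom.ext fun x => (trigToEll_toTrigAlg hN hq x).symm

theorem map_ellData (hN : 1 ≤ N) (hq : ‖Complex.exp hbar‖ < 1) :
    (ellData N hbar).map (ellToTrig hN hq) = (trigData N hbar).toEll hbar := by
  rw [DynData.map_eq_of_lift (φ := (ellToTrig (N := N) (hbar := hbar) hN hq).comp (toModP N hbar))
    (D := (trigData N hbar).toEll hbar)]
  · rfl
  · refine DynAlg.algHom_ext (S := TrigAlg N hbar) fun a => ?_
    exact (DynData.lift_of _ a).trans (ellToTrig_of hN hq a).symm

/-- On generators the composite is `toEll` applied to `toTrig`, which gives back the tautological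
realization. -/
theorem trigToEll_ellToTrig (hN : 1 ≤ N) (hq : ‖Complex.exp hbar‖ < 1) (x : EllAlgModP N hbar) :
    trigToEll hN hq (ellToTrig hN hq x) = x := by
  obtain ⟨y, rfl⟩ := RingCon.mk'_surjective _ x
  obtain ⟨r, rfl⟩ := RingCon.mk'_surjective _ y
  change trigToEll hN hq (ellToTrig hN hq (EllAlgModP.mk N hbar (EllAlg.mk N hbar r))) =
    EllAlgModP.mk N hbar (EllAlg.mk N hbar r)
  rw [← toModP_constantCoeff]
  have h : ((trigToEll hN hq).comp (ellToTrig hN hq)).comp (toModP N hbar) = toModP N hbar := by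
    refine DynAlg.algHom_ext (S := EllAlgModP N hbar) fun a => ?_
    rw [AlgHom.comp_apply, AlgHom.comp_apply, toModP_of, ellToTrig_of]
    refine (DynData.map_onGen (S := TrigAlg N hbar) (S' := EllAlgModP N hbar) _ (trigToEll hN hq) a).symm.trans ?_
    rw [← DynData.toEll_map, map_trigData, DynData.toEll_toTrig, ellData, univ_onGen, toModP_of]
  exact DFunLike.congr_fun h _

theorem ellToTrig_comp_trigToEll (hN : 1 ≤ N) (hq : ‖Complex.exp hbar‖ < 1) :
    (ellToTrig hN hq).comp (trigToEll hN hq) = AlgHom.id ℂ _ := by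
  refine RingQuot.ringQuot_ext' ℂ _ _ ?_
  refine DynAlg.algHom_ext (S := TrigAlg N hbar) fun a => ?_
  change ellToTrig hN hq (trigToEll hN hq (toTrigAlg N hbar (DynAlg.of a))) =
    toTrigAlg N hbar (DynAlg.of a)
  rw [trigToEll_toTrigAlg, DynData.lift_of]
  refine (DynData.map_onGen (S := EllAlgModP N hbar) (S' := TrigAlg N hbar) _ (ellToTrig hN hq) a).symm.trans ?_
  rw [← DynData.toTrig_map, map_ellData, DynData.toTrig_toEll _ isTrig_trigData, trigData, univ_onGen]

/-- The isomorphism of `E_{q,p} / p E_{q,p}` with the trigonometric algebra. -/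
def ellEquivTrig (hN : 1 ≤ N) (hq : ‖Complex.exp hbar‖ < 1) :
    EllAlgModP N hbar ≃ₐ[ℂ] TrigAlg N hbar :=
  AlgEquiv.ofAlgHom (ellToTrig hN hq) (trigToEll hN hq) (ellToTrig_comp_trigToEll hN hq)
    (AlgHom.ext (trigToEll_ellToTrig hN hq))

theorem trigData_onGen (a : DynGen N (TIdx N)) :
    (trigData N hbar).onGen a = TrigAlg.of a := by
  rw [trigData, univ_onGen, toTrigAlg_of]

end Isomorphism

end EllipticGL

end

theorem mainTheorem12 (N : ℕ) (hN : 1 ≤ N) (hbar : ℂ) (hq : ‖Complex.exp hbar‖ < 1) :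
    ∃ φ : EllipticGL.EllAlgModP N hbar ≃+* EllipticGL.TrigAlg N hbar,
      (∀ f : EllipticGL.FF N,
        φ (EllipticGL.EllAlgModP.of (.fn f)) = EllipticGL.TrigAlg.of (.fn f)) ∧
      φ (EllipticGL.EllAlgModP.of .d) = EllipticGL.TrigAlg.of .d ∧
      φ (EllipticGL.EllAlgModP.of .qc) = EllipticGL.TrigAlg.of .qc ∧
      φ (EllipticGL.EllAlgModP.of .qcInv) = EllipticGL.TrigAlg.of .qcInv ∧
      (∀ (i j : Fin N) (m : ℕ),
        φ (EllipticGL.EllAlgModP.of (.gen (i, j, -(m : ℤ)))) =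
          EllipticGL.TrigAlg.of (.gen (true, i, j, m))) ∧
      (∀ (i j : Fin N) (m : ℕ),
        φ (EllipticGL.EllAlgModP.of (.fn (EllipticGL.xL hbar i)) *
            EllipticGL.EllAlgModP.of (.gen (i, j, (m : ℤ))) *
            EllipticGL.EllAlgModP.of (.fn (EllipticGL.xR hbar j)⁻¹) *
            EllipticGL.EllAlgModP.of .qc ^ (2 * m)) =
          EllipticGL.TrigAlg.of (.gen (false, i, j, m))) := by
  have key : ∀ a, (EllipticGL.ellEquivTrig hN hq).toRingEquiv (EllipticGL.EllAlgModP.of a) =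
      ((EllipticGL.trigData N hbar).toEll hbar).onGen a := EllipticGL.ellToTrig_of hN hq
  refine ⟨(EllipticGL.ellEquivTrig hN hq).toRingEquiv, fun f => ?_, ?_, ?_, ?_, fun i j m => ?_,
    fun i j m => ?_⟩
  · exact (key _).trans (EllipticGL.trigData_onGen (.fn f))
  · exact (key _).trans (EllipticGL.trigData_onGen .d)
  · exact (key _).trans (EllipticGL.trigData_onGen .qc)
  · exact (key _).trans (EllipticGL.trigData_onGen .qcInv)
  · rw [key, ← EllipticGL.trigData_onGen]
    exact EllipticGL.DynData.toEll_gen_neg _ hbar i j m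
  -- The image is the twisted mode built from `toEll`; for m > 0 the twists cancel, and for m = 0
  -- the zero-mode relation applies.
  · rw [map_mul, map_mul, map_mul, map_pow, key, key, key, key, ← EllipticGL.trigData_onGen]
    exact EllipticGL.DynData.toEll_minus _ hbar EllipticGL.isTrig_trigData.zeroMode i j m
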